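/- Let $M$ be a smooth manifold with a closed real 3-form $H$. Write $\mathbb{T}M=TM\oplus T^*M$, $\langle X+\alpha,Y+\beta\rangle=\iota_X\beta+\iota_Y\alpha$ and $[X+\alpha,Y+\beta]_H=[X,Y]+\mathcal{L}_X\beta-\iota_Y d\alpha+\iota_X\iota_Y H$; for a complex closed 3-form $\mathcal{H}$ the same formula defines a complex Courant algebroid $(\mathbb{T}_{\mathbb{C}}M,\mathcal{H})$. For a 2-form $B$ let $e^B(X+\alpha)=X+\alpha+\iota_XB$. Let $(\mathbb{J}_A,\mathbb{J}_B)$ be a generalized Kähler structure on $(M,H)$: commuting smooth complex structures on $\mathbb{T}M$ whose $+i$ eigenbundles are maximal isotropic and involutive for $[\cdot,\cdot]_H$, and such that $\langle\mathbb{J}_A\cdot,\mathbb{J}_B\cdot\rangle$ is positive definite. Then there are a unique 2-form $b$ and unique bihermitian data $(g,I_+,I_-)$ ($g$ a Riemannian metric, $I_\pm$ almost complex structures orthogonal for $g$) with $$e^{-b}\mathbb{J}_{A}e^{b}=\tfrac12\begin{pmatrix}I_++I_-&(I_+-I_-)g^{-1}\\ g(I_+-I_-)&-(I_+^*+I_-^*)\end{pmatrix},\qquad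 e^{-b}\mathbb{J}_{B}e^{b}=\tfrac12\begin{pmatrix}I_+-I_-&(I_++I_-)g^{-1}\\ g(I_++I_-)&-(I_+^*-I_-^*)\end{pmatrix}.$$ These tensors are smooth, $I_\pm$ are integrable (so $X_\pm=(M,I_\pm)$ are complex manifolds), and, with $\omega_\pm=gI_\pm$ and $d^c_\pm=i(\bar\partial_\pm-\partial_\pm)$, one has $d^c_+\omega_+=-d^c_-\omega_-=H-db$. (When $\mathbb{T}M$ is split by the generalized metric, $b=0$.) Let $L_A,L_B\subset\mathbb{T}_{\mathbb{C}}M$ be the $+i$ eigenbundles of $e^{-b}\mathbb{J}_Ae^b,\ e^{-b}\mathbb{J}_Be^b$, let $\mathbb{T}_{1,0}X_\pm=T_{1,0}X_\pm\oplus T^*_{1,0}X_\pm$, and let $\mathcal{E}_\pm$ be the holomorphic Courant algebroid on $\mathbb{T}_{1,0}X_\pm$ defined by the closed form $\mathcal{H}_\pm=\mp2i\,\partial_\pm\omega_\pm$ of type $(2,1)+(3,0)$, i.e. with Dolbeault operator $\overline{D}_Xa=\pi_{1,0}[X,a]_{\mathcal{H}_\pm}$ ($X$ of type $(0,1)$)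 and bracket $\pi_{1,0}[a,a']_{\mathcal{H}_\pm}$. Put $$\mathcal{A}_+=\mathbb{T}_{1,0}X_+\cap e^{-i\omega_+}\overline{L_A},\quad \mathcal{B}_+=\mathbb{T}_{1,0}X_+\cap e^{-i\omega_+}\overline{L_B},\quad \mathcal{A}_-=\mathbb{T}_{1,0}X_-\cap e^{i\omega_-}\overline{L_A},\quad \mathcal{B}_-=\mathbb{T}_{1,0}X_-\cap e^{i\omega_-}L_B.$$ Then $(\mathcal{E}_\pm,\mathcal{A}_\pm,\mathcal{B}_\pm)$ are holomorphic Manin triples over $X_\pm$: $\mathcal{A}_\pm,\mathcal{B}_\pm$ are holomorphic Dirac structures and $\mathcal{E}_\pm=\mathcal{A}_\pm\oplus\mathcal{B}_\pm$. The matched pair of a holomorphic Courant algebroid over $X$ defined by $\mathcal{H}$ is $(\mathbb{T}_{\mathbb{C}}M,\mathcal{H})$, and that of a holomorphic Dirac structure $\mathcal{A}$ in it is $L_{\mathcal{A}}=\mathcal{A}\oplus T_{0,1}X$; the complex conjugate triple $(\overline{\mathcal{E}_\pm},\overline{\mathcal{A}_\pm},\overline{\mathcal{B}_\pm})$ lives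 on $\overline{X_\pm}=(M,-I_\pm)$ and is defined by $\overline{\mathcal{H}_\pm}$. The following gauge transformations are isomorphisms of smooth complex Courant algebroids between matched pairs, taking Dirac structures to Dirac structures as indicated: * vertically, $e^{-i(\omega_++\omega_-)}$ maps the matched pair of $\mathcal{E}_-$ to that of $\mathcal{E}_+$ and $L_{\mathcal{A}_-}$ onto $L_{\mathcal{A}_+}$; it also maps the matched pair of $\overline{\mathcal{E}_+}$ to that of $\overline{\mathcal{E}_-}$ and $L_{\overline{\mathcal{A}_+}}$ onto $L_{\overline{\mathcal{A}_-}}$; * horizontally, $e^{i(\omega_+-\omega_-)}$ maps the matched pair of $\mathcal{E}_+$ to that of $\overline{\mathcal{E}_-}$ and $L_{\mathcal{B}_+}$ onto $L_{\overline{\mathcal{B}_-}}$; it also maps the matched pair of $\mathcal{E}_-$ to that of $\overline{\mathcal{E}_+}$ and $L_{\mathcal{B}_-}$ onto $L_{\overline{\mathcal{B}_+}}$. The vertical maps intertwine only the Dirac structures of type $\mathcal{A}$, and the horizontal ones only those of type $\mathcal{B}$: if $\dim M>0$, then at no point of $M$ do the vertical maps take $L_{\mathcal{B}_-}$ to $L_{\mathcal{B}_+}$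 or $L_{\overline{\mathcal{B}_+}}$ to $L_{\overline{\mathcal{B}_-}}$, nor the horizontal ones $L_{\mathcal{A}_+}$ to $L_{\overline{\mathcal{A}_-}}$ or $L_{\mathcal{A}_-}$ to $L_{\overline{\mathcal{A}_+}}$. -/

import Mathlib

open scoped Manifold ContDiff Topology

noncomputable section

set_option linter.unusedSectionVars false

namespace GenKahler

/-! ## Linear algebra of one fibre -/

/-- The complexification `V ⊗ ℂ` of a real vector space, as formal sums `re + i im`. -/
@[ext] structure Cx (V : Type*) where
  re : V
  im : V

namespace Cx

variable {V : Type*} [AddCommGroup V]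

/-- The underlying pair of real vectors. -/
def toProd (V : Type*) : Cx V ≃ V × V where
  toFun X := (X.re, X.im)
  invFun p := ⟨p.1, p.2⟩

instance : AddCommGroup (Cx V) := (toProd V).addCommGroup

@[simp] theorem re_zero : (0 : Cx V).re = 0 := rfl
@[simp] theorem im_zero : (0 : Cx V).im = 0 := rfl
@[simp] theorem re_add (X Y : Cx V) : (X + Y).re = X.re + Y.re := rfl
@[simp] theorem im_add (X Y : Cx V) : (X + Y).im = X.im + Y.im := rfl
@[simp] theorem re_neg (X : Cx V) : (-X).re = -X.re := rfl
@[simp] theorem im_neg (X : Cx V) : (-X).im = -X.im := rfl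
@[simp] theorem re_sub (X Y : Cx V) : (X - Y).re = X.re - Y.re := rfl
@[simp] theorem im_sub (X Y : Cx V) : (X - Y).im = X.im - Y.im := rfl

variable [Module ℝ V]

instance : SMul ℂ (Cx V) :=
  ⟨fun c X => ⟨c.re • X.re - c.im • X.im, c.re • X.im + c.im • X.re⟩⟩

@[simp] theorem re_smul (c : ℂ) (X : Cx V) : (c • X).re = c.re • X.re - c.im • X.im := rfl
@[simp] theorem im_smul (c : ℂ) (X : Cx V) : (c • X).im = c.re • X.im + c.im • X.re := rfl

instance : Module ℂ (Cx V) where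
  one_smul X := by ext <;> simp
  mul_smul c d X := by ext <;> simp <;> module
  smul_zero c := by ext <;> simp
  smul_add c X Y := by ext <;> simp <;> module
  add_smul c d X := by ext <;> simp <;> module
  zero_smul X := by ext <;> simp

/-- Complex conjugation. -/
def conj (X : Cx V) : Cx V := ⟨X.re, -X.im⟩

/-- The complex-linear extension of a real endomorphism. -/
def map (f : V →ₗ[ℝ] V) : Cx V →ₗ[ℂ] Cx V where
  toFun X := ⟨f X.re, f X.im⟩
  map_add' X Y := by ext <;> simp
  map_smul' c X := by ext <;> simp

end Cx

section Fibre

variable {V : Type*} [AddCommGroup V] [Module ℝ V] [TopologicalSpace V]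
  [IsTopologicalAddGroup V] [ContinuousSMul ℝ V]
  {F : Type*} [NormedAddCommGroup F] [NormedSpace ℝ F]

/-- The fibre `V ⊕ V*` of the generalized tangent bundle. -/
abbrev GT (V : Type*) [AddCommGroup V] [Module ℝ V] [TopologicalSpace V] : Type _ :=
  V × (V →L[ℝ] ℝ)

/-- The fibre `(V ⊕ V*) ⊗ ℂ`; complex covectors are real-linear maps `V → ℂ`. -/
abbrev GTC (V : Type*) [AddCommGroup V] [Module ℝ V] [TopologicalSpace V] : Type _ :=
  Cx V × (V →L[ℝ] ℂ)

/-- The complex-linear extension of a complex covector, evaluated on a complex vector. -/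
def evalC (β : V →L[ℝ] ℂ) (X : Cx V) : ℂ := β X.re + Complex.I * β X.im

/-- The pairing `⟨X + α, Y + β⟩ = ι_X β + ι_Y α` on `V ⊕ V*`. -/
def pairing (u v : GT V) : ℝ := v.2 u.1 + u.2 v.1

/-- The complex-bilinear extension of the pairing. -/
def pairingC (u v : GTC V) : ℂ := evalC v.2 u.1 + evalC u.2 v.1

/-- Real part of an element of `(V ⊕ V*) ⊗ ℂ`. -/
def reG (u : GTC V) : GT V := (u.1.re, Complex.reCLM.comp u.2)

/-- Imaginary part of an element of `(V ⊕ V*) ⊗ ℂ`. -/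
def imG (u : GTC V) : GT V := (u.1.im, Complex.imCLM.comp u.2)

/-- The inclusion of `V ⊕ V*` in its complexification. -/
def ofRealG (u : GT V) : GTC V := (⟨u.1, 0⟩, Complex.ofRealCLM.comp u.2)

/-- Complex conjugation on `(V ⊕ V*) ⊗ ℂ`. -/
def conjG (u : GTC V) : GTC V := (u.1.conj, Complex.conjCLE.toContinuousLinearMap.comp u.2)

/-- The complex-linear extension of a real endomorphism of `V ⊕ V*`. -/
def complexify (J : GT V →ₗ[ℝ] GT V) : GTC V →ₗ[ℂ] GTC V where
  toFun u := ofRealG (J (reG u)) + Complex.I • ofRealG (J (imG u))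
  map_add' u v := by
    have h1 : reG (u + v) = reG u + reG v := by
      ext <;> simp [reG]
    have h2 : imG (u + v) = imG u + imG v := by
      ext <;> simp [imG]
    rw [h1, h2, map_add, map_add]
    ext <;> simp [ofRealG] <;> ring
  map_smul' c u := by
    have h1 : reG (c • u) = c.re • reG u - c.im • imG u := by
      ext <;> simp [reG, imG]
    have h2 : imG (c • u) = c.re • imG u + c.im • reG u := by
      ext <;> simp [reG, imG]
    rw [h1, h2, map_sub, map_add, map_smul, map_smul, map_smul, map_smul]
    generalize J (reG u) = p
    generalize J (imG u) = q
    refine Prod.ext ?_ ?_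
    · ext <;> simp [ofRealG] <;> abel
    · ext Z
      apply Complex.ext <;> simp [ofRealG] <;> ring

/-- The `+i` eigenspace of a real endomorphism of `V ⊕ V*`. -/
def eigenG (J : GT V →ₗ[ℝ] GT V) : Submodule ℂ (GTC V) :=
  Module.End.eigenspace (complexify J) Complex.I

/-- The complex conjugate of a complex subspace. -/
def conjSub (L : Submodule ℂ (GTC V)) : Submodule ℂ (GTC V) where
  carrier := {u | conjG u ∈ L}
  zero_mem' := by
    have : conjG (0 : GTC V) = 0 := by ext <;> simp [conjG, Cx.conj]
    simp [this]
  add_mem' {u v} hu hv := by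
    have : conjG (u + v) = conjG u + conjG v := by
      ext <;> simp [conjG, Cx.conj]
      abel
    simpa [this] using L.add_mem hu hv
  smul_mem' c u hu := by
    have : conjG (c • u) = (starRingEnd ℂ c) • conjG u := by
      ext <;> simp [conjG, Cx.conj]
      abel
    simpa [this] using L.smul_mem _ hu

/-- `L` is maximal isotropic (Lagrangian) in the subspace `W`: it is contained in `W` and
equals its own orthogonal in `W`. -/
def IsLagrangianIn (W L : Submodule ℂ (GTC V)) : Prop :=
  L ≤ W ∧ ∀ u ∈ W, (u ∈ L ↔ ∀ v ∈ L, pairingC u v = 0)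

/-- A one-form, as an alternating map of one variable. -/
def oneForm (α : V →L[ℝ] F) : V [⋀^Fin 1]→L[ℝ] F :=
  ContinuousAlternatingMap.ofSubsingleton ℝ V F (0 : Fin 1) α

/-- An alternating map of one variable, as a covector. -/
def toCovector (η : V [⋀^Fin 1]→L[ℝ] F) : V →L[ℝ] F :=
  (ContinuousAlternatingMap.ofSubsingleton ℝ V F (0 : Fin 1)).symm η

/-- The interior product `ι_X η = η(X, ·, …, ·)`. -/
def interior {n : ℕ} (X : V) (η : V [⋀^Fin (n + 1)]→L[ℝ] F) : V [⋀^Fin n]→L[ℝ] F where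
  toMultilinearMap := (η.toAlternatingMap.curryLeft X).toMultilinearMap
  map_eq_zero_of_eq' := (η.toAlternatingMap.curryLeft X).map_eq_zero_of_eq'
  cont := by
    change Continuous fun v : Fin n → V => η (Matrix.vecCons X v)
    exact η.cont.comp (continuous_const.matrixVecCons continuous_id)

/-- The interior product of a complex form with a complex vector. -/
def interiorC {n : ℕ} (X : Cx V) (η : V [⋀^Fin (n + 1)]→L[ℝ] ℂ) : V [⋀^Fin n]→L[ℝ] ℂ :=
  interior X.re η + Complex.I • interior X.im η

/-- A real form, as a complex form. -/
def cxForm {n : ℕ} (η : V [⋀^Fin n]→L[ℝ] ℝ) : V [⋀^Fin n]→L[ℝ] ℂ :=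
  Complex.ofRealCLM.compContinuousAlternatingMap η

/-- The complex conjugate of a complex form. -/
def conjForm {n : ℕ} (η : V [⋀^Fin n]→L[ℝ] ℂ) : V [⋀^Fin n]→L[ℝ] ℂ :=
  Complex.conjCLE.toContinuousLinearMap.compContinuousAlternatingMap η

/-- The gauge transformation `e^B : X + α ↦ X + α + ι_X B` of a complex two-form `B`. -/
def gauge (B : V [⋀^Fin 2]→L[ℝ] ℂ) : GTC V →ₗ[ℂ] GTC V where
  toFun u := (u.1, u.2 + toCovector (interiorC u.1 B))
  map_add' u v := by
    refine Prod.ext rfl ?_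
    ext Z
    have h : ∀ X Y : V, B (Matrix.vecCons (X + Y) (fun _ => Z)) =
        B (Matrix.vecCons X (fun _ => Z)) + B (Matrix.vecCons Y (fun _ => Z)) :=
      fun X Y => B.toAlternatingMap.map_vecCons_add _ _ _
    change (u.2 + v.2) Z + (B (Matrix.vecCons (u.1.re + v.1.re) fun _ => Z) +
      Complex.I * B (Matrix.vecCons (u.1.im + v.1.im) fun _ => Z)) =
      (u.2 Z + (B (Matrix.vecCons u.1.re fun _ => Z) +
        Complex.I * B (Matrix.vecCons u.1.im fun _ => Z))) +
      (v.2 Z + (B (Matrix.vecCons v.1.re fun _ => Z) +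
        Complex.I * B (Matrix.vecCons v.1.im fun _ => Z)))
    rw [h, h, add_apply]
    ring
  map_smul' c u := by
    refine Prod.ext rfl ?_
    ext Z
    have ha : ∀ X Y : V, B (Matrix.vecCons (X + Y) (fun _ => Z)) =
        B (Matrix.vecCons X (fun _ => Z)) + B (Matrix.vecCons Y (fun _ => Z)) :=
      fun X Y => B.toAlternatingMap.map_vecCons_add _ _ _
    have hs : ∀ (r : ℝ) (X : V), B (Matrix.vecCons (r • X) (fun _ => Z)) =
        r • B (Matrix.vecCons X (fun _ => Z)) :=
      fun r X => B.toAlternatingMap.map_vecCons_smul _ _ _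
    change c * u.2 Z + (B (Matrix.vecCons (c.re • u.1.re - c.im • u.1.im) fun _ => Z) +
      Complex.I * B (Matrix.vecCons (c.re • u.1.im + c.im • u.1.re) fun _ => Z)) =
      c * (u.2 Z + (B (Matrix.vecCons u.1.re fun _ => Z) +
        Complex.I * B (Matrix.vecCons u.1.im fun _ => Z)))
    rw [sub_eq_add_neg, ← neg_smul, ha, ha, hs, hs, hs, hs]
    simp only [Complex.real_smul]
    push_cast
    generalize B (Matrix.vecCons u.1.re fun _ => Z) = p
    generalize B (Matrix.vecCons u.1.im fun _ => Z) = q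
    obtain ⟨a, b⟩ := c
    apply Complex.ext <;> simp <;> ring

/-- The real gauge transformation `e^b : X + ξ ↦ X + ξ + ι_X b`, on vectors. -/
def gaugeR (b : V [⋀^Fin 2]→L[ℝ] ℝ) (u : GT V) : GT V :=
  (u.1, u.2 + toCovector (interior u.1 b))

/-! ### Types with respect to a complex structure -/

/-- The projection `½(1 - iI)` of `V ⊗ ℂ` to vectors of type `(1,0)`. -/
def P10 (J : V →L[ℝ] V) : Cx V →ₗ[ℂ] Cx V :=
  (1 / 2 : ℂ) • (LinearMap.id - Complex.I • Cx.map (J : V →ₗ[ℝ] V))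

/-- The projection `½(1 + iI)` of `V ⊗ ℂ` to vectors of type `(0,1)`. -/
def P01 (J : V →L[ℝ] V) : Cx V →ₗ[ℂ] Cx V :=
  (1 / 2 : ℂ) • (LinearMap.id + Complex.I • Cx.map (J : V →ₗ[ℝ] V))

/-- Vectors of type `(1,0)`. -/
def T10 (J : V →L[ℝ] V) : Submodule ℂ (Cx V) :=
  Module.End.eigenspace (Cx.map (J : V →ₗ[ℝ] V)) Complex.I

/-- Vectors of type `(0,1)`. -/
def T01 (J : V →L[ℝ] V) : Submodule ℂ (Cx V) :=
  Module.End.eigenspace (Cx.map (J : V →ₗ[ℝ] V)) (-Complex.I)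

/-- The complex covectors that vanish on a subspace of `V ⊗ ℂ`. -/
def annihilator (W : Submodule ℂ (Cx V)) : Submodule ℂ (V →L[ℝ] ℂ) where
  carrier := {β | ∀ X ∈ W, evalC β X = 0}
  zero_mem' X _ := by simp [evalC]
  add_mem' {α β} hα hβ X hX := by
    have h : evalC (α + β) X = evalC α X + evalC β X := by simp [evalC]; ring
    rw [h, hα X hX, hβ X hX, add_zero]
  smul_mem' c β hβ X hX := by
    have h : evalC (c • β) X = c * evalC β X := by simp [evalC]; ring
    rw [h, hβ X hX, mul_zero]

/-- `𝕋_{1,0} = T_{1,0} ⊕ T*_{1,0}`; covectors of type `(1,0)` are those that vanish on `T_{0,1}`. -/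
def GT10 (J : V →L[ℝ] V) : Submodule ℂ (GTC V) := (T10 J).prod (annihilator (T01 J))

/-- The projection of `(V ⊕ V*) ⊗ ℂ` to `𝕋_{1,0}` along `𝕋_{0,1}`. -/
def pi10 (J : V →L[ℝ] V) (u : GTC V) : GTC V :=
  (P10 J u.1, (1 / 2 : ℂ) • (u.2 - Complex.I • u.2.comp J))

/-- The matched pair `A ⊕ T_{0,1}` of a subspace `A` of `𝕋_{1,0}`. -/
def matched (J : V →L[ℝ] V) (A : Submodule ℂ (GTC V)) : Submodule ℂ (GTC V) :=
  A ⊔ (T01 J).prod ⊥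

/-- The complex-multilinear extension of a complex form, evaluated on complex vectors. -/
def evalForm {n : ℕ} (η : V [⋀^Fin n]→L[ℝ] ℂ) (w : Fin n → Cx V) : ℂ :=
  ∑ s : Finset (Fin n), Complex.I ^ s.card * η (fun k => if k ∈ s then (w k).im else (w k).re)

/-- The value on real vectors of the component of type `(p, n - p)` of a complex `n`-form: the sum
over the ways to project `p` of the arguments to `T_{1,0}` and the others to `T_{0,1}`. -/
def typeEval {n : ℕ} (J : V →L[ℝ] V) (p : ℕ) (η : V [⋀^Fin n]→L[ℝ] ℂ) (v : Fin n → V) : ℂ :=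
  ∑ s ∈ Finset.powersetCard p (Finset.univ : Finset (Fin n)),
    evalForm η (fun k => if k ∈ s then P10 J ⟨v k, 0⟩ else P01 J ⟨v k, 0⟩)

theorem evalForm_swap {n : ℕ} (η : V [⋀^Fin n]→L[ℝ] ℂ) (w : Fin n → Cx V) {i j : Fin n}
    (hij : i ≠ j) : evalForm η (fun k => w (Equiv.swap i j k)) = -evalForm η w := by
  unfold evalForm
  rw [← Finset.sum_neg_distrib]
  refine Fintype.sum_equiv (Equiv.finsetCongr (Equiv.swap i j)) _ _ fun s => ?_
  have h := η.toAlternatingMap.map_swap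
    (fun k => if k ∈ s.map (Equiv.swap i j).toEmbedding then (w k).im else (w k).re) hij
  have hs : ∀ k, Equiv.swap i j k ∈ s.map (Equiv.swap i j).toEmbedding ↔ k ∈ s := fun k => by
    simp
  have h' : η (fun k => if k ∈ s then (w (Equiv.swap i j k)).im else (w (Equiv.swap i j k)).re) =
      -η (fun k => if k ∈ s.map (Equiv.swap i j).toEmbedding then (w k).im else (w k).re) := by
    refine Eq.trans ?_ h
    change η _ = η _
    congr 1
    funext k
    simp only [Function.comp, hs]
  rw [h']
  simp [Equiv.finsetCongr]

theorem typeEval_eq_zero {n : ℕ} (J : V →L[ℝ] V) (p : ℕ) (η : V [⋀^Fin n]→L[ℝ] ℂ)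
    (v : Fin n → V) {i j : Fin n} (hv : v i = v j) (hij : i ≠ j) : typeEval J p η v = 0 := by
  have hsw : ∀ k, v (Equiv.swap i j k) = v k := fun k => by
    by_cases h1 : k = i
    · subst h1; simp [hv]
    · by_cases h2 : k = j
      · subst h2; simp [hv]
      · rw [Equiv.swap_apply_of_ne_of_ne h1 h2]
  have key : typeEval J p η v = -typeEval J p η v := by
    unfold typeEval
    rw [← Finset.sum_neg_distrib]
    refine Finset.sum_equiv (Equiv.finsetCongr (Equiv.swap i j)) (fun s => ?_) (fun s _ => ?_)
    · simp [Finset.mem_powersetCard, Equiv.finsetCongr]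
    · rw [← evalForm_swap η _ hij]
      congr 1
      funext k
      have hs : Equiv.swap i j k ∈ Equiv.finsetCongr (Equiv.swap i j) s ↔ k ∈ s := by
        simp [Equiv.finsetCongr]
      simp only [hs, hsw]
  exact self_eq_neg.mp key

/-- The component of type `(p, n - p)` of a complex `n`-form. -/
def typePart {n : ℕ} (J : V →L[ℝ] V) (p : ℕ) (η : V [⋀^Fin n]→L[ℝ] ℂ) : V [⋀^Fin n]→L[ℝ] ℂ :=
  let slot (s t : Finset (Fin n)) (k : Fin n) : V →L[ℝ] V :=
    if k ∈ t then (if k ∈ s then -((1 / 2 : ℝ) • J) else (1 / 2 : ℝ) • J)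
    else (1 / 2 : ℝ) • ContinuousLinearMap.id ℝ V
  let m : ContinuousMultilinearMap ℝ (fun _ : Fin n => V) ℂ :=
    ∑ s ∈ Finset.powersetCard p (Finset.univ : Finset (Fin n)), ∑ t : Finset (Fin n),
      Complex.I ^ t.card • η.toContinuousMultilinearMap.compContinuousLinearMap (slot s t)
  have hm : ∀ v, m v = typeEval J p η v := fun v => by
    simp only [m, typeEval, evalForm, sum_apply,
      smul_apply, smul_eq_mul]
    refine Finset.sum_congr rfl fun s _ => Finset.sum_congr rfl fun t _ => ?_
    congr 1
    change η _ = η _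
    congr 1
    funext k
    by_cases h1 : k ∈ s <;> by_cases h2 : k ∈ t <;> simp [slot, h1, h2, P10, P01, Cx.map]
  { toFun := typeEval J p η
    map_update_add' := fun v i x y => by
      simp only [← hm]; exact m.map_update_add v i x y
    map_update_smul' := fun v i c x => by
      simp only [← hm]; exact m.map_update_smul v i c x
    map_eq_zero_of_eq' := fun v _ _ hv hij => typeEval_eq_zero J p η v hv hij
    cont := by
      have h : (fun v => m v) = typeEval J p η := funext hm
      exact h ▸ m.cont }

end Fibre

/-! ## Tensor fields on a manifold -/

section Manifold

variable {E : Type*} [NormedAddCommGroup E] [NormedSpace ℝ E]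
  {M : Type*} [TopologicalSpace M] [ChartedSpace E M]
  {F : Type*} [NormedAddCommGroup F] [NormedSpace ℝ F]

/-- The tangent space at `x` of a manifold modelled on `E`. -/
abbrev T (E : Type*) [NormedAddCommGroup E] [NormedSpace ℝ E]
    {M : Type*} [TopologicalSpace M] [ChartedSpace E M] (x : M) : Type _ :=
  TangentSpace 𝓘(ℝ, E) x

/-- (Not necessarily smooth) differential `n`-forms on `M` with values in `F`. -/
abbrev Form (E : Type*) [NormedAddCommGroup E] [NormedSpace ℝ E]
    (M : Type*) [TopologicalSpace M] [ChartedSpace E M] (n : ℕ)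
    (F : Type*) [NormedAddCommGroup F] [NormedSpace ℝ F] : Type _ :=
  ∀ x : M, T E x [⋀^Fin n]→L[ℝ] F

/-- The pullback of a form to the model space by the inverse of the chart at `x₀`. -/
def chartRep {n : ℕ} (η : Form E M n F) (x₀ : M) (y : E) : E [⋀^Fin n]→L[ℝ] F :=
  (η ((extChartAt 𝓘(ℝ, E) x₀).symm y)).compContinuousLinearMap
    ((mfderiv 𝓘(ℝ, E) 𝓘(ℝ, E) (extChartAt 𝓘(ℝ, E) x₀).symm y).comp
      (NormedSpace.fromTangentSpace y).symm.toContinuousLinearMap)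

/-- The form `η` is smooth on the open set `U`: its expressions in charts are. -/
def SmoothFormOn {n : ℕ} (U : Set M) (η : Form E M n F) : Prop :=
  ∀ x₀ : M, ContDiffOn ℝ ∞ (chartRep η x₀)
    ((extChartAt 𝓘(ℝ, E) x₀).target ∩ (extChartAt 𝓘(ℝ, E) x₀).symm ⁻¹' U)

/-- The exterior derivative, computed at `x` in the chart at `x`. -/
def extD {n : ℕ} (η : Form E M n F) : Form E M (n + 1) F := fun x =>
  (extDeriv (chartRep η x) (extChartAt 𝓘(ℝ, E) x x)).compContinuousLinearMap
    ((NormedSpace.fromTangentSpace (extChartAt 𝓘(ℝ, E) x x)).toContinuousLinearMap.comp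
      (mfderiv 𝓘(ℝ, E) 𝓘(ℝ, E) (extChartAt 𝓘(ℝ, E) x) x))

/-- The differential of a complex function. -/
def extDFun (E : Type*) [NormedAddCommGroup E] [NormedSpace ℝ E]
    {M : Type*} [TopologicalSpace M] [ChartedSpace E M] (f : M → ℂ) (x : M) : T E x →L[ℝ] ℂ :=
  (NormedSpace.fromTangentSpace (f x)).toContinuousLinearMap.comp
    (mfderiv 𝓘(ℝ, E) 𝓘(ℝ, ℂ) f x)

variable [IsManifold 𝓘(ℝ, E) ∞ M]

/-- The real vector field `X` is smooth on the open set `U`. -/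
def SmoothFieldOn (U : Set M) (X : ∀ x : M, T E x) : Prop :=
  ContMDiffOn 𝓘(ℝ, E) 𝓘(ℝ, E).tangent ∞ (fun x => (⟨x, X x⟩ : TangentBundle 𝓘(ℝ, E) M)) U

/-- The complex vector field `X` is smooth on the open set `U`. -/
def SmoothFieldCOn (U : Set M) (X : ∀ x : M, Cx (T E x)) : Prop :=
  SmoothFieldOn U (fun x => (X x).re) ∧ SmoothFieldOn U (fun x => (X x).im)

/-- The section `u` of `TM ⊕ T*M` is smooth on the open set `U`. -/
def SmoothOn (U : Set M) (u : ∀ x : M, GT (T E x)) : Prop :=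
  SmoothFieldOn U (fun x => (u x).1) ∧ SmoothFormOn U (fun x => oneForm (u x).2)

/-- The section `u` of `(TM ⊕ T*M) ⊗ ℂ` is smooth on the open set `U`. -/
def SmoothCOn (U : Set M) (u : ∀ x : M, GTC (T E x)) : Prop :=
  SmoothFieldCOn U (fun x => (u x).1) ∧ SmoothFormOn U (fun x => oneForm (u x).2)

/-- The complex-bilinear extension of the Lie bracket of vector fields. -/
def lieC (X Y : ∀ x : M, Cx (T E x)) (x : M) : Cx (T E x) :=
  ⟨VectorField.mlieBracket 𝓘(ℝ, E) (fun x => (X x).re) (fun x => (Y x).re) x -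
      VectorField.mlieBracket 𝓘(ℝ, E) (fun x => (X x).im) (fun x => (Y x).im) x,
    VectorField.mlieBracket 𝓘(ℝ, E) (fun x => (X x).re) (fun x => (Y x).im) x +
      VectorField.mlieBracket 𝓘(ℝ, E) (fun x => (X x).im) (fun x => (Y x).re) x⟩

/-- The Courant bracket twisted by the complex three-form `H`,
`[X + α, Y + β]_H = [X, Y] + L_X β - ι_Y dα + ι_X ι_Y H`, where `L_X β = ι_X dβ + d(ι_X β)`. -/
def courant (H : Form E M 3 ℂ) (u v : ∀ x : M, GTC (T E x)) (x : M) : GTC (T E x) :=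
  (lieC (fun x => (u x).1) (fun x => (v x).1) x,
    toCovector (interiorC (u x).1 (extD (fun x => oneForm (v x).2) x)) +
      extDFun E (fun x => evalC (v x).2 (u x).1) x -
      toCovector (interiorC (v x).1 (extD (fun x => oneForm (u x).2) x)) +
      toCovector (interiorC (u x).1 (interiorC (v x).1 (H x))))

/-- A family of complex subspaces of the fibres of `(TM ⊕ T*M) ⊗ ℂ`. -/
abbrev Subfamily (E : Type*) [NormedAddCommGroup E] [NormedSpace ℝ E]
    (M : Type*) [TopologicalSpace M] [ChartedSpace E M] : Type _ :=
  ∀ x : M, Submodule ℂ (GTC (T E x))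

/-- Every vector of `L` extends to a local smooth section of `L`. -/
def IsSmoothFamily (L : Subfamily E M) : Prop :=
  ∀ x : M, ∀ a ∈ L x, ∃ U : Set M, IsOpen U ∧ x ∈ U ∧ ∃ u : ∀ x : M, GTC (T E x),
    SmoothCOn U u ∧ (∀ y ∈ U, u y ∈ L y) ∧ u x = a

/-- The local smooth sections of `L` are closed under the `H`-twisted Courant bracket. -/
def IsInvolutive (H : Form E M 3 ℂ) (L : Subfamily E M) : Prop :=
  ∀ U : Set M, IsOpen U → ∀ u v : ∀ x : M, GTC (T E x), SmoothCOn U u → SmoothCOn U v →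
    (∀ x ∈ U, u x ∈ L x) → (∀ x ∈ U, v x ∈ L x) → ∀ x ∈ U, courant H u v x ∈ L x

/-! ### Generalized Kähler structures -/

/-- Endomorphisms of the bundle `TM ⊕ T*M`. -/
abbrev EndGT (E : Type*) [NormedAddCommGroup E] [NormedSpace ℝ E]
    (M : Type*) [TopologicalSpace M] [ChartedSpace E M] : Type _ :=
  ∀ x : M, GT (T E x) →ₗ[ℝ] GT (T E x)

/-- Endomorphisms of the tangent bundle. -/
abbrev EndT (E : Type*) [NormedAddCommGroup E] [NormedSpace ℝ E]
    (M : Type*) [TopologicalSpace M] [ChartedSpace E M] : Type _ :=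
  ∀ x : M, T E x →L[ℝ] T E x

/-- `J` is a generalized complex structure on `(M, H)`: a smooth complex structure on
`TM ⊕ T*M` whose `+i` eigenbundle is maximal isotropic and involutive. -/
structure IsGeneralizedComplex (H : Form E M 3 ℝ) (J : EndGT E M) : Prop where
  sq : ∀ x u, J x (J x u) = -u
  smooth : ∀ U : Set M, IsOpen U → ∀ u : ∀ x : M, GT (T E x), SmoothOn U u →
    SmoothOn U (fun x => J x (u x))
  lagrangian : ∀ x, IsLagrangianIn ⊤ (eigenG (J x))
  involutive : IsInvolutive (fun x => cxForm (H x)) (fun x => eigenG (J x))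

/-- `(JA, JB)` is a generalized Kähler structure on `(M, H)`. -/
structure IsGeneralizedKahler (H : Form E M 3 ℝ) (JA JB : EndGT E M) : Prop where
  complexA : IsGeneralizedComplex H JA
  complexB : IsGeneralizedComplex H JB
  comm : ∀ x u, JA x (JB x u) = JB x (JA x u)
  pos : ∀ x u, u ≠ 0 → 0 < pairing (JA x u) (JB x u)

/-! ### Complex structures and bihermitian data -/

/-- `J` is a complex structure on `M`: a smooth almost complex structure for which `T_{1,0}` is
closed under the Lie bracket. -/
structure IsComplexStructure (J : EndT E M) : Prop where
  sq : ∀ x X, J x (J x X) = -X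
  smooth : ∀ U : Set M, IsOpen U → ∀ X : ∀ x : M, T E x, SmoothFieldOn U X →
    SmoothFieldOn U (fun x => J x (X x))
  integrable : ∀ U : Set M, IsOpen U → ∀ X Y : ∀ x : M, Cx (T E x),
    SmoothFieldCOn U X → SmoothFieldCOn U Y → (∀ x ∈ U, X x ∈ T10 (J x)) →
    (∀ x ∈ U, Y x ∈ T10 (J x)) → ∀ x ∈ U, lieC X Y x ∈ T10 (J x)

/-- For a form `η` of type `(1,1)`, the form `∂η`: the `(2,1)` component of `dη`. -/
def del (J : EndT E M) (η : Form E M 2 ℂ) : Form E M 3 ℂ :=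
  fun x => typePart (J x) 2 (extD η x)

/-- For a form `η` of type `(1,1)`, the form `∂̄η`: the `(1,2)` component of `dη`. -/
def delbar (J : EndT E M) (η : Form E M 2 ℂ) : Form E M 3 ℂ :=
  fun x => typePart (J x) 1 (extD η x)

/-- For a form `η` of type `(1,1)`, the form `d^c η = i(∂̄ - ∂)η`. -/
def dc (J : EndT E M) (η : Form E M 2 ℂ) : Form E M 3 ℂ :=
  fun x => Complex.I • (delbar J η x - del J η x)

/-- A metric `g` with two orthogonal almost complex structures `I₊ = Ip`, `I₋ = Im`, and a
two-form `b`. -/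
@[ext] structure BihermitianData (E : Type*) [NormedAddCommGroup E] [NormedSpace ℝ E]
    (M : Type*) [TopologicalSpace M] [ChartedSpace E M] where
  g : ∀ x : M, T E x →L[ℝ] T E x →L[ℝ] ℝ
  Ip : EndT E M
  Im : EndT E M
  b : Form E M 2 ℝ
  g_symm : ∀ x X Y, g x X Y = g x Y X
  g_pos : ∀ x X, X ≠ 0 → 0 < g x X X
  Ip_sq : ∀ x X, Ip x (Ip x X) = -X
  Im_sq : ∀ x X, Im x (Im x X) = -X
  g_Ip : ∀ x X Y, g x (Ip x X) (Ip x Y) = g x X Y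
  g_Im : ∀ x X Y, g x (Im x X) (Im x Y) = g x X Y

end Manifold

section Hermitian

variable {V : Type*} [AddCommGroup V] [Module ℝ V] [TopologicalSpace V]

/-- The Hermitian form `ω = gI`, that is, `ω(X, Y) = g(IX, Y)`. -/
def hermitianForm (g : V →L[ℝ] V →L[ℝ] ℝ) (J : V →L[ℝ] V)
    (symm : ∀ X Y, g X Y = g Y X) (sq : ∀ X, J (J X) = -X)
    (orth : ∀ X Y, g (J X) (J Y) = g X Y) (cont : Continuous fun p : V × V => g p.1 p.2) :
    V [⋀^Fin 2]→L[ℝ] ℝ where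
  toFun v := g (J (v 0)) (v 1)
  map_update_add' v i x y := by fin_cases i <;> simp [Function.update]
  map_update_smul' v i c x := by fin_cases i <;> simp [Function.update]
  map_eq_zero_of_eq' v i j hv hij := by
    have h0 : ∀ X, g (J X) X = 0 := fun X => by
      have h1 := orth (J X) X
      rw [sq, map_neg, neg_apply, symm X (J X)] at h1
      linarith
    have h : v 0 = v 1 := by
      fin_cases i <;> fin_cases j <;> simp_all
    change g (J (v 0)) (v 1) = 0
    rw [h, h0]
  cont := cont.comp (f := fun v : Fin 2 → V => (J (v 0), v 1)) (by fun_prop)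

end Hermitian


section Main

variable {E : Type*} [NormedAddCommGroup E] [NormedSpace ℝ E]
  {M : Type*} [TopologicalSpace M] [ChartedSpace E M]

theorem continuous_bilin (x : M) (g : T E x →L[ℝ] T E x →L[ℝ] ℝ) :
    Continuous fun p : T E x × T E x => g p.1 p.2 :=
  ContinuousLinearMap.continuous₂ (E := E) (F := E) (G := ℝ) (𝕜 := ℝ) g

variable [IsManifold 𝓘(ℝ, E) ∞ M]

namespace BihermitianData

/-- The Hermitian form `ω₊ = g I₊`. -/
def omegaP (d : BihermitianData E M) : Form E M 2 ℝ := fun x =>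
  hermitianForm (d.g x) (d.Ip x) (d.g_symm x) (d.Ip_sq x) (d.g_Ip x) (continuous_bilin x _)

/-- The Hermitian form `ω₋ = g I₋`. -/
def omegaM (d : BihermitianData E M) : Form E M 2 ℝ := fun x =>
  hermitianForm (d.g x) (d.Im x) (d.g_symm x) (d.Im_sq x) (d.g_Im x) (continuous_bilin x _)

/-- The complex two-form `-i(ω₊ + ω₋)`. -/
def vertical (d : BihermitianData E M) : Form E M 2 ℂ := fun x =>
  -Complex.I • cxForm (d.omegaP x + d.omegaM x)

/-- The complex two-form `i(ω₊ - ω₋)`. -/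
def horizontal (d : BihermitianData E M) : Form E M 2 ℂ := fun x =>
  Complex.I • cxForm (d.omegaP x - d.omegaM x)

/-- The bihermitian data are those of `(JA, JB)`. In the splitting of `TM ⊕ T*M` determined by
`b`, the formulas
`e^{-b} JA e^b = ½ [I₊ + I₋, (I₊ - I₋)g⁻¹; g(I₊ - I₋), -(I₊* + I₋*)]` and
`e^{-b} JB e^b = ½ [I₊ - I₋, (I₊ + I₋)g⁻¹; g(I₊ + I₋), -(I₊* - I₋*)]` hold, evaluated here on
a general element `X + gZ`. -/
structure IsDataOf (JA JB : EndGT E M) (d : BihermitianData E M) : Prop where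
  formulaA : ∀ x X Z, JA x (gaugeR (d.b x) (X, d.g x Z)) = gaugeR (d.b x)
    ((1 / 2 : ℝ) • (d.Ip x X + d.Im x X + (d.Ip x Z - d.Im x Z)),
      (1 / 2 : ℝ) • (d.g x (d.Ip x X - d.Im x X) -
        ((d.g x Z).comp (d.Ip x) + (d.g x Z).comp (d.Im x))))
  formulaB : ∀ x X Z, JB x (gaugeR (d.b x) (X, d.g x Z)) = gaugeR (d.b x)
    ((1 / 2 : ℝ) • (d.Ip x X - d.Im x X + (d.Ip x Z + d.Im x Z)),
      (1 / 2 : ℝ) • (d.g x (d.Ip x X + d.Im x X) -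
        ((d.g x Z).comp (d.Ip x) - (d.g x Z).comp (d.Im x))))

/-- The bihermitian conditions: all tensors are smooth, `I₊` and `I₋` are complex structures, and
`d^c₊ω₊ = -d^c₋ω₋ = H - db`. -/
structure IsBihermitian (H : Form E M 3 ℝ) (d : BihermitianData E M) : Prop where
  smooth_g : ∀ U : Set M, IsOpen U → ∀ X : ∀ x : M, T E x, SmoothFieldOn U X →
    SmoothFormOn U (fun x => oneForm (d.g x (X x)))
  smooth_b : SmoothFormOn Set.univ d.b
  complexP : IsComplexStructure d.Ip
  complexM : IsComplexStructure d.Im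
  dcP : ∀ x, dc d.Ip (fun x => cxForm (d.omegaP x)) x = cxForm (H x - extD d.b x)
  dcM : ∀ x, -dc d.Im (fun x => cxForm (d.omegaM x)) x = cxForm (H x - extD d.b x)

end BihermitianData

/-! ### Holomorphic Manin triples -/

/-- The data of a holomorphic Manin triple `(𝓔, A, B)` over `(M, J)`, in which `𝓔` is the exact
Courant algebroid `𝕋_{1,0}` with the structure defined by the three-form `curv`. -/
structure ManinTriple (E : Type*) [NormedAddCommGroup E] [NormedSpace ℝ E]
    (M : Type*) [TopologicalSpace M] [ChartedSpace E M] where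
  J : EndT E M
  curv : Form E M 3 ℂ
  A : Subfamily E M
  B : Subfamily E M

/-- `L` is a holomorphic Dirac structure in the holomorphic Courant algebroid
`(𝕋_{1,0}, D̄, [·,·]_{1,0})` over `(M, J)` defined by the three-form `H`, where
`D̄_X a = π_{1,0}[X, a]_H` for `X` of type `(0,1)` and `[a, b]_{1,0} = π_{1,0}[a, b]_H`. -/
structure IsHolomorphicDirac (J : EndT E M) (H : Form E M 3 ℂ) (L : Subfamily E M) : Prop where
  lagrangian : ∀ x, IsLagrangianIn (GT10 (J x)) (L x)
  smooth : IsSmoothFamily L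
  holomorphic : ∀ U : Set M, IsOpen U → ∀ (X : ∀ x : M, Cx (T E x)) (a : ∀ x : M, GTC (T E x)),
    SmoothFieldCOn U X → SmoothCOn U a → (∀ x ∈ U, X x ∈ T01 (J x)) → (∀ x ∈ U, a x ∈ L x) →
    ∀ x ∈ U, pi10 (J x) (courant H (fun y => (X y, 0)) a x) ∈ L x
  involutive : ∀ U : Set M, IsOpen U → ∀ a b : ∀ x : M, GTC (T E x),
    SmoothCOn U a → SmoothCOn U b → (∀ x ∈ U, a x ∈ L x) → (∀ x ∈ U, b x ∈ L x) →
    ∀ x ∈ U, pi10 (J x) (courant H a b x) ∈ L x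

namespace ManinTriple

/-- `t` is a holomorphic Manin triple: `J` is a complex structure, `curv` is a smooth closed form
of type `(2,1) + (3,0)`, and `𝕋_{1,0} = A ⊕ B` for two holomorphic Dirac structures `A`, `B`. -/
structure IsHolomorphic (t : ManinTriple E M) : Prop where
  complex : IsComplexStructure t.J
  smooth : SmoothFormOn Set.univ t.curv
  closed : ∀ x, extD t.curv x = 0
  type12 : ∀ x, typePart (t.J x) 1 (t.curv x) = 0
  type03 : ∀ x, typePart (t.J x) 0 (t.curv x) = 0
  diracA : IsHolomorphicDirac t.J t.curv t.A
  diracB : IsHolomorphicDirac t.J t.curv t.B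
  disjoint : ∀ x, t.A x ⊓ t.B x = ⊥
  span : ∀ x, t.A x ⊔ t.B x = GT10 (t.J x)

/-- The complex conjugate Manin triple, over the conjugate complex manifold. -/
def conj (t : ManinTriple E M) : ManinTriple E M where
  J x := -t.J x
  curv x := conjForm (t.curv x)
  A x := conjSub (t.A x)
  B x := conjSub (t.B x)

/-- The matched pair of `A`, a subbundle of `(TM ⊕ T*M) ⊗ ℂ`. -/
def LA (t : ManinTriple E M) : Subfamily E M := fun x => matched (t.J x) (t.A x)

/-- The matched pair of `B`. -/
def LB (t : ManinTriple E M) : Subfamily E M := fun x => matched (t.J x) (t.B x)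

end ManinTriple

/-- The `+i` eigenbundle of `J`, in the splitting of `TM ⊕ T*M` determined by `b`. -/
def eigenbundle (J : EndGT E M) (b : Form E M 2 ℝ) : Subfamily E M := fun x =>
  (eigenG (J x)).map (gauge (-cxForm (b x)))

/-- The Manin triple `(𝓔₊, A₊, B₊)`: `𝓔₊` is defined by `-2i∂₊ω₊`, and
`A₊ = 𝕋_{1,0}X₊ ∩ e^{-iω₊}(L̄_A)`, `B₊ = 𝕋_{1,0}X₊ ∩ e^{-iω₊}(L̄_B)`. -/
def maninP (JA JB : EndGT E M) (d : BihermitianData E M) : ManinTriple E M where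
  J := d.Ip
  curv x := (-2 * Complex.I) • del d.Ip (fun x => cxForm (d.omegaP x)) x
  A x := GT10 (d.Ip x) ⊓
    (conjSub (eigenbundle JA d.b x)).map (gauge (-Complex.I • cxForm (d.omegaP x)))
  B x := GT10 (d.Ip x) ⊓
    (conjSub (eigenbundle JB d.b x)).map (gauge (-Complex.I • cxForm (d.omegaP x)))

/-- The Manin triple `(𝓔₋, A₋, B₋)`: `𝓔₋` is defined by `2i∂₋ω₋`, and
`A₋ = 𝕋_{1,0}X₋ ∩ e^{iω₋}(L̄_A)`, `B₋ = 𝕋_{1,0}X₋ ∩ e^{iω₋}(L_B)`. -/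
def maninM (JA JB : EndGT E M) (d : BihermitianData E M) : ManinTriple E M where
  J := d.Im
  curv x := (2 * Complex.I) • del d.Im (fun x => cxForm (d.omegaM x)) x
  A x := GT10 (d.Im x) ⊓
    (conjSub (eigenbundle JA d.b x)).map (gauge (Complex.I • cxForm (d.omegaM x)))
  B x := GT10 (d.Im x) ⊓
    (eigenbundle JB d.b x).map (gauge (Complex.I • cxForm (d.omegaM x)))

/-- The gauge transformation `e^F` of `(TM ⊕ T*M) ⊗ ℂ` is an isomorphism of smooth complex Courant
algebroids from the `H`-twisted to the `H'`-twisted one. -/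
structure IsGaugeEquiv (F : Form E M 2 ℂ) (H H' : Form E M 3 ℂ) : Prop where
  bijective : ∀ x, Function.Bijective (gauge (F x))
  smooth : ∀ U : Set M, IsOpen U → ∀ u : ∀ x : M, GTC (T E x),
    SmoothCOn U u ↔ SmoothCOn U (fun x => gauge (F x) (u x))
  anchor : ∀ x u, (gauge (F x) u).1 = u.1
  pairing : ∀ x u v, pairingC (gauge (F x) u) (gauge (F x) v) = pairingC u v
  bracket : ∀ U : Set M, IsOpen U → ∀ u v : ∀ x : M, GTC (T E x),
    SmoothCOn U u → SmoothCOn U v → ∀ x ∈ U,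
    courant H' (fun y => gauge (F y) (u y)) (fun y => gauge (F y) (v y)) x =
      gauge (F x) (courant H u v x)

/-- `e^F` is an isomorphism from the matched pair of `t` to that of `t'`, which takes the matched
pair of the Dirac structure `A` to that of `A'`, and, unless `M` is zero-dimensional, nowhere
takes the matched pair of `B` to that of `B'`. -/
def GaugeEquivA (F : Form E M 2 ℂ) (t t' : ManinTriple E M) : Prop :=
  IsGaugeEquiv F t.curv t'.curv ∧
  (∀ x, (t.LA x).map (gauge (F x)) = t'.LA x) ∧
  (Nontrivial E → ∀ x, (t.LB x).map (gauge (F x)) ≠ t'.LB x)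

/-- The same with the roles of the Dirac structures of types `A` and `B` exchanged. -/
def GaugeEquivB (F : Form E M 2 ℂ) (t t' : ManinTriple E M) : Prop :=
  IsGaugeEquiv F t.curv t'.curv ∧
  (∀ x, (t.LB x).map (gauge (F x)) = t'.LB x) ∧
  (Nontrivial E → ∀ x, (t.LA x).map (gauge (F x)) ≠ t'.LA x)

end Main

end GenKahler

end

noncomputable section

set_option linter.unusedSectionVars false

/-! Fibrewise, everything is encoded in the generalized metric `G = -JA JB`. It is a symmetric
involution, positive for the pairing, and its eigenspaces C± for ±1 are graphs {X + ι_X b ± gX}: by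
positivity the map α ↦ π_T G(α) from covectors to vectors is injective, hence invertible; its
inverse is g, and G(gX) = X + ι_X b gives b. Since `JA` commutes with G it preserves C±, and reading
it through the projections C± → TM gives I±. As `JB = JA G`, `JB` is `JA` on C₊ and -`JA` on C₋,
which is the content of the two matrix formulas. The identity G(gX) = X + ι_X b
(`IsFibreData.genMetric_covector`) gives uniqueness, and also smoothness: g is the inverse of a
smooth family of operators, and b and I± are then obtained by applying smooth operators.

The rest follows from one observation about gauge transformations. The intersection of the
conjugates of L_A and L_B consists of the vectors of I₊-type (0,1) lifted to C₊ ⊗ ℂ. On a (0,1)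
vector X one has ι_X ω₊ = -i gX, so the gauge transformation by -iω₊ - b removes exactly the
covector part of the lift: the intersection becomes T_{0,1}X₊. Likewise iω₋ - b takes the
intersection of the conjugate of L_A with L_B itself to T_{0,1}X₋, because `JB` changes sign on C₋.
Since e^B intertwines the H-twisted and the (H + dB)-twisted brackets (`courant_gauge`), this
produces Dirac structures L, L' for K = H - db ∓ i dω± with L ∩ L' = T_{0,1} (`IsDiracPair`).

From such a pair the holomorphic statements are formal. The bracket of two (0,1) fields lies in L ∩
L', so T_{0,1} is involutive, which is integrability, and ι_X ι_Y K = 0, so K has type (2,1) +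
(3,0). Comparing types, with H - db real and ω of type (1,1), gives both the d^c equation and K =
∓2i ∂ω (`real_form_types`). A Lagrangian L containing T_{0,1} lies in its orthogonal T ⊕ T*_{1,0},
hence L = (𝕋_{1,0} ∩ L) ⊕ T_{0,1}: it is a matched pair, and projecting its involutivity by π_{1,0}
gives the holomorphic Dirac axioms.

Finally, the matched pairs of the four triples are gauge transforms of members of L_A, L_B and their
conjugates, by two-forms ∓iω± - b (`IsGaugeOf`). The vertical and horizontal maps are differences of
these two-forms. Vertically the two triples start from the same structure of type A and from
conjugate structures of type B, and horizontally the roles are exchanged; a nonzero eigenspace for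
+i differs from its conjugate, and gauge transformations are injective on subspaces, so the other
type is nowhere intertwined. -/

namespace GenKahler

/-! ### Vector fields and forms in a chart -/

section Chart

variable {E : Type*} [NormedAddCommGroup E] [NormedSpace ℝ E]
  {M : Type*} [TopologicalSpace M] [ChartedSpace E M] [IsManifold 𝓘(ℝ, E) ∞ M]
  {F : Type*} [NormedAddCommGroup F] [NormedSpace ℝ F]

/-- The derivative at `x` of the chart at `x₀`. -/
def chartD (x₀ x : M) : T E x →L[ℝ] E :=
  (NormedSpace.fromTangentSpace (extChartAt 𝓘(ℝ, E) x₀ x)).toContinuousLinearMap.comp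
    (mfderiv 𝓘(ℝ, E) 𝓘(ℝ, E) (extChartAt 𝓘(ℝ, E) x₀) x)

/-- The derivative at `y` of the inverse of the chart at `x₀`. -/
def chartDSymm (x₀ : M) (y : E) : E →L[ℝ] T E ((extChartAt 𝓘(ℝ, E) x₀).symm y) :=
  (mfderiv 𝓘(ℝ, E) 𝓘(ℝ, E) (extChartAt 𝓘(ℝ, E) x₀).symm y).comp
      (NormedSpace.fromTangentSpace y).symm.toContinuousLinearMap

theorem chartRep_eq {n : ℕ} (η : Form E M n F) (x₀ : M) (y : E) :
    chartRep η x₀ y =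
      (η ((extChartAt 𝓘(ℝ, E) x₀).symm y)).compContinuousLinearMap (chartDSymm x₀ y) := rfl

theorem extD_eq {n : ℕ} (η : Form E M n F) (x : M) :
    extD η x = (extDeriv (chartRep η x) (extChartAt 𝓘(ℝ, E) x x)).compContinuousLinearMap
      (chartD x x) := rfl

theorem chartDSymm_chartD {x₀ : M} {y : E} (hy : y ∈ (extChartAt 𝓘(ℝ, E) x₀).target)
    (v : T E ((extChartAt 𝓘(ℝ, E) x₀).symm y)) :
    chartDSymm x₀ y (chartD x₀ ((extChartAt 𝓘(ℝ, E) x₀).symm y) v) = v := by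
  have h := mfderivWithin_extChartAt_symm_comp_mfderiv_extChartAt' (I := 𝓘(ℝ, E))
    ((extChartAt 𝓘(ℝ, E) x₀).map_target hy)
  rw [(extChartAt 𝓘(ℝ, E) x₀).right_inv hy] at h
  simp only [modelWithCornersSelf_coe, Set.range_id, mfderivWithin_univ] at h
  exact DFunLike.congr_fun h v

theorem chartD_chartDSymm {x₀ : M} {y : E} (hy : y ∈ (extChartAt 𝓘(ℝ, E) x₀).target) (v : E) :
    chartD x₀ ((extChartAt 𝓘(ℝ, E) x₀).symm y) (chartDSymm x₀ y v) = v := by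
  have h := mfderiv_extChartAt_comp_mfderivWithin_extChartAt_symm (I := 𝓘(ℝ, E)) hy
  simp only [modelWithCornersSelf_coe, Set.range_id, mfderivWithin_univ] at h
  exact DFunLike.congr_fun h v

/-- The expression of a vector field in the chart at `x₀`. -/
def chartField (X : ∀ x : M, T E x) (x₀ : M) (y : E) : E :=
  chartD x₀ ((extChartAt 𝓘(ℝ, E) x₀).symm y) (X ((extChartAt 𝓘(ℝ, E) x₀).symm y))

theorem chartRep_chartField {n : ℕ} (η : Form E M n F) {x₀ : M} {y : E}
    (hy : y ∈ (extChartAt 𝓘(ℝ, E) x₀).target) (X : Fin n → ∀ x : M, T E x) :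
    chartRep η x₀ y (fun i => chartField (X i) x₀ y) =
      η ((extChartAt 𝓘(ℝ, E) x₀).symm y) (fun i => X i ((extChartAt 𝓘(ℝ, E) x₀).symm y)) := by
  rw [chartRep_eq]
  change η _ _ = η _ _
  congr 1
  funext i
  exact chartDSymm_chartD hy _

/-- The vector field that is constant in the chart at `x₀`. -/
def constField (x₀ : M) (v : E) (x : M) : T E x :=
  ContinuousLinearMap.inverse (chartD x₀ x) v

theorem isInvertible_chartD {x₀ x : M} (hx : x ∈ (extChartAt 𝓘(ℝ, E) x₀).source) :
    (chartD (E := E) x₀ x).IsInvertible :=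
  isInvertible_mfderiv_extChartAt (I := 𝓘(ℝ, E)) hx

theorem chartD_constField {x₀ x : M} (hx : x ∈ (extChartAt 𝓘(ℝ, E) x₀).source) (v : E) :
    chartD x₀ x (constField x₀ v x) = v := by
  obtain ⟨e, he⟩ := isInvertible_chartD (E := E) hx
  rw [constField, ← he, ContinuousLinearMap.inverse_equiv]
  exact e.apply_symm_apply v

theorem constField_chartD {x₀ x : M} (hx : x ∈ (extChartAt 𝓘(ℝ, E) x₀).source) (v : T E x) :
    constField x₀ (chartD x₀ x v) x = v := by
  obtain ⟨e, he⟩ := isInvertible_chartD (E := E) hx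
  rw [constField, ← he, ContinuousLinearMap.inverse_equiv]
  exact e.symm_apply_apply v

theorem constField_symm {x₀ : M} {y : E} (hy : y ∈ (extChartAt 𝓘(ℝ, E) x₀).target) (v : E) :
    constField x₀ v ((extChartAt 𝓘(ℝ, E) x₀).symm y) = chartDSymm x₀ y v := by
  rw [← constField_chartD ((extChartAt 𝓘(ℝ, E) x₀).map_target hy) (chartDSymm x₀ y v),
    chartD_chartDSymm hy]

/-- The chart expression of a field is its pullback by the inverse chart, and pullback by a smooth
map with invertible derivative preserves smoothness. -/
theorem contDiffOn_chartField [CompleteSpace E] {U : Set M} {X : ∀ x : M, T E x}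
    (hX : SmoothFieldOn U X) (x₀ : M) :
    ContDiffOn ℝ ∞ (chartField X x₀)
      ((extChartAt 𝓘(ℝ, E) x₀).target ∩ (extChartAt 𝓘(ℝ, E) x₀).symm ⁻¹' U) := by
  have h := ContMDiffOn.mpullbackWithin_vectorField_inter (m := ∞) (n := ∞) hX
    (contMDiffOn_extChartAt_symm (I := 𝓘(ℝ, E)) (n := ∞) x₀)
    (fun y hy => by
      have h := isInvertible_mfderivWithin_extChartAt_symm (I := 𝓘(ℝ, E)) (x := x₀) hy.1
      rw [mfderivWithin_of_isOpen (isOpen_extChartAt_target x₀) hy.1]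
      simpa using h)
    (isOpen_extChartAt_target x₀).uniqueMDiffOn le_rfl
  rw [contMDiffOn_vectorSpace_iff_contDiffOn] at h
  refine h.congr fun y hy => ?_
  rw [VectorField.mpullbackWithin_apply,
    mfderivWithin_of_isOpen (isOpen_extChartAt_target x₀) hy.1]
  have h1 := isInvertible_mfderivWithin_extChartAt_symm (I := 𝓘(ℝ, E)) (x := x₀) hy.1
  simp only [modelWithCornersSelf_coe, Set.range_id, mfderivWithin_univ] at h1
  obtain ⟨e, he⟩ := h1
  have h2 := chartDSymm_chartD hy.1 (X ((extChartAt 𝓘(ℝ, E) x₀).symm y))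
  change (mfderiv 𝓘(ℝ, E) 𝓘(ℝ, E) (extChartAt 𝓘(ℝ, E) x₀).symm y) _ = _ at h2
  rw [← he] at h2 ⊢
  rw [ContinuousLinearMap.inverse_equiv]
  exact (e.symm_apply_eq.mpr h2.symm).symm

/-- These fields serve as test fields and as local extensions of a single tangent vector; they are
the pullbacks of constant fields by the chart. -/
theorem smoothFieldOn_constField [CompleteSpace E] (x₀ : M) (v : E) :
    SmoothFieldOn (extChartAt 𝓘(ℝ, E) x₀).source (constField x₀ v) := by
  have h := ContMDiffOn.mpullbackWithin_vectorField_inter (m := ∞) (n := ∞)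
    (V := fun y : E => (NormedSpace.fromTangentSpace (𝕜 := ℝ) y).symm v) (t := Set.univ)
    (contMDiffOn_vectorSpace_iff_contDiffOn.mpr contDiffOn_const)
    (contMDiffOn_extChartAt (I := 𝓘(ℝ, E)) (n := ∞) (x := x₀))
    (fun y hy => by
      rw [mfderivWithin_of_isOpen (chartAt E x₀).open_source hy.1]
      exact isInvertible_mfderiv_extChartAt (by simpa using hy.1))
    (chartAt E x₀).open_source.uniqueMDiffOn le_rfl
  rw [extChartAt_source]
  rw [Set.preimage_univ, Set.inter_univ] at h
  refine h.congr fun y hy => ?_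
  have h : VectorField.mpullbackWithin 𝓘(ℝ, E) 𝓘(ℝ, E) (extChartAt 𝓘(ℝ, E) x₀) (fun y : E => (NormedSpace.fromTangentSpace (𝕜 := ℝ) y).symm v)
      (chartAt E x₀).source y = constField x₀ v y := by
    rw [VectorField.mpullbackWithin_apply, mfderivWithin_of_isOpen (chartAt E x₀).open_source hy]
    rfl
  exact congrArg (Bundle.TotalSpace.mk y) h.symm

end Chart

/-! ### Smoothness of forms tested on vector fields -/

section FormCalculus

variable {E : Type*} [NormedAddCommGroup E] [NormedSpace ℝ E] [FiniteDimensional ℝ E]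
  {F : Type*} [NormedAddCommGroup F] [NormedSpace ℝ F]

/-- An alternating map is determined by its values on tuples of basis vectors. The resulting
injective linear map Φ into a finite product has a linear left inverse, which is smooth in finite
dimension. -/
theorem contDiffOn_alternating [FiniteDimensional ℝ F] {D : Type*} [NormedAddCommGroup D]
    [NormedSpace ℝ D] {n : ℕ} {f : D → E [⋀^Fin n]→L[ℝ] F} {s : Set D}
    (h : ∀ v, ContDiffOn ℝ ∞ (fun y => f y v) s) : ContDiffOn ℝ ∞ f s := by
  let b := Module.finBasis ℝ E
  let Φ : (E [⋀^Fin n]→L[ℝ] F) →ₗ[ℝ] ((Fin n → Fin (Module.finrank ℝ E)) → F) :=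
    { toFun := fun η r => η fun i => b (r i)
      map_add' := fun _ _ => rfl
      map_smul' := fun _ _ => rfl }
  have hΦ : Function.Injective Φ := fun η ξ hη => by
    apply ContinuousAlternatingMap.toAlternatingMap_injective
    refine AlternatingMap.coe_multilinearMap_injective (Module.Basis.ext_multilinear
      (fun _ => b) fun r => ?_)
    exact congrFun hη r
  have : FiniteDimensional ℝ (E [⋀^Fin n]→L[ℝ] F) := Module.Finite.of_injective Φ hΦ
  obtain ⟨Ψ, hΨ⟩ := Φ.exists_leftInverse_of_injective (LinearMap.ker_eq_bot.mpr hΦ)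
  have h1 : ContDiffOn ℝ ∞ (fun y => Φ (f y)) s := contDiffOn_pi.mpr fun r => h _
  have h2 := (LinearMap.toContinuousLinearMap Ψ).contDiff.comp_contDiffOn h1
  refine h2.congr fun y _ => ?_
  exact (LinearMap.congr_fun hΨ (f y)).symm

theorem ContDiffOn.alternating_apply {D : Type*} [NormedAddCommGroup D]
    [NormedSpace ℝ D] {n : ℕ} {f : D → E [⋀^Fin n]→L[ℝ] F} {v : Fin n → D → E} {s : Set D}
    (hf : ContDiffOn ℝ ∞ f s) (hv : ∀ i, ContDiffOn ℝ ∞ (v i) s) :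
    ContDiffOn ℝ ∞ (fun y => f y (fun i => v i y)) s := by
  let b := Module.finBasis ℝ E
  have h : ∀ y, f y (fun i => v i y) = ∑ r : Fin n → Fin (Module.finrank ℝ E),
      (∏ i, b.repr (v i y) (r i)) • f y (fun i => b (r i)) := fun y => by
    conv_lhs => enter [2, i]; rw [← b.sum_repr (v i y)]
    rw [ContinuousAlternatingMap.map_sum]
    exact Finset.sum_congr rfl fun r _ => (f y).toMultilinearMap.map_smul_univ _ _
  simp only [h]
  refine ContDiffOn.sum fun r _ => ContDiffOn.smul (contDiffOn_prod fun i _ => ?_) ?_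
  · exact (LinearMap.toContinuousLinearMap (b.coord (r i))).contDiff.comp_contDiffOn (hv i)
  · exact (ContinuousAlternatingMap.apply ℝ E F (fun i => b (r i))).contDiff.comp_contDiffOn hf

variable {M : Type*} [TopologicalSpace M] [ChartedSpace E M] [IsManifold 𝓘(ℝ, E) ∞ M]

theorem contDiffOn_comp_symm {U : Set M} {f : M → F} (hf : ContMDiffOn 𝓘(ℝ, E) 𝓘(ℝ, F) ∞ f U)
    (x₀ : M) : ContDiffOn ℝ ∞ (fun y => f ((extChartAt 𝓘(ℝ, E) x₀).symm y))
      ((extChartAt 𝓘(ℝ, E) x₀).target ∩ (extChartAt 𝓘(ℝ, E) x₀).symm ⁻¹' U) :=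
  (hf.comp ((contMDiffOn_extChartAt_symm (n := ∞) x₀).mono Set.inter_subset_left)
    Set.inter_subset_right).contDiffOn

theorem contMDiffOn_of_comp_symm {U : Set M} (hU : IsOpen U) {f : M → F}
    (hf : ∀ x₀ : M, ContDiffOn ℝ ∞ (fun y => f ((extChartAt 𝓘(ℝ, E) x₀).symm y))
      ((extChartAt 𝓘(ℝ, E) x₀).target ∩ (extChartAt 𝓘(ℝ, E) x₀).symm ⁻¹' U)) :
    ContMDiffOn 𝓘(ℝ, E) 𝓘(ℝ, F) ∞ f U := fun x hx => by
  have h1 : ContMDiffOn 𝓘(ℝ, E) 𝓘(ℝ, F) ∞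
      ((fun y => f ((extChartAt 𝓘(ℝ, E) x).symm y)) ∘ extChartAt 𝓘(ℝ, E) x)
      ((chartAt E x).source ∩ U) := by
    refine (hf x).contMDiffOn.comp (contMDiffOn_extChartAt.mono Set.inter_subset_left) ?_
    intro y hy
    have hy' : y ∈ (extChartAt 𝓘(ℝ, E) x).source := by simpa using hy.1
    refine ⟨(extChartAt 𝓘(ℝ, E) x).map_source hy', ?_⟩
    rw [Set.mem_preimage, (extChartAt 𝓘(ℝ, E) x).left_inv hy']
    exact hy.2
  have hn : (chartAt E x).source ∩ U ∈ 𝓝 x :=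
    Filter.inter_mem (chart_source_mem_nhds E x) (hU.mem_nhds hx)
  refine ContMDiffAt.contMDiffWithinAt ((h1.contMDiffAt hn).congr_of_eventuallyEq ?_)
  filter_upwards [hn] with y hy
  have hy' : y ∈ (extChartAt 𝓘(ℝ, E) x).source := by simpa using hy.1
  rw [Function.comp_apply, (extChartAt 𝓘(ℝ, E) x).left_inv hy']

theorem SmoothFormOn.mono {n : ℕ} {U V : Set M} {η : Form E M n F} (h : SmoothFormOn U η)
    (hV : V ⊆ U) : SmoothFormOn V η := fun x₀ =>
  (h x₀).mono (Set.inter_subset_inter_right _ (Set.preimage_mono hV))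

theorem SmoothFieldOn.mono {U V : Set M} {X : ∀ x : M, T E x} (h : SmoothFieldOn U X)
    (hV : V ⊆ U) : SmoothFieldOn V X := ContMDiffOn.mono h hV

theorem SmoothFormOn.apply {n : ℕ} {U : Set M} (hU : IsOpen U) {η : Form E M n F}
    (hη : SmoothFormOn U η) {X : Fin n → ∀ x : M, T E x} (hX : ∀ i, SmoothFieldOn U (X i)) :
    ContMDiffOn 𝓘(ℝ, E) 𝓘(ℝ, F) ∞ (fun x => η x (fun i => X i x)) U := by
  refine contMDiffOn_of_comp_symm hU fun x₀ => ?_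
  refine (ContDiffOn.alternating_apply (hη x₀)
    (fun i => contDiffOn_chartField (hX i) x₀)).congr fun y hy => ?_
  exact (chartRep_chartField η hy.1 X).symm

/-- It suffices to test on the fields that are constant in a chart: the values of the form on them
are the components of its chart expression. -/
theorem smoothFormOn_of_apply [FiniteDimensional ℝ F] {n : ℕ} {U : Set M} {η : Form E M n F}
    (hU : IsOpen U) (h : ∀ V : Set M, IsOpen V → V ⊆ U → ∀ X : Fin n → ∀ x : M, T E x,
      (∀ i, SmoothFieldOn V (X i)) →
      ContMDiffOn 𝓘(ℝ, E) 𝓘(ℝ, F) ∞ (fun x => η x (fun i => X i x)) V) :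
    SmoothFormOn U η := fun x₀ => by
  refine contDiffOn_alternating fun v => ?_
  have h1 := contDiffOn_comp_symm (h ((extChartAt 𝓘(ℝ, E) x₀).source ∩ U)
    ((isOpen_extChartAt_source x₀).inter hU) Set.inter_subset_right
    (fun i => constField x₀ (v i))
    (fun i => (smoothFieldOn_constField x₀ (v i)).mono Set.inter_subset_left)) x₀
  refine (h1.mono ?_).congr fun y hy => ?_
  · intro y hy
    exact ⟨hy.1, (extChartAt 𝓘(ℝ, E) x₀).map_target hy.1, hy.2⟩
  · simp only [constField_symm hy.1]
    rfl

theorem SmoothFormOn.contDiffAt {n : ℕ} {U : Set M} (hU : IsOpen U) {η : Form E M n F}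
    (hη : SmoothFormOn U η) {x₀ : M} {y : E} (hy : y ∈ (extChartAt 𝓘(ℝ, E) x₀).target)
    (hyU : (extChartAt 𝓘(ℝ, E) x₀).symm y ∈ U) :
    ContDiffAt ℝ ∞ (chartRep η x₀) y :=
  (hη x₀).contDiffAt (((continuousOn_extChartAt_symm x₀).isOpen_inter_preimage
    (isOpen_extChartAt_target x₀) hU).mem_nhds ⟨hy, hyU⟩)

theorem SmoothFieldOn.contDiffAt {U : Set M} (hU : IsOpen U) {X : ∀ x : M, T E x}
    (hX : SmoothFieldOn U X) {x₀ : M} {y : E} (hy : y ∈ (extChartAt 𝓘(ℝ, E) x₀).target)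
    (hyU : (extChartAt 𝓘(ℝ, E) x₀).symm y ∈ U) : ContDiffAt ℝ ∞ (chartField X x₀) y :=
  (contDiffOn_chartField hX x₀).contDiffAt (((continuousOn_extChartAt_symm x₀).isOpen_inter_preimage
    (isOpen_extChartAt_target x₀) hU).mem_nhds ⟨hy, hyU⟩)

theorem contDiffAt_comp_symm {U : Set M} (hU : IsOpen U) {f : M → F}
    (hf : ContMDiffOn 𝓘(ℝ, E) 𝓘(ℝ, F) ∞ f U) {x₀ : M} {y : E}
    (hy : y ∈ (extChartAt 𝓘(ℝ, E) x₀).target) (hyU : (extChartAt 𝓘(ℝ, E) x₀).symm y ∈ U) :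
    ContDiffAt ℝ ∞ (fun y => f ((extChartAt 𝓘(ℝ, E) x₀).symm y)) y :=
  (contDiffOn_comp_symm hf x₀).contDiffAt (((continuousOn_extChartAt_symm x₀).isOpen_inter_preimage
    (isOpen_extChartAt_target x₀) hU).mem_nhds ⟨hy, hyU⟩)

theorem extDFun_apply {U : Set M} (hU : IsOpen U) {f : M → ℂ}
    (hf : ContMDiffOn 𝓘(ℝ, E) 𝓘(ℝ, ℂ) ∞ f U) {x : M} (hx : x ∈ U) (v : T E x) :
    extDFun E f x v = fderiv ℝ (fun y => f ((extChartAt 𝓘(ℝ, E) x).symm y))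
      (extChartAt 𝓘(ℝ, E) x x) (chartD x x v) := by
  have hg : MDifferentiableAt 𝓘(ℝ, E) 𝓘(ℝ, ℂ)
      (fun y : E => f ((extChartAt 𝓘(ℝ, E) x).symm y)) (extChartAt 𝓘(ℝ, E) x x) :=
    ((contDiffAt_comp_symm hU hf (mem_extChartAt_target x)
      (by simpa using hx)).differentiableAt (by simp)).mdifferentiableAt
  have hφ : MDifferentiableAt 𝓘(ℝ, E) 𝓘(ℝ, E) (extChartAt 𝓘(ℝ, E) x) x :=
    mdifferentiableAt_extChartAt (mem_chart_source E x)
  have h2 := mfderiv_comp x hg hφ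
  have h3 : mfderiv 𝓘(ℝ, E) 𝓘(ℝ, ℂ) f x = mfderiv 𝓘(ℝ, E) 𝓘(ℝ, ℂ)
      ((fun y : E => f ((extChartAt 𝓘(ℝ, E) x).symm y)) ∘ extChartAt 𝓘(ℝ, E) x) x := by
    refine Filter.EventuallyEq.mfderiv_eq ?_
    filter_upwards [extChartAt_source_mem_nhds (I := 𝓘(ℝ, E)) x] with y hy
    rw [Function.comp_apply, (extChartAt 𝓘(ℝ, E) x).left_inv hy]
  have h4 : extDFun E f x v = mfderiv 𝓘(ℝ, E) 𝓘(ℝ, ℂ) f x v := rfl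
  rw [h4, h3, h2, mfderiv_eq_fderiv]
  rfl

end FormCalculus

/-! ### The exterior derivative and Lie brackets -/

section Cartan

variable {E : Type*} [NormedAddCommGroup E] [NormedSpace ℝ E] [FiniteDimensional ℝ E]
  {M : Type*} [TopologicalSpace M] [ChartedSpace E M] [IsManifold 𝓘(ℝ, E) ∞ M]

theorem chartD_mlieBracket (X Y : ∀ x : M, T E x) (x : M) :
    chartD x x (VectorField.mlieBracket 𝓘(ℝ, E) X Y x) =
      VectorField.lieBracket ℝ (chartField X x) (chartField Y x) (extChartAt 𝓘(ℝ, E) x x) := by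
  have hx : x ∈ (extChartAt 𝓘(ℝ, E) x).source := mem_extChartAt_source x
  have hf : ∀ Z : ∀ x : M, T E x, VectorField.mpullbackWithin 𝓘(ℝ, E) 𝓘(ℝ, E)
      (extChartAt 𝓘(ℝ, E) x).symm Z (Set.range 𝓘(ℝ, E))
      =ᶠ[𝓝 (extChartAt 𝓘(ℝ, E) x x)] chartField Z x := fun Z => by
    filter_upwards [(isOpen_extChartAt_target (I := 𝓘(ℝ, E)) x).mem_nhds (mem_extChartAt_target x)]
      with y hy
    have h1 := isInvertible_mfderivWithin_extChartAt_symm (I := 𝓘(ℝ, E)) (x := x) hy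
    rw [VectorField.mpullbackWithin_apply]
    simp only [modelWithCornersSelf_coe, Set.range_id, mfderivWithin_univ] at h1 ⊢
    obtain ⟨e, he⟩ := h1
    have h2 := chartDSymm_chartD hy (Z ((extChartAt 𝓘(ℝ, E) x).symm y))
    change (mfderiv 𝓘(ℝ, E) 𝓘(ℝ, E) (extChartAt 𝓘(ℝ, E) x).symm y) _ = _ at h2
    rw [← he] at h2 ⊢
    rw [ContinuousLinearMap.inverse_equiv]
    exact e.symm_apply_eq.mpr h2.symm
  have h2 : ∀ A B : E → E, A =ᶠ[𝓝 (extChartAt 𝓘(ℝ, E) x x)] chartField X x →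
      B =ᶠ[𝓝 (extChartAt 𝓘(ℝ, E) x x)] chartField Y x →
      VectorField.lieBracketWithin ℝ A B
        ((extChartAt 𝓘(ℝ, E) x).symm ⁻¹' Set.univ ∩ Set.range 𝓘(ℝ, E))
        (extChartAt 𝓘(ℝ, E) x x) =
      VectorField.lieBracket ℝ (chartField X x) (chartField Y x) (extChartAt 𝓘(ℝ, E) x x) := by
    intro A B hA hB
    rw [← Filter.EventuallyEq.lieBracket_vectorField_eq hA hB]
    simp only [modelWithCornersSelf_coe, Set.range_id, Set.preimage_univ, Set.inter_univ,
      VectorField.lieBracketWithin_univ]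
  -- By definition the bracket on `M` at x is the inverse of the chart derivative applied to the
  -- bracket of the chart expressions, that is, a value of `constField`.
  exact (congrArg (fun w => chartD x x (constField x w x)) (h2 _ _ (hf X) (hf Y))).trans
    (chartD_constField (E := E) hx _)

theorem chartField_self (X : ∀ x : M, T E x) (x : M) :
    chartField X x (extChartAt 𝓘(ℝ, E) x x) = chartD x x (X x) := by
  rw [chartField, extChartAt_to_inv]

theorem chartRep_self {n : ℕ} {F : Type*} [NormedAddCommGroup F] [NormedSpace ℝ F]
    (η : Form E M n F) (x : M) (v : Fin n → T E x) :
    chartRep η x (extChartAt 𝓘(ℝ, E) x x) (fun i => chartD x x (v i)) = η x v := by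
  have h := chartRep_chartField η (mem_extChartAt_target (I := 𝓘(ℝ, E)) x)
    (fun i => constField x (chartD x x (v i)))
  simp only [chartField_self, chartD_constField (mem_extChartAt_source (I := 𝓘(ℝ, E)) x)] at h
  rw [h, extChartAt_to_inv]
  simp only [constField_chartD (mem_extChartAt_source (I := 𝓘(ℝ, E)) x)]

variable {U : Set M} {x : M}

theorem extDFun_form {n : ℕ} (hU : IsOpen U) (hx : x ∈ U) {η : Form E M n ℂ}
    (hη : SmoothFormOn U η) {X : Fin n → ∀ x : M, T E x} (hX : ∀ i, SmoothFieldOn U (X i))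
    (Z : T E x) :
    extDFun E (fun y => η y (fun i => X i y)) x Z =
      fderiv ℝ (fun y => chartRep η x y (fun i => chartField (X i) x y))
        (extChartAt 𝓘(ℝ, E) x x) (chartD x x Z) := by
  rw [extDFun_apply hU (hη.apply hU hX) hx]
  congr 1
  refine Filter.EventuallyEq.fderiv_eq ?_
  filter_upwards [(isOpen_extChartAt_target (I := 𝓘(ℝ, E)) x).mem_nhds (mem_extChartAt_target x)]
    with y hy
  exact (chartRep_chartField η hy X).symm

/-- The invariant formula of the model space, read in the chart at x. A pair of indices i < k is
encoded by i and j = k - 1 ≥ i; this shift turns the usual sign (-1)^(i+k) into the minus sign in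
front of the second sum. -/
theorem extD_apply_fields {n : ℕ} (hU : IsOpen U) (hx : x ∈ U) {η : Form E M (n + 1) ℂ}
    (hη : SmoothFormOn U η) {X : Fin (n + 2) → ∀ x : M, T E x}
    (hX : ∀ i, SmoothFieldOn U (X i)) :
    extD η x (fun i => X i x) =
      ∑ i : Fin (n + 2), (-1) ^ (i : ℕ) • extDFun E (fun y => η y (i.removeNth fun j => X j y)) x (X i x) -
        ∑ i : Fin (n + 1), ∑ j ≥ i, (-1) ^ ((i : ℕ) + (j : ℕ)) •
          η x (Matrix.vecCons (VectorField.mlieBracket 𝓘(ℝ, E) (X i.castSucc) (X j.succ) x)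
            (j.removeNth (i.castSucc.removeNth fun k => X k x))) := by
  have ht := mem_extChartAt_target (I := 𝓘(ℝ, E)) x
  have hxU : (extChartAt 𝓘(ℝ, E) x).symm (extChartAt 𝓘(ℝ, E) x x) ∈ U := by
    rwa [extChartAt_to_inv]
  have h := extDeriv_apply_vectorField (V := fun i => chartField (X i) x)
    ((hη.contDiffAt hU ht hxU).differentiableAt (by simp))
    (fun i => ((hX i).contDiffAt hU ht hxU).differentiableAt (by simp))
  simp only [chartField_self] at h
  rw [extD_eq]
  refine h.trans ?_
  congr 1
  · refine Finset.sum_congr rfl fun i _ => ?_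
    congr 1
    exact (extDFun_form hU hx hη (X := i.removeNth X) (fun j => hX _) (X i x)).symm
  · refine Finset.sum_congr rfl fun i _ => Finset.sum_congr rfl fun j _ => ?_
    congr 1
    rw [← chartRep_self]
    congr 1
    funext k
    refine Fin.cases ?_ (fun k => ?_) k
    · exact (chartD_mlieBracket _ _ x).symm
    · rfl

/-- Cartan's formula for the differential of a one-form. -/
theorem extD_one (hU : IsOpen U) (hx : x ∈ U) {α : Form E M 1 ℂ} (hα : SmoothFormOn U α)
    {X Y : ∀ x : M, T E x} (hX : SmoothFieldOn U X) (hY : SmoothFieldOn U Y) :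
    extD α x ![X x, Y x] =
      extDFun E (fun y => α y ![Y y]) x (X x) - extDFun E (fun y => α y ![X y]) x (Y x) -
        α x ![VectorField.mlieBracket 𝓘(ℝ, E) X Y x] := by
  have h := extD_apply_fields hU hx hα (X := ![X, Y]) (by
    intro i; fin_cases i <;> assumption)
  have e0 : (fun i => (![X, Y] : Fin 2 → ∀ x : M, T E x) i x) = ![X x, Y x] := by
    funext i; fin_cases i <;> rfl
  have e1 : ∀ y, ((0 : Fin 2).removeNth fun j => (![X, Y] : Fin 2 → ∀ x : M, T E x) j y) =
      ![Y y] := fun y => by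
    funext i; fin_cases i; rfl
  have e2 : ∀ y, ((1 : Fin 2).removeNth fun j => (![X, Y] : Fin 2 → ∀ x : M, T E x) j y) =
      ![X y] := fun y => by
    funext i; fin_cases i; rfl
  have e3 : ∀ (Z : T E x) (w : Fin 0 → T E x), Matrix.vecCons Z w = ![Z] := fun Z w => by
    funext i; fin_cases i; rfl
  rw [e0] at h
  rw [h]
  simp [Fin.sum_univ_two, e1, e2, e3]
  ring


theorem extD_two (hU : IsOpen U) (hx : x ∈ U) {η : Form E M 2 ℂ} (hη : SmoothFormOn U η)
    {X Y Z : ∀ x : M, T E x} (hX : SmoothFieldOn U X) (hY : SmoothFieldOn U Y)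
    (hZ : SmoothFieldOn U Z) :
    extD η x ![X x, Y x, Z x] =
      extDFun E (fun y => η y ![Y y, Z y]) x (X x) - extDFun E (fun y => η y ![X y, Z y]) x (Y x) +
      extDFun E (fun y => η y ![X y, Y y]) x (Z x) -
      η x ![VectorField.mlieBracket 𝓘(ℝ, E) X Y x, Z x] +
      η x ![VectorField.mlieBracket 𝓘(ℝ, E) X Z x, Y x] -
      η x ![VectorField.mlieBracket 𝓘(ℝ, E) Y Z x, X x] := by
  have h := extD_apply_fields hU hx hη (X := ![X, Y, Z]) (by
    intro i; fin_cases i <;> assumption)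
  have e0 : (fun i => (![X, Y, Z] : Fin 3 → ∀ x : M, T E x) i x) = ![X x, Y x, Z x] := by
    funext i; fin_cases i <;> rfl
  have e1 : ∀ y, ((0 : Fin 3).removeNth fun j => (![X, Y, Z] : Fin 3 → ∀ x : M, T E x) j y) =
      ![Y y, Z y] := fun y => by
    funext i; fin_cases i <;> rfl
  have e2 : ∀ y, ((1 : Fin 3).removeNth fun j => (![X, Y, Z] : Fin 3 → ∀ x : M, T E x) j y) =
      ![X y, Z y] := fun y => by
    funext i; fin_cases i <;> rfl
  have e3 : ∀ y, ((2 : Fin 3).removeNth fun j => (![X, Y, Z] : Fin 3 → ∀ x : M, T E x) j y) =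
      ![X y, Y y] := fun y => by
    funext i; fin_cases i <;> rfl
  have e4 : ∀ (V W : T E x) (v : Fin 1 → T E x), v 0 = W → Matrix.vecCons V v = ![V, W] :=
    fun Z W v hv => by
    funext i; fin_cases i; rfl; exact hv
  have s0 : (Finset.Ici (0 : Fin 2)) = {0, 1} := by decide
  have s1 : (Finset.Ici (1 : Fin 2)) = {1} := by decide
  rw [e0] at h
  rw [h, Fin.sum_univ_three, Fin.sum_univ_two, s0, s1, Finset.sum_pair (by decide),
    Finset.sum_singleton]
  simp only [e1, e2, e3]
  change (-1 : ℤ) ^ 0 • extDFun E (fun y => η y ![Y y, Z y]) x (X x) +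
    (-1 : ℤ) ^ 1 • extDFun E (fun y => η y ![X y, Z y]) x (Y x) +
    (-1 : ℤ) ^ 2 • extDFun E (fun y => η y ![X y, Y y]) x (Z x) -
    ((-1 : ℤ) ^ (0 + 0) • η x (Matrix.vecCons (VectorField.mlieBracket 𝓘(ℝ, E) X Y x)
        ((0 : Fin 2).removeNth ((0 : Fin 3).removeNth ![X x, Y x, Z x]))) +
      (-1 : ℤ) ^ (0 + 1) • η x (Matrix.vecCons (VectorField.mlieBracket 𝓘(ℝ, E) X Z x)
        ((1 : Fin 2).removeNth ((0 : Fin 3).removeNth ![X x, Y x, Z x]))) +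
      (-1 : ℤ) ^ (1 + 1) • η x (Matrix.vecCons (VectorField.mlieBracket 𝓘(ℝ, E) Y Z x)
        ((1 : Fin 2).removeNth ((1 : Fin 3).removeNth ![X x, Y x, Z x])))) = _
  rw [e4 _ (Z x) ((0 : Fin 2).removeNth ((0 : Fin 3).removeNth ![X x, Y x, Z x])) rfl,
    e4 _ (Y x) ((1 : Fin 2).removeNth ((0 : Fin 3).removeNth ![X x, Y x, Z x])) rfl,
    e4 _ (X x) ((1 : Fin 2).removeNth ((1 : Fin 3).removeNth ![X x, Y x, Z x])) rfl]
  norm_num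
  ring

end Cartan

/-! ### Naturality of the exterior derivative, and d² = 0 -/

section ExtD

variable {E : Type*} [NormedAddCommGroup E] [NormedSpace ℝ E] [FiniteDimensional ℝ E]
  {M : Type*} [TopologicalSpace M] [ChartedSpace E M] [IsManifold 𝓘(ℝ, E) ∞ M]
  {F F' : Type*} [NormedAddCommGroup F] [NormedSpace ℝ F] [NormedAddCommGroup F'] [NormedSpace ℝ F']
  {U : Set M} {x : M} {n : ℕ}

theorem SmoothFormOn.comp_clm {η : Form E M n F} (hη : SmoothFormOn U η) (L : F →L[ℝ] F') :
    SmoothFormOn U (fun x => L.compContinuousAlternatingMap (η x)) := fun x₀ =>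
  (ContinuousLinearMap.compContinuousAlternatingMapCLM ℝ E F F' (Fin n) L).contDiff.comp_contDiffOn (hη x₀)

theorem SmoothFormOn.add {η ξ : Form E M n F} (hη : SmoothFormOn U η) (hξ : SmoothFormOn U ξ) :
    SmoothFormOn U (fun x => η x + ξ x) := fun x₀ => (hη x₀).add (hξ x₀)

theorem SmoothFormOn.sub {η ξ : Form E M n F} (hη : SmoothFormOn U η) (hξ : SmoothFormOn U ξ) :
    SmoothFormOn U (fun x => η x - ξ x) := fun x₀ => (hη x₀).sub (hξ x₀)

theorem SmoothFormOn.neg {η : Form E M n F} (hη : SmoothFormOn U η) :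
    SmoothFormOn U (fun x => -η x) := fun x₀ => (hη x₀).neg

theorem SmoothFormOn.smul {η : Form E M n ℂ} (hη : SmoothFormOn U η) (c : ℂ) :
    SmoothFormOn U (fun x => c • η x) := fun x₀ => (hη x₀).const_smul c

theorem SmoothFormOn.cx {η : Form E M n ℝ} (hη : SmoothFormOn U η) :
    SmoothFormOn U (fun x => cxForm (η x)) := hη.comp_clm Complex.ofRealCLM

theorem SmoothFormOn.differentiableAt_chartRep {η : Form E M n F} (hU : IsOpen U) (hx : x ∈ U)
    (hη : SmoothFormOn U η) :
    DifferentiableAt ℝ (chartRep η x) (extChartAt 𝓘(ℝ, E) x x) :=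
  (hη.contDiffAt hU (mem_extChartAt_target x) (by rwa [extChartAt_to_inv])).differentiableAt
    (by simp)

/-- Real-linear operations on the values commute with d. Scalar multiplication, sign,
complexification and complex conjugation of forms are all instances. -/
theorem extD_comp_clm (hU : IsOpen U) (hx : x ∈ U) {η : Form E M n F} (hη : SmoothFormOn U η)
    (L : F →L[ℝ] F') :
    extD (fun x => L.compContinuousAlternatingMap (η x)) x =
      L.compContinuousAlternatingMap (extD η x) := by
  have h := hη.differentiableAt_chartRep hU hx
  rw [extD_eq, extD_eq]
  ext v
  change extDeriv _ _ _ = L (extDeriv _ _ _)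
  rw [extDeriv_apply ((hη.comp_clm L).differentiableAt_chartRep hU hx), extDeriv_apply h, map_sum]
  refine Finset.sum_congr rfl fun i _ => ?_
  rw [map_zsmul]
  congr 1
  have h2 := L.hasFDerivAt.comp (extChartAt 𝓘(ℝ, E) x x)
    (h.continuousAlternatingMap_apply_const
      (i.removeNth fun j => chartD x x (v j))).hasFDerivAt
  exact DFunLike.congr_fun h2.fderiv _

theorem extD_add (hU : IsOpen U) (hx : x ∈ U) {η ξ : Form E M n F} (hη : SmoothFormOn U η)
    (hξ : SmoothFormOn U ξ) : extD (fun x => η x + ξ x) x = extD η x + extD ξ x := by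
  rw [extD_eq, extD_eq, extD_eq]
  have h := extDeriv_add (hη.differentiableAt_chartRep hU hx) (hξ.differentiableAt_chartRep hU hx)
  change (extDeriv (chartRep η x + chartRep ξ x) _).compContinuousLinearMap _ = _
  rw [h]
  rfl

theorem extD_smul (hU : IsOpen U) (hx : x ∈ U) {η : Form E M n ℂ} (hη : SmoothFormOn U η) (c : ℂ) :
    extD (fun x => c • η x) x = c • extD η x :=
  extD_comp_clm hU hx hη ((c • ContinuousLinearMap.id ℂ ℂ).restrictScalars ℝ)

theorem extD_neg (hU : IsOpen U) (hx : x ∈ U) {η : Form E M n F} (hη : SmoothFormOn U η) :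
    extD (fun x => -η x) x = -extD η x :=
  extD_comp_clm hU hx hη (-ContinuousLinearMap.id ℝ F)

theorem extD_cx (hU : IsOpen U) (hx : x ∈ U) {η : Form E M n ℝ} (hη : SmoothFormOn U η) :
    extD (fun x => cxForm (η x)) x = cxForm (extD η x) :=
  extD_comp_clm hU hx hη Complex.ofRealCLM

theorem chartRep_chartD (η : Form E M n F) {x₀ x : M} (hx : x ∈ (extChartAt 𝓘(ℝ, E) x₀).source)
    (v : Fin n → T E x) :
    chartRep η x₀ (extChartAt 𝓘(ℝ, E) x₀ x) (fun i => chartD x₀ x (v i)) = η x v := by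
  have h := chartRep_chartField η ((extChartAt 𝓘(ℝ, E) x₀).map_source hx)
    (fun i => constField x₀ (chartD x₀ x (v i)))
  have e : ∀ X : ∀ x : M, T E x, chartField X x₀ (extChartAt 𝓘(ℝ, E) x₀ x) = chartD x₀ x (X x) :=
    fun X => by rw [chartField, (extChartAt 𝓘(ℝ, E) x₀).left_inv hx]
  simp only [e, chartD_constField hx] at h
  rw [h, (extChartAt 𝓘(ℝ, E) x₀).left_inv hx]
  simp only [constField_chartD hx]

theorem minSmoothness_two_le : minSmoothness ℝ 2 ≤ ∞ := by
  rw [minSmoothness_of_isRCLikeNormedField]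
  exact ENat.LEInfty.out

/-- By definition d is computed at each point in a chart of its own. Naturality under transition
maps shows that a single chart computes it at all its points, which is needed before d can be
differentiated or iterated. -/
theorem chartRep_extD (hU : IsOpen U) {η : Form E M n F} (hη : SmoothFormOn U η) {x₀ : M} {y : E}
    (hy : y ∈ (extChartAt 𝓘(ℝ, E) x₀).target) (hyU : (extChartAt 𝓘(ℝ, E) x₀).symm y ∈ U) :
    chartRep (extD η) x₀ y = extDeriv (chartRep η x₀) y := by
  generalize hz : (extChartAt 𝓘(ℝ, E) x₀).symm y = z at hyU
  have hzs := mem_extChartAt_source (I := 𝓘(ℝ, E)) z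
  -- The transition map from the chart at x₀ to the chart at z, in which dη is defined at z. The
  -- chart expressions of η near y are related by pullback along τ.
  let τ : E → E := fun y' => extChartAt 𝓘(ℝ, E) z ((extChartAt 𝓘(ℝ, E) x₀).symm y')
  have hopen : IsOpen ((extChartAt 𝓘(ℝ, E) x₀).target ∩
      (extChartAt 𝓘(ℝ, E) x₀).symm ⁻¹' (extChartAt 𝓘(ℝ, E) z).source) :=
    (continuousOn_extChartAt_symm x₀).isOpen_inter_preimage (isOpen_extChartAt_target x₀)
      (isOpen_extChartAt_source z)
  have hmem : (extChartAt 𝓘(ℝ, E) x₀).target ∩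
      (extChartAt 𝓘(ℝ, E) x₀).symm ⁻¹' (extChartAt 𝓘(ℝ, E) z).source ∈ 𝓝 y :=
    hopen.mem_nhds ⟨hy, by rwa [Set.mem_preimage, hz]⟩
  have hτ : ContDiffAt ℝ ∞ τ y :=
    ((contMDiffOn_extChartAt (I := 𝓘(ℝ, E)) (n := ∞) (x := z)).comp
      ((contMDiffOn_extChartAt_symm (I := 𝓘(ℝ, E)) (n := ∞) x₀).mono Set.inter_subset_left)
      (fun y' hy' => by rw [← extChartAt_source 𝓘(ℝ, E)]; exact hy'.2)).contDiffOn.contDiffAt hmem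
  have hdτ : ∀ y' ∈ (extChartAt 𝓘(ℝ, E) x₀).target ∩
      (extChartAt 𝓘(ℝ, E) x₀).symm ⁻¹' (extChartAt 𝓘(ℝ, E) z).source, ∀ v,
      fderiv ℝ τ y' v = chartD z ((extChartAt 𝓘(ℝ, E) x₀).symm y') (chartDSymm x₀ y' v) := by
    intro y' hy' v
    have h1 : MDifferentiableAt 𝓘(ℝ, E) 𝓘(ℝ, E) (extChartAt 𝓘(ℝ, E) x₀).symm y' :=
      ((contMDiffOn_extChartAt_symm (I := 𝓘(ℝ, E)) (n := ∞) x₀).contMDiffAt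
        ((isOpen_extChartAt_target x₀).mem_nhds hy'.1)).mdifferentiableAt (by simp)
    have h2 : MDifferentiableAt 𝓘(ℝ, E) 𝓘(ℝ, E) (extChartAt 𝓘(ℝ, E) z)
        ((extChartAt 𝓘(ℝ, E) x₀).symm y') :=
      mdifferentiableAt_extChartAt (by rw [← extChartAt_source 𝓘(ℝ, E)]; exact hy'.2)
    rw [← mfderiv_eq_fderiv]
    exact DFunLike.congr_fun (mfderiv_comp y' h2 h1) v
  have hpull : chartRep η x₀ =ᶠ[𝓝 y]
      fun y' => (chartRep η z (τ y')).compContinuousLinearMap (fderiv ℝ τ y') := by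
    filter_upwards [hmem] with y' hy'
    ext v
    change _ = chartRep η z (τ y') fun i => fderiv ℝ τ y' (v i)
    simp only [hdτ y' hy']
    exact (chartRep_chartD η hy'.2 fun i => chartDSymm x₀ y' (v i)).symm
  have hτy : τ y = extChartAt 𝓘(ℝ, E) z z := by simp only [τ, hz]
  rw [hpull.extDeriv_eq, extDeriv_pullback (r := ∞) _ hτ minSmoothness_two_le, hτy]
  · ext v
    change extD η _ _ = extDeriv _ _ (fun i => fderiv ℝ τ y (v i))
    simp only [hdτ y (mem_of_mem_nhds hmem)]
    subst hz
    rfl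
  · rw [hτy]
    exact hη.differentiableAt_chartRep hU hyU

theorem SmoothFormOn.extD (hU : IsOpen U) {η : Form E M n F} (hη : SmoothFormOn U η) :
    SmoothFormOn U (extD η) := fun x₀ => by
  have h : ContDiffOn ℝ ∞ (extDeriv (chartRep η x₀)) ((extChartAt 𝓘(ℝ, E) x₀).target ∩
      (extChartAt 𝓘(ℝ, E) x₀).symm ⁻¹' U) := by
    have ho := (continuousOn_extChartAt_symm (I := 𝓘(ℝ, E)) x₀).isOpen_inter_preimage
      (isOpen_extChartAt_target x₀) hU
    exact (ContinuousAlternatingMap.alternatizeUncurryFinCLM ℝ E F).contDiff.comp_contDiffOn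
      ((hη x₀).fderiv_of_isOpen ho (m := ∞) le_rfl)
  exact h.congr fun y hy => chartRep_extD hU hη hy.1 hy.2

theorem extD_extD (hU : IsOpen U) (hx : x ∈ U) {η : Form E M n F} (hη : SmoothFormOn U η) :
    GenKahler.extD (GenKahler.extD η) x = 0 := by
  have ht := mem_extChartAt_target (I := 𝓘(ℝ, E)) x
  have hxU : (extChartAt 𝓘(ℝ, E) x).symm (extChartAt 𝓘(ℝ, E) x x) ∈ U := by
    rwa [extChartAt_to_inv]
  have h : chartRep (GenKahler.extD η) x =ᶠ[𝓝 (extChartAt 𝓘(ℝ, E) x x)]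
      extDeriv (chartRep η x) := by
    filter_upwards [((continuousOn_extChartAt_symm (I := 𝓘(ℝ, E)) x).isOpen_inter_preimage
      (isOpen_extChartAt_target x) hU).mem_nhds ⟨ht, hxU⟩] with y hy
    exact chartRep_extD hU hη hy.1 hy.2
  rw [extD_eq, h.extDeriv_eq, extDeriv_extDeriv_apply (r := ∞) (hη.contDiffAt hU ht hxU)
    minSmoothness_two_le]
  rfl

end ExtD

/-! ### Interior products evaluated on vectors -/

section Evaluation

variable {V : Type*} [AddCommGroup V] [Module ℝ V] [TopologicalSpace V]
  [IsTopologicalAddGroup V] [ContinuousSMul ℝ V]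

theorem vec_two (X Z : V) : Matrix.vecCons X (fun _ : Fin 1 => Z) = ![X, Z] := by
  funext i; fin_cases i <;> rfl

theorem vec_three (X Y Z : V) :
    Matrix.vecCons X (Matrix.vecCons Y (fun _ : Fin 1 => Z)) = ![X, Y, Z] := by
  rw [vec_two]

theorem toCovector_interior {F : Type*} [NormedAddCommGroup F] [NormedSpace ℝ F] (X Z : V)
    (η : V [⋀^Fin 2]→L[ℝ] F) : toCovector (interior X η) Z = η ![X, Z] := by
  rw [← vec_two]; rfl

theorem toCovector_interiorC (X : Cx V) (Z : V) (η : V [⋀^Fin 2]→L[ℝ] ℂ) :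
    toCovector (interiorC X η) Z = η ![X.re, Z] + Complex.I * η ![X.im, Z] := by
  rw [← vec_two, ← vec_two]; rfl

/-- The innermost vector fills the first slot: ι_X ι_Y η is η(Y, X, ·). This order fixes the sign of
the twisting term in all later computations. -/
theorem toCovector_interiorC_interiorC (X Y : Cx V) (Z : V) (η : V [⋀^Fin 3]→L[ℝ] ℂ) :
    toCovector (interiorC X (interiorC Y η)) Z =
      (η ![Y.re, X.re, Z] + Complex.I * η ![Y.im, X.re, Z]) +
        Complex.I * (η ![Y.re, X.im, Z] + Complex.I * η ![Y.im, X.im, Z]) := by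
  rw [← vec_three, ← vec_three, ← vec_three, ← vec_three]; rfl

variable {F : Type*} [NormedAddCommGroup F] [NormedSpace ℝ F]

theorem two_swap (η : V [⋀^Fin 2]→L[ℝ] F) (X Y : V) : η ![Y, X] = -η ![X, Y] := by
  have h := η.toAlternatingMap.map_swap ![X, Y] (i := 0) (j := 1) (by decide)
  have e : ![X, Y] ∘ Equiv.swap (0 : Fin 2) 1 = ![Y, X] := by
    funext i; fin_cases i <;> rfl
  rw [e] at h
  exact h

theorem two_add_left (η : V [⋀^Fin 2]→L[ℝ] F) (X Y Z : V) :
    η ![X + Y, Z] = η ![X, Z] + η ![Y, Z] := η.toAlternatingMap.map_vecCons_add _ _ _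

theorem two_smul_left (η : V [⋀^Fin 2]→L[ℝ] F) (c : ℝ) (X Z : V) :
    η ![c • X, Z] = c • η ![X, Z] := η.toAlternatingMap.map_vecCons_smul _ _ _

theorem two_neg_left (η : V [⋀^Fin 2]→L[ℝ] F) (X Z : V) : η ![-X, Z] = -η ![X, Z] := by
  rw [← neg_one_smul ℝ, two_smul_left, neg_one_smul]

theorem two_sub_left (η : V [⋀^Fin 2]→L[ℝ] F) (X Y Z : V) :
    η ![X - Y, Z] = η ![X, Z] - η ![Y, Z] := by
  rw [sub_eq_add_neg, two_add_left, two_neg_left, sub_eq_add_neg]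

theorem two_zero_left (η : V [⋀^Fin 2]→L[ℝ] F) (Z : V) : η ![0, Z] = 0 := by
  rw [← zero_smul ℝ (0 : V), two_smul_left, zero_smul]

end Evaluation

/-! ### Cartan's formulas on complex vector fields -/

section ComplexCartan

variable {E : Type*} [NormedAddCommGroup E] [NormedSpace ℝ E] [FiniteDimensional ℝ E]
  {M : Type*} [TopologicalSpace M] [ChartedSpace E M] [IsManifold 𝓘(ℝ, E) ∞ M]
  {U : Set M} {x : M}

theorem SmoothFormOn.apply_one {F : Type*} [NormedAddCommGroup F] [NormedSpace ℝ F]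
    (hU : IsOpen U) {β : ∀ x : M, T E x →L[ℝ] F}
    (hβ : SmoothFormOn U (fun x => oneForm (β x))) {X : ∀ x : M, T E x} (hX : SmoothFieldOn U X) :
    ContMDiffOn 𝓘(ℝ, E) 𝓘(ℝ, F) ∞ (fun x => β x (X x)) U :=
  hβ.apply hU (X := fun _ => X) fun _ => hX

theorem SmoothFormOn.apply_two {F : Type*} [NormedAddCommGroup F] [NormedSpace ℝ F]
    (hU : IsOpen U) {η : Form E M 2 F} (hη : SmoothFormOn U η) {X Y : ∀ x : M, T E x}
    (hX : SmoothFieldOn U X) (hY : SmoothFieldOn U Y) :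
    ContMDiffOn 𝓘(ℝ, E) 𝓘(ℝ, F) ∞ (fun x => η x ![X x, Y x]) U := by
  refine (hη.apply hU (X := ![X, Y]) (by intro i; fin_cases i <;> assumption)).congr fun y _ => ?_
  congr 1
  funext i; fin_cases i <;> rfl

theorem contMDiffOn_add_I_mul {f g : M → ℂ} (hf : ContMDiffOn 𝓘(ℝ, E) 𝓘(ℝ, ℂ) ∞ f U)
    (hg : ContMDiffOn 𝓘(ℝ, E) 𝓘(ℝ, ℂ) ∞ g U) :
    ContMDiffOn 𝓘(ℝ, E) 𝓘(ℝ, ℂ) ∞ (fun y => f y + Complex.I * g y) U :=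
  hf.add ((ContinuousLinearMap.mul ℝ ℂ Complex.I).contMDiff.comp_contMDiffOn hg)

theorem extDFun_add (hU : IsOpen U) (hx : x ∈ U) {f g : M → ℂ}
    (hf : ContMDiffOn 𝓘(ℝ, E) 𝓘(ℝ, ℂ) ∞ f U) (hg : ContMDiffOn 𝓘(ℝ, E) 𝓘(ℝ, ℂ) ∞ g U) :
    extDFun E (fun y => f y + g y) x = extDFun E f x + extDFun E g x := by
  have ht := mem_extChartAt_target (I := 𝓘(ℝ, E)) x
  have hxU : (extChartAt 𝓘(ℝ, E) x).symm (extChartAt 𝓘(ℝ, E) x x) ∈ U := by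
    rwa [extChartAt_to_inv]
  ext v
  have h0 := extDFun_apply hU (hf.add hg) hx v
  refine h0.trans ?_
  rw [add_apply, extDFun_apply hU hf hx, extDFun_apply hU hg hx]
  have h := fderiv_add ((contDiffAt_comp_symm hU hf ht hxU).differentiableAt (by simp))
    ((contDiffAt_comp_symm hU hg ht hxU).differentiableAt (by simp))
  exact DFunLike.congr_fun h _

theorem extDFun_comp_clm (hU : IsOpen U) (hx : x ∈ U) {f : M → ℂ}
    (hf : ContMDiffOn 𝓘(ℝ, E) 𝓘(ℝ, ℂ) ∞ f U) (L : ℂ →L[ℝ] ℂ) :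
    extDFun E (fun y => L (f y)) x = L.comp (extDFun E f x) := by
  have ht := mem_extChartAt_target (I := 𝓘(ℝ, E)) x
  have hxU : (extChartAt 𝓘(ℝ, E) x).symm (extChartAt 𝓘(ℝ, E) x x) ∈ U := by
    rwa [extChartAt_to_inv]
  ext v
  change _ = L (extDFun E f x v)
  refine (extDFun_apply hU (L.contMDiff.comp_contMDiffOn hf) hx v).trans ?_
  rw [extDFun_apply hU hf hx]
  have h := (L.hasFDerivAt.comp (extChartAt 𝓘(ℝ, E) x x)
    ((contDiffAt_comp_symm hU hf ht hxU).differentiableAt (by simp)).hasFDerivAt).fderiv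
  exact DFunLike.congr_fun h _

theorem extDFun_add_I_mul (hU : IsOpen U) (hx : x ∈ U) {f g : M → ℂ}
    (hf : ContMDiffOn 𝓘(ℝ, E) 𝓘(ℝ, ℂ) ∞ f U) (hg : ContMDiffOn 𝓘(ℝ, E) 𝓘(ℝ, ℂ) ∞ g U)
    (v : T E x) :
    extDFun E (fun y => f y + Complex.I * g y) x v =
      extDFun E f x v + Complex.I * extDFun E g x v := by
  have h0 := extDFun_add hU hx hf
    ((ContinuousLinearMap.mul ℝ ℂ Complex.I).contMDiff.comp_contMDiffOn hg)
  refine (DFunLike.congr_fun h0 v).trans ?_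
  have h := extDFun_comp_clm hU hx hg (ContinuousLinearMap.mul ℝ ℂ Complex.I)
  exact congrArg (extDFun E f x v + ·) (DFunLike.congr_fun h v)

theorem contMDiffOn_evalC (hU : IsOpen U) {β : ∀ x : M, T E x →L[ℝ] ℂ}
    (hβ : SmoothFormOn U (fun x => oneForm (β x))) {X : ∀ x : M, Cx (T E x)}
    (hX : SmoothFieldCOn U X) :
    ContMDiffOn 𝓘(ℝ, E) 𝓘(ℝ, ℂ) ∞ (fun x => evalC (β x) (X x)) U :=
  contMDiffOn_add_I_mul (hβ.apply_one hU hX.1) (hβ.apply_one hU hX.2)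

theorem extD_oneForm_apply (hU : IsOpen U) (hx : x ∈ U) {β : ∀ x : M, T E x →L[ℝ] ℂ}
    (hβ : SmoothFormOn U (fun x => oneForm (β x))) {X Y : ∀ x : M, T E x} (hX : SmoothFieldOn U X)
    (hY : SmoothFieldOn U Y) :
    extD (fun x => oneForm (β x)) x ![X x, Y x] =
      extDFun E (fun y => β y (Y y)) x (X x) - extDFun E (fun y => β y (X y)) x (Y x) -
        β x (VectorField.mlieBracket 𝓘(ℝ, E) X Y x) :=
  extD_one hU hx hβ hX hY

/-- Cartan's formula for the differential of a complex one-form, on complex vector fields. -/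
theorem extD_oneForm_complex (hU : IsOpen U) (hx : x ∈ U) {β : ∀ x : M, T E x →L[ℝ] ℂ}
    (hβ : SmoothFormOn U (fun x => oneForm (β x))) {X Y : ∀ x : M, Cx (T E x)}
    (hX : SmoothFieldCOn U X) (hY : SmoothFieldCOn U Y) :
    evalC (toCovector (interiorC (X x) (extD (fun x => oneForm (β x)) x))) (Y x) =
      evalC (extDFun E (fun y => evalC (β y) (Y y)) x) (X x) -
        evalC (extDFun E (fun y => evalC (β y) (X y)) x) (Y x) - evalC (β x) (lieC X Y x) := by
  have h := @extD_oneForm_apply E _ _ _ M _ _ _ U x hU hx β hβ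
  have hs := fun X hX => hβ.apply_one (X := X) hU hX
  simp only [evalC, toCovector_interiorC, lieC, map_add, map_sub]
  simp only [extDFun_add_I_mul hU hx (hs _ hY.1) (hs _ hY.2),
    extDFun_add_I_mul hU hx (hs _ hX.1) (hs _ hX.2)]
  -- Each real instance is weighted by `Complex.I` to the number of imaginary parts among its
  -- arguments. The last term is needed because `lieC` has the square of `Complex.I` already
  -- replaced by -1.
  linear_combination h hX.1 hY.1 + Complex.I * h hX.1 hY.2 + Complex.I * h hX.2 hY.1 +
    Complex.I ^ 2 * h hX.2 hY.2 -
    β x (VectorField.mlieBracket 𝓘(ℝ, E) (fun x => (X x).im) (fun x => (Y x).im) x) *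
      Complex.I_sq

theorem extDFun_two (hU : IsOpen U) (hx : x ∈ U) {η : Form E M 2 ℂ}
    (hη : SmoothFormOn U η) {X Y : ∀ x : M, Cx (T E x)}
    (hX : SmoothFieldCOn U X) (hY : SmoothFieldCOn U Y) (v : T E x) :
    extDFun E (fun y => evalC (toCovector (interiorC (X y) (η y))) (Y y)) x v =
      extDFun E (fun y => η y ![(X y).re, (Y y).re]) x v +
        Complex.I * extDFun E (fun y => η y ![(X y).im, (Y y).re]) x v +
        Complex.I * (extDFun E (fun y => η y ![(X y).re, (Y y).im]) x v +
        Complex.I * extDFun E (fun y => η y ![(X y).im, (Y y).im]) x v) := by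
  simp only [evalC, toCovector_interiorC]
  have hs := fun X Y hX hY => hη.apply_two (X := X) (Y := Y) hU hX hY
  have h1 := hs _ _ hX.1 hY.1
  have h2 := hs _ _ hX.2 hY.1
  have h3 := hs _ _ hX.1 hY.2
  have h4 := hs _ _ hX.2 hY.2
  rw [extDFun_add_I_mul hU hx (contMDiffOn_add_I_mul h1 h2) (contMDiffOn_add_I_mul h3 h4),
    extDFun_add_I_mul hU hx h1 h2, extDFun_add_I_mul hU hx h3 h4]

/-- Cartan's formula for the differential of a complex two-form, on complex vector fields. -/
theorem extD_two_complex (hU : IsOpen U) (hx : x ∈ U) {η : Form E M 2 ℂ}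
    (hη : SmoothFormOn U η) {X Y Z : ∀ x : M, Cx (T E x)}
    (hX : SmoothFieldCOn U X) (hY : SmoothFieldCOn U Y) (hZ : SmoothFieldCOn U Z) :
    evalC (toCovector (interiorC (Y x) (interiorC (X x) (extD η x)))) (Z x) =
      evalC (extDFun E (fun y => evalC (toCovector (interiorC (Y y) (η y))) (Z y)) x) (X x) -
      evalC (extDFun E (fun y => evalC (toCovector (interiorC (X y) (η y))) (Z y)) x) (Y x) +
      evalC (extDFun E (fun y => evalC (toCovector (interiorC (X y) (η y))) (Y y)) x) (Z x) -
      evalC (toCovector (interiorC (lieC X Y x) (η x))) (Z x) +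
      evalC (toCovector (interiorC (lieC X Z x) (η x))) (Y x) -
      evalC (toCovector (interiorC (lieC Y Z x) (η x))) (X x) := by
  have h := @extD_two E _ _ _ M _ _ _ U x hU hx η hη
  have h111 := h hX.1 hY.1 hZ.1
  have h112 := h hX.1 hY.1 hZ.2
  have h121 := h hX.1 hY.2 hZ.1
  have h122 := h hX.1 hY.2 hZ.2
  have h211 := h hX.2 hY.1 hZ.1
  have h212 := h hX.2 hY.1 hZ.2
  have h221 := h hX.2 hY.2 hZ.1
  have h222 := h hX.2 hY.2 hZ.2
  have e1 := extDFun_two hU hx hη hY hZ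
  have e2 := extDFun_two hU hx hη hX hZ
  have e3 := extDFun_two hU hx hη hX hY
  rw [evalC, evalC, evalC, evalC, e1, e1, e2, e2, e3, e3]
  simp only [evalC, toCovector_interiorC_interiorC]
  simp only [toCovector_interiorC, lieC, two_add_left, two_sub_left]
  linear_combination h111 + Complex.I * (h112 + h121 + h211) +
    Complex.I ^ 2 * (h122 + h212 + h221) + Complex.I ^ 3 * h222 +
    (-(η x ![VectorField.mlieBracket 𝓘(ℝ, E) (fun x => (X x).im) (fun x => (Y x).im) x, (Z x).re] +
      Complex.I *
        η x ![VectorField.mlieBracket 𝓘(ℝ, E) (fun x => (X x).im) (fun x => (Y x).im) x, (Z x).im]) +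
      (η x ![VectorField.mlieBracket 𝓘(ℝ, E) (fun x => (X x).im) (fun x => (Z x).im) x, (Y x).re] +
      Complex.I *
        η x ![VectorField.mlieBracket 𝓘(ℝ, E) (fun x => (X x).im) (fun x => (Z x).im) x, (Y x).im]) -
      (η x ![VectorField.mlieBracket 𝓘(ℝ, E) (fun x => (Y x).im) (fun x => (Z x).im) x, (X x).re] +
      Complex.I *
        η x ![VectorField.mlieBracket 𝓘(ℝ, E) (fun x => (Y x).im) (fun x => (Z x).im) x, (X x).im])) *
      Complex.I_sq

end ComplexCartan

/-! ### Gauge transformations and the Courant bracket -/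

section Courant

variable {E : Type*} [NormedAddCommGroup E] [NormedSpace ℝ E] [FiniteDimensional ℝ E]
  {M : Type*} [TopologicalSpace M] [ChartedSpace E M] [IsManifold 𝓘(ℝ, E) ∞ M]
  {U : Set M} {x : M}

theorem SmoothCOn.mono {V : Set M} {u : ∀ x : M, GTC (T E x)} (h : SmoothCOn U u)
    (hV : V ⊆ U) : SmoothCOn V u :=
  ⟨⟨h.1.1.mono hV, h.1.2.mono hV⟩, h.2.mono hV⟩

theorem smoothFormOn_interiorC (hU : IsOpen U) {η : Form E M 2 ℂ} (hη : SmoothFormOn U η)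
    {X : ∀ x : M, Cx (T E x)} (hX : SmoothFieldCOn U X) :
    SmoothFormOn U (fun x => oneForm (toCovector (interiorC (X x) (η x)))) := by
  refine smoothFormOn_of_apply hU fun V hV hVU Z hZ => ?_
  change ContMDiffOn 𝓘(ℝ, E) 𝓘(ℝ, ℂ) ∞
    (fun x => toCovector (interiorC (X x) (η x)) (Z 0 x)) V
  simp only [toCovector_interiorC]
  exact contMDiffOn_add_I_mul ((hη.mono hVU).apply_two hV (hX.1.mono hVU) (hZ 0))
    ((hη.mono hVU).apply_two hV (hX.2.mono hVU) (hZ 0))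

theorem SmoothCOn.gauge (hU : IsOpen U) {B : Form E M 2 ℂ} (hB : SmoothFormOn U B)
    {u : ∀ x : M, GTC (T E x)} (hu : SmoothCOn U u) :
    SmoothCOn U (fun x => gauge (B x) (u x)) :=
  ⟨hu.1, hu.2.add (smoothFormOn_interiorC hU hB hu.1)⟩

theorem exists_smoothFieldOn (x : M) (v : T E x) :
    ∃ U : Set M, IsOpen U ∧ x ∈ U ∧ ∃ X : ∀ x : M, T E x, SmoothFieldOn U X ∧ X x = v :=
  ⟨_, isOpen_extChartAt_source x, mem_extChartAt_source x, _,
    smoothFieldOn_constField x (chartD x x v), constField_chartD (mem_extChartAt_source x) v⟩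

theorem smoothFieldOn_zero : SmoothFieldOn U (fun x => (0 : T E x)) := by
  have h := ((Bundle.contMDiff_zeroSection ℝ (TangentSpace 𝓘(ℝ, E) : M → Type _)
    (F := E) (IB := 𝓘(ℝ, E)) (n := ∞))).contMDiffOn (s := U)
  exact h

theorem SmoothFieldOn.toC {X : ∀ x : M, T E x} (hX : SmoothFieldOn U X) :
    SmoothFieldCOn U (fun x => (⟨X x, 0⟩ : Cx (T E x))) := ⟨hX, smoothFieldOn_zero⟩

theorem evalC_real {V : Type*} [AddCommGroup V] [Module ℝ V] [TopologicalSpace V]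
    (β : V →L[ℝ] ℂ) (Z : V) : evalC β ⟨Z, 0⟩ = β Z := by simp [evalC]

theorem evalC_add {V : Type*} [AddCommGroup V] [Module ℝ V] [TopologicalSpace V]
    (α β : V →L[ℝ] ℂ) (X : Cx V) : evalC (α + β) X = evalC α X + evalC β X := by
  simp [evalC]; ring

theorem evalC_covector_swap {V : Type*} [AddCommGroup V] [Module ℝ V] [TopologicalSpace V]
    [IsTopologicalAddGroup V] [ContinuousSMul ℝ V] (η : V [⋀^Fin 2]→L[ℝ] ℂ) (X Y : Cx V) :
    evalC (toCovector (interiorC Y η)) X = -evalC (toCovector (interiorC X η)) Y := by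
  simp only [evalC, toCovector_interiorC]
  rw [two_swap η X.re Y.re, two_swap η X.re Y.im, two_swap η X.im Y.re, two_swap η X.im Y.im]
  ring

theorem lieC_swap (X Y : ∀ x : M, Cx (T E x)) (x : M) : lieC Y X x = -lieC X Y x := by
  have h := fun X Y : ∀ x : M, T E x =>
    VectorField.mlieBracket_swap_apply (I := 𝓘(ℝ, E)) (V := X) (W := Y) (x := x)
  refine Cx.ext ?_ ?_
  · simp only [lieC, Cx.re_neg]
    rw [h (fun x => (Y x).re), h (fun x => (Y x).im)]
    abel
  · simp only [lieC, Cx.im_neg]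
    rw [h (fun x => (Y x).re), h (fun x => (Y x).im)]
    abel

theorem interiorC_neg {V : Type*} [AddCommGroup V] [Module ℝ V] [TopologicalSpace V]
    [IsTopologicalAddGroup V] [ContinuousSMul ℝ V] (η : V [⋀^Fin 2]→L[ℝ] ℂ) (X : Cx V) (Z : V) :
    toCovector (interiorC (-X) η) Z = -toCovector (interiorC X η) Z := by
  simp only [toCovector_interiorC, Cx.re_neg, Cx.im_neg, two_neg_left]
  ring

theorem covector_interiorC_interiorC_add {V : Type*} [AddCommGroup V] [Module ℝ V]
    [TopologicalSpace V] [IsTopologicalAddGroup V] [ContinuousSMul ℝ V]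
    (η ξ : V [⋀^Fin 3]→L[ℝ] ℂ) (X Y : Cx V) :
    toCovector (interiorC X (interiorC Y (η + ξ))) =
      toCovector (interiorC X (interiorC Y η)) + toCovector (interiorC X (interiorC Y ξ)) := by
  ext Z
  rw [add_apply]
  simp only [toCovector_interiorC_interiorC, ContinuousAlternatingMap.add_apply]
  ring

/-- A gauge transformation `e^F` intertwines the `H`-twisted and the `(H + dF)`-twisted Courant
brackets. -/
theorem courant_gauge (hU : IsOpen U) (hx : x ∈ U) {B : Form E M 2 ℂ} (hB : SmoothFormOn U B)
    {H H' : Form E M 3 ℂ} (hH : H' x = H x + extD B x) {u v : ∀ x : M, GTC (T E x)}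
    (hu : SmoothCOn U u) (hv : SmoothCOn U v) :
    courant H' (fun y => gauge (B y) (u y)) (fun y => gauge (B y) (v y)) x =
      gauge (B x) (courant H u v x) := by
  refine Prod.ext rfl ?_
  ext Z₀
  -- The covector parts are compared on one tangent vector, extended to a local field so that
  -- Cartan's formulas apply to the triple u, v, Z.
  obtain ⟨W, hW, hxW, Z, hZ, rfl⟩ := exists_smoothFieldOn x Z₀
  have hVo : IsOpen (U ∩ W) := hU.inter hW
  have hxV : x ∈ U ∩ W := ⟨hx, hxW⟩
  replace hB := hB.mono (Set.inter_subset_left (t := W))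
  replace hu := hu.mono (Set.inter_subset_left (t := W))
  replace hv := hv.mono (Set.inter_subset_left (t := W))
  replace hZ := (hZ.mono (Set.inter_subset_right (s := U))).toC
  have hu' := hu.gauge hVo hB
  have hv' := hv.gauge hVo hB
  have c1 := extD_oneForm_complex hVo hxV hv.2 hu.1 hZ
  have c2 := extD_oneForm_complex hVo hxV hu.2 hv.1 hZ
  have c3 := extD_oneForm_complex hVo hxV hv'.2 hu.1 hZ
  have c4 := extD_oneForm_complex hVo hxV hu'.2 hv.1 hZ
  -- The arguments are in the order v, u, Z because ι_u ι_v dB is dB(v, u, ·).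
  have c5 := extD_two_complex hVo hxV hB hv.1 hu.1 hZ
  have si := fun X hX => smoothFormOn_interiorC (X := X) hVo hB hX
  have a1 : ∀ (w : ∀ x : M, GTC (T E x)) (X : ∀ x : M, Cx (T E x)), SmoothCOn (U ∩ W) w →
      SmoothFieldCOn (U ∩ W) X →
      extDFun E (fun y => evalC (gauge (B y) (w y)).2 (X y)) x =
      extDFun E (fun y => evalC (w y).2 (X y)) x +
        extDFun E (fun y => evalC (toCovector (interiorC (w y).1 (B y))) (X y)) x := by
    intro w X hw hX
    rw [← extDFun_add hVo hxV (contMDiffOn_evalC hVo hw.2 hX)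
      (contMDiffOn_evalC hVo (si _ hw.1) hX)]
    congr 1
    funext y
    exact evalC_add _ _ _
  have sw : extDFun E (fun y => evalC (toCovector (interiorC (u y).1 (B y))) (v y).1) x =
      -extDFun E (fun y => evalC (toCovector (interiorC (v y).1 (B y))) (u y).1) x := by
    have := extDFun_comp_clm hVo hxV (contMDiffOn_evalC hVo (si _ hv.1) hu.1)
      (-ContinuousLinearMap.id ℝ ℂ)
    refine Eq.trans ?_ (this.trans ?_)
    · congr 1
      funext y
      exact evalC_covector_swap _ _ _
    · ext; rfl
  have sl := lieC_swap (fun y => (u y).1) (fun y => (v y).1) x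
  have e3 := evalC_covector_swap (B x) (v x).1
    (lieC (fun y => (u y).1) (fun y => (⟨Z y, 0⟩ : Cx (T E y))) x)
  have e4 := evalC_covector_swap (B x) (u x).1
    (lieC (fun y => (v y).1) (fun y => (⟨Z y, 0⟩ : Cx (T E y))) x)
  rw [a1 _ _ hv hZ, a1 _ _ hv hu.1] at c3
  rw [a1 _ _ hu hZ, a1 _ _ hu hv.1, sw] at c4
  rw [sl] at c5
  simp only [evalC_add, evalC_real, interiorC_neg, add_apply, neg_apply] at c1 c2 c3 c4 c5
  have e1' : ∀ w : GTC (T E x), evalC (gauge (B x) w).2 = fun X =>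
    evalC w.2 X + evalC (toCovector (interiorC w.1 (B x))) X := fun w => by
    funext X; exact evalC_add _ _ _
  rw [e1'] at c3 c4
  change (toCovector (interiorC (u x).1 (extD (fun x => oneForm (gauge (B x) (v x)).2) x)) +
    extDFun E (fun y => evalC (gauge (B y) (v y)).2 (u y).1) x -
    toCovector (interiorC (v x).1 (extD (fun x => oneForm (gauge (B x) (u x)).2) x)) +
    toCovector (interiorC (u x).1 (interiorC (v x).1 (H' x)))) (Z x) =
    (toCovector (interiorC (u x).1 (extD (fun x => oneForm (v x).2) x)) +
    extDFun E (fun y => evalC (v y).2 (u y).1) x -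
    toCovector (interiorC (v x).1 (extD (fun x => oneForm (u x).2) x)) +
    toCovector (interiorC (u x).1 (interiorC (v x).1 (H x)))) (Z x) +
    toCovector (interiorC (lieC (fun y => (u y).1) (fun y => (v y).1) x) (B x)) (Z x)
  rw [a1 _ _ hv hu.1, hH, covector_interiorC_interiorC_add]
  simp only [add_apply, sub_apply]
  -- Cartan's formulas for the one-forms of the gauged sections, minus those for the original ones,
  -- leave derivatives of B on pairs and brackets; the formula for dB cancels these up to the
  -- skew-symmetry of B recorded in `e3` and `e4`.
  linear_combination c3 - c4 - c1 + c2 + c5 - e3 + e4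

end Courant

/-! ### Complex conjugation of sections, forms and brackets -/

section Conjugation

variable {V : Type*} [AddCommGroup V] [Module ℝ V] [TopologicalSpace V]
  [IsTopologicalAddGroup V] [ContinuousSMul ℝ V]

/-- Complex conjugation, as a real-linear map. -/
abbrev conjL : ℂ →L[ℝ] ℂ := Complex.conjCLE.toContinuousLinearMap

theorem evalC_conj (β : V →L[ℝ] ℂ) (X : Cx V) :
    evalC (conjL.comp β) X.conj = conjL (evalC β X) := by
  simp [evalC, Cx.conj]

theorem conjG_conjG (u : GTC V) : conjG (conjG u) = u := by
  ext <;> simp [conjG, Cx.conj]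

theorem mem_conjSub {L : Submodule ℂ (GTC V)} {u : GTC V} : u ∈ conjSub L ↔ conjG u ∈ L := Iff.rfl

theorem conjSub_conjSub (L : Submodule ℂ (GTC V)) : conjSub (conjSub L) = L := by
  ext u
  rw [mem_conjSub, mem_conjSub, conjG_conjG]

theorem conjForm_cxForm {n : ℕ} (η : V [⋀^Fin n]→L[ℝ] ℝ) : conjForm (cxForm η) = cxForm η := by
  ext v
  exact Complex.conj_ofReal _

theorem toCovector_interiorC_conj (η : V [⋀^Fin 2]→L[ℝ] ℂ) (X : Cx V) :
    toCovector (interiorC X.conj (conjForm η)) = conjL.comp (toCovector (interiorC X η)) := by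
  ext Z
  change _ = conjL (toCovector (interiorC X η) Z)
  simp only [toCovector_interiorC, Cx.conj, two_neg_left]
  change conjL _ + Complex.I * -conjL _ = _
  simp

theorem toCovector_interiorC_interiorC_conj (η : V [⋀^Fin 3]→L[ℝ] ℂ) (X Y : Cx V) :
    toCovector (interiorC X.conj (interiorC Y.conj (conjForm η))) =
      conjL.comp (toCovector (interiorC X (interiorC Y η))) := by
  have h3 : ∀ A B Z : V, η ![A, -B, Z] = -η ![A, B, Z] := fun A B Z => by
    have h := two_neg_left (interior A η) B Z
    exact h
  have h3' : ∀ A B Z : V, η ![-A, B, Z] = -η ![A, B, Z] := fun A B Z => by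
    have h := η.toAlternatingMap.map_vecCons_smul ![B, Z] (-1) A
    simpa using h
  ext Z
  change _ = conjL (toCovector (interiorC X (interiorC Y η)) Z)
  simp only [toCovector_interiorC_interiorC, Cx.conj]
  change conjL (η _) + Complex.I * conjL (η _) +
    Complex.I * (conjL (η _) + Complex.I * conjL (η _)) = _
  simp only [h3, h3']
  simp
  ring

theorem gauge_conj (B : V [⋀^Fin 2]→L[ℝ] ℂ) (u : GTC V) :
    gauge (conjForm B) (conjG u) = conjG (gauge B u) := by
  refine Prod.ext rfl ?_
  change conjL.comp u.2 + toCovector (interiorC u.1.conj (conjForm B)) = conjL.comp (u.2 + _)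
  rw [toCovector_interiorC_conj]
  ext Z
  exact (map_add conjL _ _).symm

variable {E : Type*} [NormedAddCommGroup E] [NormedSpace ℝ E] [FiniteDimensional ℝ E]
  {M : Type*} [TopologicalSpace M] [ChartedSpace E M] [IsManifold 𝓘(ℝ, E) ∞ M]
  {U : Set M} {x : M}

theorem SmoothFieldOn.neg {X : ∀ x : M, T E x} (hX : SmoothFieldOn U X) :
    SmoothFieldOn U (fun x => -X x) := ContMDiffOn.neg_section hX

theorem SmoothFieldOn.add {X Y : ∀ x : M, T E x} (hX : SmoothFieldOn U X)
    (hY : SmoothFieldOn U Y) : SmoothFieldOn U (fun x => X x + Y x) :=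
  ContMDiffOn.add_section hX hY

theorem SmoothFieldOn.sub {X Y : ∀ x : M, T E x} (hX : SmoothFieldOn U X)
    (hY : SmoothFieldOn U Y) : SmoothFieldOn U (fun x => X x - Y x) :=
  ContMDiffOn.sub_section hX hY

theorem SmoothFieldOn.smul {X : ∀ x : M, T E x} (hX : SmoothFieldOn U X) (c : ℝ) :
    SmoothFieldOn U (fun x => c • X x) := ContMDiffOn.const_smul_section hX

theorem SmoothFieldOn.mdifferentiableAt (hU : IsOpen U) (hx : x ∈ U) {X : ∀ x : M, T E x}
    (hX : SmoothFieldOn U X) : MDifferentiableAt 𝓘(ℝ, E) 𝓘(ℝ, E).tangent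
      (fun x => (⟨x, X x⟩ : TangentBundle 𝓘(ℝ, E) M)) x :=
  (ContMDiffOn.contMDiffAt hX (hU.mem_nhds hx)).mdifferentiableAt (by simp)

theorem SmoothCOn.conj {u : ∀ x : M, GTC (T E x)} (hu : SmoothCOn U u) :
    SmoothCOn U (fun x => conjG (u x)) :=
  ⟨⟨hu.1.1, hu.1.2.neg⟩, hu.2.comp_clm conjL⟩

theorem lieC_conj (hU : IsOpen U) (hx : x ∈ U) {X Y : ∀ x : M, Cx (T E x)}
    (hX : SmoothFieldCOn U X) (hY : SmoothFieldCOn U Y) :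
    lieC (fun y => (X y).conj) (fun y => (Y y).conj) x = (lieC X Y x).conj := by
  have h1 : ∀ V W : ∀ x : M, T E x, SmoothFieldOn U W →
      VectorField.mlieBracket 𝓘(ℝ, E) V (fun y => -W y) x =
        -VectorField.mlieBracket 𝓘(ℝ, E) V W x := fun V W hW => by
    have h := VectorField.mlieBracket_const_smul_right (I := 𝓘(ℝ, E)) (V := V) (c := (-1 : ℝ))
      (hW.mdifferentiableAt hU hx)
    rw [neg_one_smul] at h
    exact h.trans (neg_one_smul ℝ _)
  have h2 : ∀ V W : ∀ x : M, T E x, SmoothFieldOn U V →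
      VectorField.mlieBracket 𝓘(ℝ, E) (fun y => -V y) W x =
        -VectorField.mlieBracket 𝓘(ℝ, E) V W x := fun V W hV => by
    rw [VectorField.mlieBracket_swap_apply, h1 _ _ hV, VectorField.mlieBracket_swap_apply, neg_neg]
  refine Cx.ext ?_ ?_
  · simp only [lieC, Cx.conj]
    rw [h1 _ _ hY.2, h2 _ _ hX.2, neg_neg]
  · simp only [lieC, Cx.conj]
    rw [h1 _ _ hY.2, h2 _ _ hX.2, neg_add]

/-- Complex conjugation intertwines the Courant brackets twisted by conjugate three-forms. -/
theorem courant_conj (hU : IsOpen U) (hx : x ∈ U) (H : Form E M 3 ℂ)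
    {u v : ∀ x : M, GTC (T E x)} (hu : SmoothCOn U u) (hv : SmoothCOn U v) :
    courant (fun y => conjForm (H y)) (fun y => conjG (u y)) (fun y => conjG (v y)) x =
      conjG (courant H u v x) := by
  refine Prod.ext (lieC_conj hU hx hu.1 hv.1) ?_
  have hd := fun (w : ∀ x : M, GTC (T E x)) (hw : SmoothCOn U w) => extD_comp_clm hU hx hw.2 conjL
  have hf := extDFun_comp_clm hU hx (contMDiffOn_evalC hU hv.2 hu.1) conjL
  have hf' : (fun y => evalC (conjG (v y)).2 (conjG (u y)).1) =
      fun y => conjL (evalC (v y).2 (u y).1) := funext fun y => evalC_conj _ _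
  have hd' : ∀ w : ∀ x : M, GTC (T E x), SmoothCOn U w →
      extD (fun y => oneForm (conjG (w y)).2) x =
      conjForm (extD (fun y => oneForm (w y).2) x) := fun w hw => hd w hw
  change toCovector (interiorC (u x).1.conj (extD (fun y => oneForm (conjG (v y)).2) x)) +
    extDFun E (fun y => evalC (conjG (v y)).2 (conjG (u y)).1) x -
    toCovector (interiorC (v x).1.conj (extD (fun y => oneForm (conjG (u y)).2) x)) +
    toCovector (interiorC (u x).1.conj (interiorC (v x).1.conj (conjForm (H x)))) =
    conjL.comp (toCovector (interiorC (u x).1 (extD (fun x => oneForm (v x).2) x)) +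
    extDFun E (fun y => evalC (v y).2 (u y).1) x -
    toCovector (interiorC (v x).1 (extD (fun x => oneForm (u x).2) x)) +
    toCovector (interiorC (u x).1 (interiorC (v x).1 (H x))))
  rw [hd' _ hu, hd' _ hv, hf', hf, toCovector_interiorC_conj, toCovector_interiorC_conj,
    toCovector_interiorC_interiorC_conj]
  ext Z
  simp

end Conjugation

/-! ### Type decomposition of complex three-forms -/

section Types

variable {V : Type*} [AddCommGroup V] [Module ℝ V] [TopologicalSpace V]
  [IsTopologicalAddGroup V] [ContinuousSMul ℝ V]

/-- The complex-trilinear extension of a complex three-form. -/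
def evalThree (η : V [⋀^Fin 3]→L[ℝ] ℂ) (X Y Z : Cx V) : ℂ :=
  evalC (toCovector (interiorC Y (interiorC X η))) Z

/-- This transports the antisymmetry of `evalForm`, proved for general degree, to the iterated
interior product that Cartan's formulas use. -/
theorem evalForm_three (η : V [⋀^Fin 3]→L[ℝ] ℂ) (w : Fin 3 → Cx V) :
    evalForm η w = evalThree η (w 0) (w 1) (w 2) := by
  have hu : (Finset.univ : Finset (Finset (Fin 3))) =
      {∅, {0}, {1}, {2}, {0, 1}, {0, 2}, {1, 2}, {0, 1, 2}} := by decide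
  have hv : ∀ s : Finset (Fin 3), (fun k => if k ∈ s then (w k).im else (w k).re) =
      ![if 0 ∈ s then (w 0).im else (w 0).re, if 1 ∈ s then (w 1).im else (w 1).re,
        if 2 ∈ s then (w 2).im else (w 2).re] := fun s => by
    funext k; fin_cases k <;> rfl
  have c3 : (({0, 1, 2} : Finset (Fin 3)).card) = 3 := by decide
  unfold evalForm evalThree
  simp only [hv, hu]
  rw [Finset.sum_insert (by decide), Finset.sum_insert (by decide), Finset.sum_insert (by decide),
    Finset.sum_insert (by decide), Finset.sum_insert (by decide), Finset.sum_insert (by decide),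
    Finset.sum_insert (by decide), Finset.sum_singleton]
  simp only [evalC, toCovector_interiorC_interiorC]
  simp [c3]
  linear_combination (-(η ![(w 0).im, (w 1).im, (w 2).re] + η ![(w 0).im, (w 1).re, (w 2).im] +
    η ![(w 0).re, (w 1).im, (w 2).im] + Complex.I * η ![(w 0).im, (w 1).im, (w 2).im])) *
    Complex.I_sq

theorem evalThree_swap₀₁ (η : V [⋀^Fin 3]→L[ℝ] ℂ) (X Y Z : Cx V) :
    evalThree η Y X Z = -evalThree η X Y Z := by
  have h := evalForm_swap η ![X, Y, Z] (i := 0) (j := 1) (by decide)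
  rw [evalForm_three, evalForm_three] at h
  exact h

theorem evalThree_swap₁₂ (η : V [⋀^Fin 3]→L[ℝ] ℂ) (X Y Z : Cx V) :
    evalThree η X Z Y = -evalThree η X Y Z := by
  have h := evalForm_swap η ![X, Y, Z] (i := 1) (j := 2) (by decide)
  rw [evalForm_three, evalForm_three] at h
  exact h

/-- Additivity is immediate in the last argument, where covectors are evaluated; the transpositions
carry it to the other two. -/
theorem evalThree_add₂ (η : V [⋀^Fin 3]→L[ℝ] ℂ) (X Y Z W : Cx V) :
    evalThree η X Y (Z + W) = evalThree η X Y Z + evalThree η X Y W := by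
  simp only [evalThree, evalC, Cx.re_add, Cx.im_add, map_add]
  ring

theorem evalThree_add₁ (η : V [⋀^Fin 3]→L[ℝ] ℂ) (X Y Z W : Cx V) :
    evalThree η X (Y + W) Z = evalThree η X Y Z + evalThree η X W Z := by
  rw [evalThree_swap₁₂, evalThree_add₂, evalThree_swap₁₂ η X Y, evalThree_swap₁₂ η X W]
  ring

theorem evalThree_add₀ (η : V [⋀^Fin 3]→L[ℝ] ℂ) (X Y Z W : Cx V) :
    evalThree η (X + W) Y Z = evalThree η X Y Z + evalThree η W Y Z := by
  rw [evalThree_swap₀₁, evalThree_add₁, evalThree_swap₀₁ η X Y, evalThree_swap₀₁ η W Y]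
  ring

theorem evalThree_conj (η : V [⋀^Fin 3]→L[ℝ] ℂ) (X Y Z : Cx V) :
    evalThree (conjForm η) X.conj Y.conj Z.conj = conjL (evalThree η X Y Z) := by
  rw [evalThree, toCovector_interiorC_interiorC_conj, evalC_conj]
  rfl

theorem evalThree_add_smul (η ξ : V [⋀^Fin 3]→L[ℝ] ℂ) (c : ℂ) (X Y Z : Cx V) :
    evalThree (η + c • ξ) X Y Z = evalThree η X Y Z + c * evalThree ξ X Y Z := by
  simp only [evalThree, evalC, toCovector_interiorC_interiorC, ContinuousAlternatingMap.add_apply,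
    ContinuousAlternatingMap.smul_apply, smul_eq_mul]
  ring

/-- On real vectors only the empty set of imaginary slots contributes to the sum that defines
`evalForm`. -/
theorem evalThree_real (η : V [⋀^Fin 3]→L[ℝ] ℂ) (v : Fin 3 → V) :
    evalThree η ⟨v 0, 0⟩ ⟨v 1, 0⟩ ⟨v 2, 0⟩ = η v := by
  have h : ![v 0, v 1, v 2] = v := by funext k; fin_cases k <;> rfl
  rw [← evalForm_three η fun k => ⟨v k, 0⟩, evalForm]
  rw [Finset.sum_eq_single ∅]
  · simp
  · intro s _ hs
    obtain ⟨k, hk⟩ := Finset.nonempty_iff_ne_empty.mpr hs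
    rw [η.map_coord_zero k (by simp [hk]), mul_zero]
  · simp

theorem Cx.conj_real (X : V) : Cx.conj ⟨X, 0⟩ = ⟨X, 0⟩ := by simp [Cx.conj]

variable (J : V →L[ℝ] V)

theorem P10_add_P01 (X : Cx V) : P10 J X + P01 J X = X := by
  simp only [P10, P01, LinearMap.smul_apply, LinearMap.sub_apply, LinearMap.add_apply]
  rw [← smul_add, sub_add_add_cancel, LinearMap.id_apply, ← two_smul ℂ X, smul_smul]
  norm_num

theorem P10_conj (X : Cx V) : (P10 J X).conj = P01 J X.conj := by
  ext <;> simp [P10, P01, Cx.conj, Cx.map] <;> module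

theorem P01_conj (X : Cx V) : (P01 J X).conj = P10 J X.conj := by
  ext <;> simp [P10, P01, Cx.conj, Cx.map] <;> module

variable {J}

theorem P01_mem (hJ : ∀ X, J (J X) = -X) (X : Cx V) : P01 J X ∈ T01 J := by
  rw [T01, Module.End.mem_eigenspace_iff]
  ext <;> simp [P01, Cx.map, hJ] <;> module

theorem P10_mem (hJ : ∀ X, J (J X) = -X) (X : Cx V) : P10 J X ∈ T10 J := by
  rw [T10, Module.End.mem_eigenspace_iff]
  ext <;> simp [P10, Cx.map, hJ] <;> module

theorem typePart_zero_apply (η : V [⋀^Fin 3]→L[ℝ] ℂ) (v : Fin 3 → V) :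
    typePart J 0 η v =
      evalThree η (P01 J ⟨v 0, 0⟩) (P01 J ⟨v 1, 0⟩) (P01 J ⟨v 2, 0⟩) := by
  change typeEval J 0 η v = _
  rw [typeEval, show Finset.powersetCard 0 (Finset.univ : Finset (Fin 3)) = {∅} by decide]
  simp [evalForm_three]

theorem typePart_one_apply (η : V [⋀^Fin 3]→L[ℝ] ℂ) (v : Fin 3 → V) :
    typePart J 1 η v =
      evalThree η (P10 J ⟨v 0, 0⟩) (P01 J ⟨v 1, 0⟩) (P01 J ⟨v 2, 0⟩) +
      (evalThree η (P01 J ⟨v 0, 0⟩) (P10 J ⟨v 1, 0⟩) (P01 J ⟨v 2, 0⟩) +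
      evalThree η (P01 J ⟨v 0, 0⟩) (P01 J ⟨v 1, 0⟩) (P10 J ⟨v 2, 0⟩)) := by
  change typeEval J 1 η v = _
  rw [typeEval, show Finset.powersetCard 1 (Finset.univ : Finset (Fin 3)) = {{0}, {1}, {2}} by
    decide, Finset.sum_insert (by decide), Finset.sum_insert (by decide), Finset.sum_singleton]
  simp [evalForm_three]

theorem typePart_two_apply (η : V [⋀^Fin 3]→L[ℝ] ℂ) (v : Fin 3 → V) :
    typePart J 2 η v =
      evalThree η (P01 J ⟨v 0, 0⟩) (P10 J ⟨v 1, 0⟩) (P10 J ⟨v 2, 0⟩) +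
      (evalThree η (P10 J ⟨v 0, 0⟩) (P01 J ⟨v 1, 0⟩) (P10 J ⟨v 2, 0⟩) +
      evalThree η (P10 J ⟨v 0, 0⟩) (P10 J ⟨v 1, 0⟩) (P01 J ⟨v 2, 0⟩)) := by
  change typeEval J 2 η v = _
  rw [typeEval, show Finset.powersetCard 2 (Finset.univ : Finset (Fin 3)) =
    {{1, 2}, {0, 2}, {0, 1}} by decide, Finset.sum_insert (by decide),
    Finset.sum_insert (by decide), Finset.sum_singleton]
  simp [evalForm_three]

theorem typePart_three_apply (η : V [⋀^Fin 3]→L[ℝ] ℂ) (v : Fin 3 → V) :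
    typePart J 3 η v =
      evalThree η (P10 J ⟨v 0, 0⟩) (P10 J ⟨v 1, 0⟩) (P10 J ⟨v 2, 0⟩) := by
  change typeEval J 3 η v = _
  rw [typeEval, show Finset.powersetCard 3 (Finset.univ : Finset (Fin 3)) = {Finset.univ} by
    decide]
  simp [evalForm_three]

/-- Each argument is split into its (1,0) and (0,1) parts; the eight resulting terms are sorted by
the number of (1,0) arguments. -/
theorem sum_typePart (η : V [⋀^Fin 3]→L[ℝ] ℂ) :
    typePart J 0 η + typePart J 1 η + typePart J 2 η + typePart J 3 η = η := by
  ext v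
  rw [← evalThree_real η v, ← P10_add_P01 J ⟨v 0, 0⟩, ← P10_add_P01 J ⟨v 1, 0⟩,
    ← P10_add_P01 J ⟨v 2, 0⟩]
  simp only [ContinuousAlternatingMap.add_apply, typePart_zero_apply, typePart_one_apply,
    typePart_two_apply, typePart_three_apply, evalThree_add₀, evalThree_add₁, evalThree_add₂]
  ring

theorem typePart_add_smul {p : ℕ} (η ξ : V [⋀^Fin 3]→L[ℝ] ℂ) (c : ℂ) :
    typePart J p (η + c • ξ) = typePart J p η + c • typePart J p ξ := by
  ext v
  change typeEval J p _ v = typeEval J p _ v + c * typeEval J p _ v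
  simp only [typeEval, evalForm_three, evalThree_add_smul, Finset.sum_add_distrib, Finset.mul_sum]

theorem conjForm_typePart_zero (η : V [⋀^Fin 3]→L[ℝ] ℂ) :
    conjForm (typePart J 0 η) = typePart J 3 (conjForm η) := by
  ext v
  change conjL (typePart J 0 η v) = _
  rw [typePart_zero_apply, typePart_three_apply, ← evalThree_conj]
  simp only [P01_conj, Cx.conj_real]

theorem conjForm_typePart_one (η : V [⋀^Fin 3]→L[ℝ] ℂ) :
    conjForm (typePart J 1 η) = typePart J 2 (conjForm η) := by
  ext v
  change conjL (typePart J 1 η v) = _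
  rw [typePart_one_apply, typePart_two_apply, map_add, map_add]
  simp only [← evalThree_conj, P01_conj, P10_conj, Cx.conj_real]

theorem typePart_zero_eq_zero (hJ : ∀ X, J (J X) = -X) {η : V [⋀^Fin 3]→L[ℝ] ℂ}
    (h : ∀ X ∈ T01 J, ∀ Y ∈ T01 J, ∀ Z ∈ T01 J, evalThree η X Y Z = 0) : typePart J 0 η = 0 := by
  ext v
  rw [typePart_zero_apply]
  exact h _ (P01_mem hJ _) _ (P01_mem hJ _) _ (P01_mem hJ _)

/-- Every term of the (1,2) part has two arguments of type (0,1), which transpositions bring to the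
first two places. -/
theorem typePart_one_eq_zero (hJ : ∀ X, J (J X) = -X) {η : V [⋀^Fin 3]→L[ℝ] ℂ}
    (h : ∀ X ∈ T01 J, ∀ Y ∈ T01 J, ∀ Z, evalThree η X Y Z = 0) : typePart J 1 η = 0 := by
  ext v
  have h0 := P01_mem hJ ⟨v 0, 0⟩
  have h1 := P01_mem hJ ⟨v 1, 0⟩
  have h2 := P01_mem hJ ⟨v 2, 0⟩
  rw [typePart_one_apply, evalThree_swap₀₁, evalThree_swap₁₂, h _ h1 _ h2, evalThree_swap₁₂,
    h _ h0 _ h2, h _ h0 _ h1]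
  simp

end Types

/-! ### Eigenspaces, gauge transformations and matched pairs in one fibre -/

section Fibre

variable {V : Type*} [AddCommGroup V] [Module ℝ V] [TopologicalSpace V]
  [IsTopologicalAddGroup V] [ContinuousSMul ℝ V]

/-! ### Real and imaginary parts -/

theorem ext_re_im {u v : GTC V} (hr : reG u = reG v) (hi : imG u = imG v) : u = v := by
  refine Prod.ext (Cx.ext (congrArg Prod.fst hr) (congrArg Prod.fst hi)) ?_
  ext Z
  exact Complex.ext (DFunLike.congr_fun (congrArg Prod.snd hr) Z)
    (DFunLike.congr_fun (congrArg Prod.snd hi) Z)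

/-- The element of `(V ⊕ V*) ⊗ ℂ` with given real and imaginary parts. -/
def mkG (r m : GT V) : GTC V :=
  (⟨r.1, m.1⟩, Complex.ofRealCLM.comp r.2 + Complex.I • Complex.ofRealCLM.comp m.2)

@[simp] theorem reG_mkG (r m : GT V) : reG (mkG r m) = r := by
  ext <;> simp [reG, mkG]

@[simp] theorem imG_mkG (r m : GT V) : imG (mkG r m) = m := by
  ext <;> simp [imG, mkG]

@[simp] theorem reG_conjG (u : GTC V) : reG (conjG u) = reG u := by
  ext <;> simp [reG, conjG, Cx.conj]

@[simp] theorem imG_conjG (u : GTC V) : imG (conjG u) = -imG u := by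
  ext <;> simp [imG, conjG, Cx.conj]

theorem reG_I_smul (u : GTC V) : reG (Complex.I • u) = -imG u := by
  ext <;> simp [reG, imG]

theorem imG_I_smul (u : GTC V) : imG (Complex.I • u) = reG u := by
  ext <;> simp [reG, imG]

theorem reG_complexify (J : GT V →ₗ[ℝ] GT V) (u : GTC V) :
    reG (complexify J u) = J (reG u) := by
  change reG (ofRealG (J (reG u)) + Complex.I • ofRealG (J (imG u))) = _
  ext <;> simp [reG, ofRealG]

theorem imG_complexify (J : GT V →ₗ[ℝ] GT V) (u : GTC V) :
    imG (complexify J u) = J (imG u) := by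
  change imG (ofRealG (J (reG u)) + Complex.I • ofRealG (J (imG u))) = _
  ext <;> simp [imG, ofRealG]

/-- Of the two real equations contained in Ju = iu, one implies the other because J² = -1. So the
eigenspace is the set of r - iJr, parametrized by the real part r. -/
theorem mem_eigenG {J : GT V →ₗ[ℝ] GT V} (hJ : ∀ u, J (J u) = -u) {u : GTC V} :
    u ∈ eigenG J ↔ J (reG u) = -imG u := by
  rw [eigenG, Module.End.mem_eigenspace_iff]
  constructor
  · intro h
    rw [← reG_complexify, h, reG_I_smul]
  · intro h
    refine ext_re_im ?_ ?_
    · rw [reG_complexify, reG_I_smul, h]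
    · rw [imG_complexify, imG_I_smul, ← neg_neg (imG u), ← h, map_neg, hJ, neg_neg]

theorem mem_conjSub_eigenG {J : GT V →ₗ[ℝ] GT V} (hJ : ∀ u, J (J u) = -u) {u : GTC V} :
    u ∈ conjSub (eigenG J) ↔ J (reG u) = imG u := by
  rw [mem_conjSub, mem_eigenG hJ, reG_conjG, imG_conjG, neg_neg]

/-- For a nonzero real r, the vector r - iJr lies in the +i eigenspace; in the conjugate it would
satisfy Jr = -Jr, hence Jr = 0 and r = 0. This is the source of all the negative statements of the
theorem. -/
theorem eigenG_ne_conjSub [Nontrivial V] {J : GT V →ₗ[ℝ] GT V} (hJ : ∀ u, J (J u) = -u) :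
    eigenG J ≠ conjSub (eigenG J) := by
  intro h
  obtain ⟨X, hX⟩ := exists_ne (0 : V)
  have h1 : mkG (X, 0) (-J (X, 0)) ∈ eigenG J := by
    rw [mem_eigenG hJ, reG_mkG, imG_mkG, neg_neg]
  have h2 := h1
  rw [h, mem_conjSub_eigenG hJ, reG_mkG, imG_mkG, eq_neg_iff_add_eq_zero, ← two_smul ℝ,
    smul_eq_zero_iff_right two_ne_zero] at h2
  have h3 := hJ (X, 0)
  rw [h2, map_zero, zero_eq_neg] at h3
  exact hX (congrArg Prod.fst h3)

/-! ### Gauge transformations -/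

theorem gauge_apply (B : V [⋀^Fin 2]→L[ℝ] ℂ) (u : GTC V) :
    gauge B u = (u.1, u.2 + toCovector (interiorC u.1 B)) := rfl

theorem gauge_gauge (B C : V [⋀^Fin 2]→L[ℝ] ℂ) (u : GTC V) :
    gauge B (gauge C u) = gauge (B + C) u := by
  refine Prod.ext rfl ?_
  ext Z
  simp only [gauge_apply, add_apply, toCovector_interiorC, ContinuousAlternatingMap.add_apply]
  ring

theorem gauge_zero (u : GTC V) : gauge 0 u = u := by
  refine Prod.ext rfl ?_
  ext Z
  simp [gauge_apply, toCovector_interiorC]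

theorem gauge_neg_gauge (B : V [⋀^Fin 2]→L[ℝ] ℂ) (u : GTC V) : gauge (-B) (gauge B u) = u := by
  rw [gauge_gauge, neg_add_cancel, gauge_zero]

theorem gauge_gauge_neg (B : V [⋀^Fin 2]→L[ℝ] ℂ) (u : GTC V) : gauge B (gauge (-B) u) = u := by
  rw [gauge_gauge, add_neg_cancel, gauge_zero]

theorem mem_map_gauge {B : V [⋀^Fin 2]→L[ℝ] ℂ} {L : Submodule ℂ (GTC V)} {u : GTC V} :
    u ∈ L.map (gauge B) ↔ gauge (-B) u ∈ L := by
  rw [Submodule.mem_map]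
  constructor
  · rintro ⟨v, hv, rfl⟩
    rwa [gauge_neg_gauge]
  · exact fun h => ⟨_, h, gauge_gauge_neg B u⟩

theorem map_gauge_map_gauge (B C : V [⋀^Fin 2]→L[ℝ] ℂ) (L : Submodule ℂ (GTC V)) :
    (L.map (gauge C)).map (gauge B) = L.map (gauge (B + C)) := by
  ext u
  rw [mem_map_gauge, mem_map_gauge, mem_map_gauge, gauge_gauge, neg_add, add_comm]

theorem map_gauge_injective (B : V [⋀^Fin 2]→L[ℝ] ℂ) :
    Function.Injective (Submodule.map (gauge B)) := fun L L' h => by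
  ext u
  have h1 := mem_map_gauge (B := B) (L := L) (u := gauge B u)
  have h2 := mem_map_gauge (B := B) (L := L') (u := gauge B u)
  rw [gauge_neg_gauge] at h1 h2
  rw [← h1, ← h2, h]

theorem conjSub_map_gauge (B : V [⋀^Fin 2]→L[ℝ] ℂ) (L : Submodule ℂ (GTC V)) :
    conjSub (L.map (gauge B)) = (conjSub L).map (gauge (conjForm B)) := by
  ext u
  have h : conjForm (-conjForm B) = -B := by
    ext v
    change conjL (-conjL (B v)) = -B v
    simp
  rw [mem_conjSub, mem_map_gauge, mem_map_gauge, mem_conjSub, ← gauge_conj, h]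

/-- The two extra terms B(u, v) and B(v, u) cancel. -/
theorem pairingC_gauge (B : V [⋀^Fin 2]→L[ℝ] ℂ) (u v : GTC V) :
    pairingC (gauge B u) (gauge B v) = pairingC u v := by
  simp only [pairingC, gauge_apply, evalC_add]
  rw [evalC_covector_swap B u.1 v.1]
  ring

theorem pairingC_conjG (u v : GTC V) : pairingC (conjG u) (conjG v) = conjL (pairingC u v) := by
  simp only [pairingC, conjG]
  rw [evalC_conj, evalC_conj, map_add]

theorem IsLagrangianIn.map_gauge {L : Submodule ℂ (GTC V)} (hL : IsLagrangianIn ⊤ L)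
    (B : V [⋀^Fin 2]→L[ℝ] ℂ) : IsLagrangianIn ⊤ (L.map (gauge B)) := by
  refine ⟨le_top, fun u _ => ?_⟩
  rw [mem_map_gauge, hL.2 _ trivial]
  constructor
  · intro h v hv
    rw [← pairingC_gauge (-B)]
    exact h _ (mem_map_gauge.mp hv)
  · intro h v hv
    rw [← pairingC_gauge B, gauge_gauge_neg]
    exact h _ (Submodule.mem_map_of_mem hv)

theorem IsLagrangianIn.conjSub {L : Submodule ℂ (GTC V)} (hL : IsLagrangianIn ⊤ L) :
    IsLagrangianIn ⊤ (conjSub L) := by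
  refine ⟨le_top, fun u _ => ?_⟩
  rw [mem_conjSub, hL.2 _ trivial]
  constructor
  · intro h v hv
    have := h _ hv
    rwa [pairingC_conjG, map_eq_zero_iff conjL (starRingEnd ℂ).injective] at this
  · intro h v hv
    have := h (conjG v) (by rwa [mem_conjSub, conjG_conjG])
    rw [← conjG_conjG v, pairingC_conjG, this, map_zero]

/-! ### Types -/

variable {J : V →L[ℝ] V}

theorem mem_T10 (hJ : ∀ X, J (J X) = -X) {X : Cx V} : X ∈ T10 J ↔ J X.re = -X.im := by
  rw [T10, Module.End.mem_eigenspace_iff, Cx.ext_iff]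
  simp only [Cx.map, LinearMap.coe_mk, AddHom.coe_mk, ContinuousLinearMap.coe_coe, Cx.re_smul,
    Cx.im_smul, Complex.I_re, Complex.I_im, zero_smul, one_smul, zero_sub, zero_add]
  refine ⟨fun h => h.1, fun h => ⟨h, ?_⟩⟩
  rw [← neg_neg X.im, ← h, map_neg, hJ, neg_neg]

theorem mem_T01 (hJ : ∀ X, J (J X) = -X) {X : Cx V} : X ∈ T01 J ↔ J X.re = X.im := by
  rw [T01, Module.End.mem_eigenspace_iff, Cx.ext_iff]
  simp only [Cx.map, LinearMap.coe_mk, AddHom.coe_mk, ContinuousLinearMap.coe_coe, Cx.re_smul,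
    Cx.im_smul, Cx.re_neg, Cx.im_neg, Complex.I_re, Complex.I_im, zero_smul, neg_smul,
    one_smul, zero_sub, zero_add, neg_neg]
  refine ⟨fun h => h.1, fun h => ⟨h, ?_⟩⟩
  rw [← h, hJ]

theorem conj_mem_T01 (hJ : ∀ X, J (J X) = -X) {X : Cx V} (h : X ∈ T10 J) : X.conj ∈ T01 J := by
  rw [mem_T01 hJ]
  exact (mem_T10 hJ).mp h

theorem conj_mem_T10 (hJ : ∀ X, J (J X) = -X) {X : Cx V} (h : X ∈ T01 J) : X.conj ∈ T10 J := by
  rw [mem_T10 hJ]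
  simpa [Cx.conj] using (mem_T01 hJ).mp h

theorem T10_inf_T01 (hJ : ∀ X, J (J X) = -X) {X : Cx V} (h : X ∈ T10 J) (h' : X ∈ T01 J) :
    X = 0 := by
  rw [mem_T10 hJ] at h
  rw [mem_T01 hJ, h, neg_eq_iff_add_eq_zero, ← two_smul ℝ,
    smul_eq_zero_iff_right two_ne_zero] at h'
  have h2 := hJ X.re
  rw [h, h', neg_zero, map_zero, zero_eq_neg] at h2
  exact Cx.ext h2 h'

/-- The other projection is a difference of two (1,0) vectors, hence of both types, hence zero. -/
theorem P10_of_mem (hJ : ∀ X, J (J X) = -X) {X : Cx V} (h : X ∈ T10 J) : P10 J X = X := by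
  have h1 := P10_add_P01 J X
  have h2 : P01 J X = 0 := T10_inf_T01 hJ (by
    rw [← eq_sub_iff_add_eq'] at h1
    rw [h1]
    exact Submodule.sub_mem _ h (P10_mem hJ X)) (P01_mem hJ X)
  rwa [h2, add_zero] at h1

theorem P01_of_mem (hJ : ∀ X, J (J X) = -X) {X : Cx V} (h : X ∈ T01 J) : P01 J X = X := by
  have h1 := P10_add_P01 J X
  have h2 : P10 J X = 0 := T10_inf_T01 hJ (P10_mem hJ X) (by
    rw [← eq_sub_iff_add_eq] at h1
    rw [h1]
    exact Submodule.sub_mem _ h (P01_mem hJ X))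
  rwa [h2, zero_add] at h1

/-- The (0,1) vectors are the X + iJX, so vanishing on them is the equation β(X) + iβ(JX) = 0. -/
theorem comp_of_mem_annihilator (hJ : ∀ X, J (J X) = -X) {β : V →L[ℝ] ℂ}
    (hβ : β ∈ annihilator (T01 J)) : β.comp J = Complex.I • β := by
  ext X
  have h : evalC β ⟨X, J X⟩ = 0 := hβ _ ((mem_T01 hJ).mpr rfl)
  change β (J X) = Complex.I * β X
  simp only [evalC] at h
  linear_combination (-Complex.I) * h + β (J X) * Complex.I_sq

theorem pi10_of_annihilator (hJ : ∀ X, J (J X) = -X) {u : GTC V}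
    (hu : u.2 ∈ annihilator (T01 J)) : pi10 J u = (P10 J u.1, u.2) := by
  refine Prod.ext rfl ?_
  change (1 / 2 : ℂ) • (u.2 - Complex.I • u.2.comp J) = u.2
  rw [comp_of_mem_annihilator hJ hu, smul_smul, Complex.I_mul_I]
  ext X
  simp
  ring

theorem pi10_of_mem (hJ : ∀ X, J (J X) = -X) {u : GTC V} (hu : u ∈ GT10 J) : pi10 J u = u := by
  rw [pi10_of_annihilator hJ hu.2, P10_of_mem hJ hu.1]

theorem pi10_add (u v : GTC V) : pi10 J (u + v) = pi10 J u + pi10 J v := by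
  refine Prod.ext (map_add _ _ _) ?_
  ext X
  simp [pi10]
  ring

section Matched

variable {L L' : Submodule ℂ (GTC V)}

/-- A Lagrangian that contains T_{0,1} is contained in the orthogonal of T_{0,1}, whose covectors
are those of type (1,0). -/
theorem annihilator_of_isotropic (hL : IsLagrangianIn ⊤ L) (hT : (T01 J).prod ⊥ ≤ L) {u : GTC V}
    (hu : u ∈ L) : u.2 ∈ annihilator (T01 J) := fun X hX => by
  have h := (hL.2 u trivial).mp hu (X, 0) (hT ⟨hX, rfl⟩)
  simpa [pairingC, evalC] using h

/-- On the orthogonal of T_{0,1}, the projection only subtracts the (0,1) part of the vector, and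
this part belongs to L. -/
theorem pi10_mem (hJ : ∀ X, J (J X) = -X) (hL : IsLagrangianIn ⊤ L)
    (hT : (T01 J).prod ⊥ ≤ L) {u : GTC V} (hu : u ∈ L) : pi10 J u ∈ GT10 J ⊓ L := by
  have h := annihilator_of_isotropic hL hT hu
  rw [pi10_of_annihilator hJ h]
  refine ⟨⟨P10_mem hJ _, h⟩, ?_⟩
  have e : (P10 J u.1, u.2) = u - (P01 J u.1, 0) := by
    refine Prod.ext ?_ (sub_zero _).symm
    exact eq_sub_of_add_eq (P10_add_P01 J u.1)
  rw [e]
  exact L.sub_mem hu (hT ⟨P01_mem hJ _, rfl⟩)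

/-- The decomposition of u ∈ L into its projection and a (0,1) vector takes place inside L, so L is
recovered from its trace on 𝕋_{1,0}. -/
theorem matched_inf (hJ : ∀ X, J (J X) = -X) (hL : IsLagrangianIn ⊤ L)
    (hT : (T01 J).prod ⊥ ≤ L) : matched J (GT10 J ⊓ L) = L := by
  refine le_antisymm (sup_le inf_le_right hT) fun u hu => ?_
  have h := annihilator_of_isotropic hL hT hu
  have e : u = pi10 J u + (P01 J u.1, 0) := by
    rw [pi10_of_annihilator hJ h]
    exact Prod.ext (P10_add_P01 J u.1).symm (add_zero _).symm
  rw [e]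
  exact Submodule.add_mem_sup (pi10_mem hJ hL hT hu) ⟨P01_mem hJ _, rfl⟩

/-- An element of 𝕋_{1,0} has the same pairing with v ∈ L as with the projection of v, so
orthogonality to the trace of L implies orthogonality to L. -/
theorem isLagrangianIn_inf (hJ : ∀ X, J (J X) = -X) (hL : IsLagrangianIn ⊤ L)
    (hT : (T01 J).prod ⊥ ≤ L) : IsLagrangianIn (GT10 J) (GT10 J ⊓ L) := by
  refine ⟨inf_le_left, fun u hu => ⟨fun h v hv => (hL.2 u trivial).mp h.2 v hv.2, fun h => ?_⟩⟩
  refine ⟨hu, (hL.2 u trivial).mpr fun v hv => ?_⟩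
  have hv' := annihilator_of_isotropic hL hT hv
  have h1 := h _ (pi10_mem hJ hL hT hv)
  rw [pi10_of_annihilator hJ hv'] at h1
  have h2 : evalC u.2 v.1 = evalC u.2 (P10 J v.1) + evalC u.2 (P01 J v.1) := by
    conv_lhs => rw [← P10_add_P01 J v.1]
    simp only [evalC, Cx.re_add, Cx.im_add, map_add]
    ring
  have h3 : evalC u.2 (P01 J v.1) = 0 := hu.2 _ (P01_mem hJ _)
  simp only [pairingC] at h1 ⊢
  rw [h2, h3, add_zero, h1]

theorem inf_inf_inf_eq_bot (hJ : ∀ X, J (J X) = -X) (h : L ⊓ L' = (T01 J).prod ⊥) :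
    (GT10 J ⊓ L) ⊓ (GT10 J ⊓ L') = ⊥ := by
  rw [eq_bot_iff]
  rintro u ⟨⟨hu, h1⟩, _, h2⟩
  have h3 : u ∈ (T01 J).prod ⊥ := h ▸ ⟨h1, h2⟩
  exact Prod.ext (T10_inf_T01 hJ hu.1 h3.1) h3.2

/-- A decomposition in L + L' of an element of 𝕋_{1,0} is projected to 𝕋_{1,0}, where `pi10_mem`
keeps each summand in its Lagrangian. -/
theorem inf_sup_inf_eq (hJ : ∀ X, J (J X) = -X) (hL : IsLagrangianIn ⊤ L)
    (hT : (T01 J).prod ⊥ ≤ L) (hL' : IsLagrangianIn ⊤ L') (hT' : (T01 J).prod ⊥ ≤ L')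
    (h : GT10 J ≤ L ⊔ L') : (GT10 J ⊓ L) ⊔ (GT10 J ⊓ L') = GT10 J := by
  refine le_antisymm (sup_le inf_le_left inf_le_left) fun u hu => ?_
  obtain ⟨v, hv, w, hw, rfl⟩ := Submodule.mem_sup.mp (h hu)
  rw [← pi10_of_mem hJ hu, pi10_add]
  exact Submodule.add_mem_sup (pi10_mem hJ hL hT hv) (pi10_mem hJ hL' hT' hw)

theorem matched_conj (hJ : ∀ X, J (J X) = -X) (A : Submodule ℂ (GTC V)) :
    matched (-J) (conjSub A) = conjSub (matched J A) := by
  have hJ' : ∀ X, (-J) ((-J) X) = -X := fun X => by simp [hJ]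
  have hc : ∀ u v : GTC V, conjG (u + v) = conjG u + conjG v := fun u v => by
    refine ext_re_im ?_ ?_
    · ext <;> simp [reG, conjG, Cx.conj]
    · ext <;> simp [imG, conjG, Cx.conj]
      abel
  have hT : ∀ u : GTC V, u ∈ (T01 (-J)).prod ⊥ ↔ conjG u ∈ (T01 J).prod ⊥ := fun u => by
    rw [Submodule.mem_prod, Submodule.mem_prod, mem_T01 hJ', mem_T01 hJ, Submodule.mem_bot,
      Submodule.mem_bot]
    refine and_congr ?_ ⟨fun h => ?_, fun h => ?_⟩
    · simp [conjG, Cx.conj, neg_eq_iff_eq_neg]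
    · ext Z
      simp [conjG, h]
    · ext Z
      have := DFunLike.congr_fun h Z
      simpa [conjG] using this
  ext u
  rw [mem_conjSub, matched, matched, Submodule.mem_sup, Submodule.mem_sup]
  constructor
  · rintro ⟨a, ha, t, ht, rfl⟩
    exact ⟨conjG a, ha, conjG t, (hT t).mp ht, (hc _ _).symm⟩
  · rintro ⟨a, ha, t, ht, h⟩
    refine ⟨conjG a, ?_, conjG t, (hT _).mpr ?_, ?_⟩
    · rwa [mem_conjSub, conjG_conjG]
    · rwa [conjG_conjG]
    · rw [← hc, h, conjG_conjG]

end Matched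

end Fibre

/-! ### Reality and types: the algebra behind the d^c equation -/

section ThreeForm

variable {V : Type*} [AddCommGroup V] [Module ℝ V] [TopologicalSpace V]
  [IsTopologicalAddGroup V] [ContinuousSMul ℝ V] {J : V →L[ℝ] V}

theorem conjForm_neg_smul {n : ℕ} (η : V [⋀^Fin n]→L[ℝ] ℂ) {c : ℂ}
    (hc : (starRingEnd ℂ) c = -c) : conjForm (c • η) = (-c) • conjForm η := by
  ext v
  change conjL (c * η v) = -c * conjL (η v)
  rw [← hc]
  exact map_mul (starRingEnd ℂ) _ _

/-- A real three-form `η` for which `η + cξ`, with `ξ` real without `(0,3)` part and `c` imaginary,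
is of type `(2,1) + (3,0)`. -/
theorem real_form_types (hJ : ∀ X, J (J X) = -X) {η ξ : V [⋀^Fin 3]→L[ℝ] ℂ} {c : ℂ}
    (hη : conjForm η = η) (hξ : conjForm ξ = ξ) (hc : (starRingEnd ℂ) c = -c)
    (hK : ∀ X ∈ T01 J, ∀ Y ∈ T01 J, ∀ Z, evalThree (η + c • ξ) X Y Z = 0)
    (h0 : ∀ X ∈ T01 J, ∀ Y ∈ T01 J, ∀ Z ∈ T01 J, evalThree ξ X Y Z = 0) :
    η = (-c) • (typePart J 1 ξ - typePart J 2 ξ) ∧ η + c • ξ = (2 * c) • typePart J 2 ξ := by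
  -- Reality turns the vanishing of a (0,3) part into that of the (3,0) part, for ξ and then for η.
  have hξ0 := typePart_zero_eq_zero hJ h0
  have hξ3 : typePart J 3 ξ = 0 := by
    rw [← hξ, ← conjForm_typePart_zero, hξ0]
    ext v
    exact map_zero conjL
  have hη0 : typePart J 0 η = 0 := by
    have := typePart_zero_eq_zero hJ fun X hX Y hY Z _ => hK X hX Y hY Z
    rw [typePart_add_smul, hξ0] at this
    ext v
    have := DFunLike.congr_fun this v
    simpa using this
  have hη3 : typePart J 3 η = 0 := by
    rw [← hη, ← conjForm_typePart_zero, hη0]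
    ext v
    exact map_zero conjL
  have hη1 : typePart J 1 η = (-c) • typePart J 1 ξ := by
    have := typePart_one_eq_zero hJ hK
    rw [typePart_add_smul] at this
    ext v
    have : typePart J 1 η v + c * typePart J 1 ξ v = 0 := DFunLike.congr_fun this v
    change typePart J 1 η v = -c * typePart J 1 ξ v
    linear_combination this
  -- The conjugate of the identity for the (1,2) parts; the sign changes because c is imaginary.
  have hη2 : typePart J 2 η = c • typePart J 2 ξ := by
    have hc' : (starRingEnd ℂ) (-c) = -(-c) := by rw [map_neg, hc]
    rw [← hη, ← conjForm_typePart_one, hη1, conjForm_neg_smul _ hc', conjForm_typePart_one, hξ,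
      neg_neg]
  have e1 := sum_typePart (J := J) η
  have e2 := sum_typePart (J := J) ξ
  rw [hη0, hη3, hη1, hη2, zero_add, add_zero] at e1
  rw [hξ0, hξ3, zero_add, add_zero] at e2
  refine ⟨?_, ?_⟩ <;> ext v <;> have e1 := DFunLike.congr_fun e1 v <;>
    have e2 := DFunLike.congr_fun e2 v <;>
    simp only [ContinuousAlternatingMap.add_apply, ContinuousAlternatingMap.sub_apply,
      ContinuousAlternatingMap.smul_apply, smul_eq_mul] at e1 e2 ⊢
  · linear_combination -e1
  · linear_combination -e1 - c * e2

/-- A J-invariant two-form satisfies σ(X, Y) = σ(JX, JY) = (-i)² σ(X, Y) on (0,1) vectors. -/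
theorem evalC_interiorC_of_mem_T01 (hJ : ∀ X, J (J X) = -X) {σ : V [⋀^Fin 2]→L[ℝ] ℂ}
    (hσ : ∀ X Y, σ ![J X, J Y] = σ ![X, Y]) {X Y : Cx V} (hX : X ∈ T01 J) (hY : Y ∈ T01 J) :
    evalC (toCovector (interiorC X σ)) Y = 0 := by
  rw [mem_T01 hJ] at hX hY
  have h1 := hσ X.re Y.re
  have h2 := hσ X.re Y.im
  rw [hX, hY] at h1
  rw [hX, ← hY, hJ, two_swap, two_neg_left, two_swap, neg_neg, hY] at h2
  simp only [evalC, toCovector_interiorC]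
  rw [h1]
  linear_combination (-Complex.I) * h2 + σ ![X.re, Y.re] * Complex.I_sq

end ThreeForm

/-! ### Dirac structures that meet in T_{0,1} -/

section Half

variable {E : Type*} [NormedAddCommGroup E] [NormedSpace ℝ E] [FiniteDimensional ℝ E]
  {M : Type*} [TopologicalSpace M] [ChartedSpace E M] [IsManifold 𝓘(ℝ, E) ∞ M]
  {U : Set M} {x : M}

theorem smoothFormOn_zero : SmoothFormOn U (fun x => oneForm (0 : T E x →L[ℝ] ℂ)) := fun x₀ => by
  refine (contDiffOn_const (c := (0 : E [⋀^Fin 1]→L[ℝ] ℂ))).congr fun y _ => ?_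
  ext v
  rfl

theorem extD_zero_oneForm : extD (fun x : M => oneForm (0 : T E x →L[ℝ] ℂ)) x = 0 := by
  have h := extD_smul isOpen_univ (Set.mem_univ x)
    (smoothFormOn_zero (E := E) (M := M) (U := Set.univ)) 0
  rw [zero_smul] at h
  rw [← h]
  congr 1
  funext y
  ext v
  simp [oneForm]

theorem extDFun_eq_zero (hU : IsOpen U) (hx : x ∈ U) {f : M → ℂ} (hf : ∀ y ∈ U, f y = 0) :
    extDFun E f x = 0 := by
  have h : HasMFDerivAt 𝓘(ℝ, E) 𝓘(ℝ, ℂ) f x 0 :=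
    (hasMFDerivAt_const (0 : ℂ) x).congr_of_eventuallyEq
      (Filter.eventuallyEq_of_mem (hU.mem_nhds hx) hf)
  rw [extDFun, h.mfderiv]
  ext v
  rfl

theorem SmoothFieldCOn.pair_zero {X : ∀ x : M, Cx (T E x)} (hX : SmoothFieldCOn U X) :
    SmoothCOn U (fun x => (X x, 0)) := ⟨hX, smoothFormOn_zero⟩

/-- With no covector parts, only the Lie bracket and the twisting term survive. -/
theorem courant_pair_zero (hU : IsOpen U) (hx : x ∈ U) (K : Form E M 3 ℂ)
    (X Y : ∀ x : M, Cx (T E x)) :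
    courant K (fun y => (X y, 0)) (fun y => (Y y, 0)) x =
      (lieC X Y x, toCovector (interiorC (X x) (interiorC (Y x) (K x)))) := by
  refine Prod.ext rfl ?_
  have h : extDFun E (fun y => evalC (0 : T E y →L[ℝ] ℂ) (X y)) x = 0 :=
    extDFun_eq_zero hU hx fun y _ => by simp [evalC]
  change toCovector (interiorC (X x) (extD (fun y : M => oneForm (0 : T E y →L[ℝ] ℂ)) x)) +
    extDFun E (fun y => evalC (0 : T E y →L[ℝ] ℂ) (X y)) x -
    toCovector (interiorC (Y x) (extD (fun y : M => oneForm (0 : T E y →L[ℝ] ℂ)) x)) + _ = _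
  rw [h, extD_zero_oneForm]
  ext Z
  simp [toCovector_interiorC]

/-- A smooth endomorphism of the tangent bundle. -/
def IsSmoothEnd (J : EndT E M) : Prop :=
  ∀ U : Set M, IsOpen U → ∀ X : ∀ x : M, T E x, SmoothFieldOn U X →
    SmoothFieldOn U (fun x => J x (X x))

variable {J : EndT E M}

theorem IsSmoothEnd.P01 (hJs : IsSmoothEnd J) (hU : IsOpen U) {X : ∀ x : M, Cx (T E x)}
    (hX : SmoothFieldCOn U X) : SmoothFieldCOn U (fun x => P01 (J x) (X x)) := by
  have h1 := (hX.1.sub (hJs U hU _ hX.2)).smul (1 / 2)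
  have h2 := (hX.2.add (hJs U hU _ hX.1)).smul (1 / 2)
  refine ⟨h1.congr fun x _ => ?_, h2.congr fun x _ => ?_⟩ <;> congr 1 <;>
    simp [GenKahler.P01, Cx.map, sub_eq_add_neg]

theorem IsSmoothEnd.P10 (hJs : IsSmoothEnd J) (hU : IsOpen U) {X : ∀ x : M, Cx (T E x)}
    (hX : SmoothFieldCOn U X) : SmoothFieldCOn U (fun x => P10 (J x) (X x)) := by
  have h1 := (hX.1.add (hJs U hU _ hX.2)).smul (1 / 2)
  have h2 := (hX.2.sub (hJs U hU _ hX.1)).smul (1 / 2)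
  refine ⟨h1.congr fun x _ => ?_, h2.congr fun x _ => ?_⟩ <;> congr 1 <;>
    simp [GenKahler.P10, Cx.map, sub_eq_add_neg]

theorem exists_smoothFieldCOn (x : M) (v : Cx (T E x)) : ∃ U : Set M, IsOpen U ∧ x ∈ U ∧
    ∃ X : ∀ x : M, Cx (T E x), SmoothFieldCOn U X ∧ X x = v := by
  obtain ⟨U, hU, hx, X, hX, hXv⟩ := exists_smoothFieldOn x v.re
  obtain ⟨U', hU', hx', X', hX', hXv'⟩ := exists_smoothFieldOn x v.im
  exact ⟨U ∩ U', hU.inter hU', ⟨hx, hx'⟩, fun y => ⟨X y, X' y⟩,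
    ⟨hX.mono Set.inter_subset_left, hX'.mono Set.inter_subset_right⟩, Cx.ext hXv hXv'⟩

theorem SmoothFieldCOn.mono {V : Set M} {X : ∀ x : M, Cx (T E x)} (hX : SmoothFieldCOn U X)
    (hV : V ⊆ U) : SmoothFieldCOn V X := ⟨hX.1.mono hV, hX.2.mono hV⟩

/-- An arbitrary smooth extension, projected to T_{0,1}. -/
theorem exists_smoothFieldCOn_T01 (hJ : ∀ x X, J x (J x X) = -X) (hJs : IsSmoothEnd J)
    {v : Cx (T E x)} (hv : v ∈ T01 (J x)) : ∃ U : Set M, IsOpen U ∧ x ∈ U ∧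
    ∃ X : ∀ x : M, Cx (T E x), SmoothFieldCOn U X ∧ (∀ y, X y ∈ T01 (J y)) ∧ X x = v := by
  obtain ⟨U, hU, hx, X, hX, hXv⟩ := exists_smoothFieldCOn x v
  refine ⟨U, hU, hx, _, hJs.P01 hU hX, fun y => P01_mem (hJ y) _, ?_⟩
  rw [hXv, P01_of_mem (hJ x) hv]

/-- Two Dirac structures `L`, `L'` for the three-form `K` whose intersection is `T_{0,1}` for the
almost complex structure `J`, and whose sum contains `𝕋_{1,0}`. -/
structure IsDiracPair (J : EndT E M) (K : Form E M 3 ℂ) (L L' : Subfamily E M) : Prop where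
  sq : ∀ x X, J x (J x X) = -X
  smooth : IsSmoothEnd J
  lagrangian : ∀ x, IsLagrangianIn ⊤ (L x)
  lagrangian' : ∀ x, IsLagrangianIn ⊤ (L' x)
  smoothFamily : IsSmoothFamily L
  smoothFamily' : IsSmoothFamily L'
  involutive : IsInvolutive K L
  involutive' : IsInvolutive K L'
  inf : ∀ x, L x ⊓ L' x = (T01 (J x)).prod ⊥
  span : ∀ x, GT10 (J x) ≤ L x ⊔ L' x

namespace IsDiracPair

variable {K : Form E M 3 ℂ} {L L' : Subfamily E M}

theorem symm (h : IsDiracPair J K L L') : IsDiracPair J K L' L where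
  sq := h.sq
  smooth := h.smooth
  lagrangian := h.lagrangian'
  lagrangian' := h.lagrangian
  smoothFamily := h.smoothFamily'
  smoothFamily' := h.smoothFamily
  involutive := h.involutive'
  involutive' := h.involutive
  inf x := by rw [inf_comm, h.inf]
  span x := by rw [sup_comm]; exact h.span x

theorem le (h : IsDiracPair J K L L') (x : M) : (T01 (J x)).prod ⊥ ≤ L x :=
  h.inf x ▸ inf_le_left

/-- Fields of type (0,1) are sections of both L and L', so their bracket lies in L ∩ L' = T_{0,1}.
Its vector part yields integrability, and the absence of a covector part restricts the type of K. -/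
theorem courant_mem (h : IsDiracPair J K L L') (hU : IsOpen U) (hx : x ∈ U)
    {X Y : ∀ x : M, Cx (T E x)} (hX : SmoothFieldCOn U X) (hY : SmoothFieldCOn U Y)
    (hXT : ∀ y ∈ U, X y ∈ T01 (J y)) (hYT : ∀ y ∈ U, Y y ∈ T01 (J y)) :
    lieC X Y x ∈ T01 (J x) ∧
      toCovector (interiorC (X x) (interiorC (Y x) (K x))) = 0 := by
  have key : courant K (fun y => (X y, 0)) (fun y => (Y y, 0)) x ∈ (T01 (J x)).prod ⊥ := by
    rw [← h.inf]
    exact ⟨h.involutive U hU _ _ hX.pair_zero hY.pair_zero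
        (fun y hy => h.le y ⟨hXT y hy, rfl⟩) (fun y hy => h.le y ⟨hYT y hy, rfl⟩) x hx,
      h.involutive' U hU _ _ hX.pair_zero hY.pair_zero
        (fun y hy => h.symm.le y ⟨hXT y hy, rfl⟩) (fun y hy => h.symm.le y ⟨hYT y hy, rfl⟩) x hx⟩
  rw [courant_pair_zero hU hx] at key
  exact ⟨key.1, key.2⟩

theorem evalThree_eq_zero (h : IsDiracPair J K L L') {X Y : Cx (T E x)} (hX : X ∈ T01 (J x))
    (hY : Y ∈ T01 (J x)) (Z : Cx (T E x)) : evalThree (K x) X Y Z = 0 := by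
  obtain ⟨U, hU, hxU, X', hX', hXT, rfl⟩ := exists_smoothFieldCOn_T01 h.sq h.smooth hX
  obtain ⟨V, hV, hxV, Y', hY', hYT, rfl⟩ := exists_smoothFieldCOn_T01 h.sq h.smooth hY
  -- The fields are exchanged because `evalThree` inserts X before Y, as ι_Y ι_X does.
  have := (h.courant_mem (hU.inter hV) ⟨hxU, hxV⟩ (hY'.mono Set.inter_subset_right)
    (hX'.mono Set.inter_subset_left) (fun y _ => hYT y) (fun y _ => hXT y)).2
  rw [evalThree, this]
  simp [evalC]

/-- Involutivity of T_{0,1}, conjugated. -/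
theorem isComplexStructure (h : IsDiracPair J K L L') : IsComplexStructure J where
  sq := h.sq
  smooth := h.smooth
  integrable U hU X Y hX hY hXT hYT x hx := by
    have hX' : SmoothFieldCOn U (fun y => (X y).conj) := ⟨hX.1, hX.2.neg⟩
    have hY' : SmoothFieldCOn U (fun y => (Y y).conj) := ⟨hY.1, hY.2.neg⟩
    have := (h.courant_mem hU hx hX' hY' (fun y hy => conj_mem_T01 (h.sq y) (hXT y hy))
      (fun y hy => conj_mem_T01 (h.sq y) (hYT y hy))).1
    rw [lieC_conj hU hx hX hY] at this
    have := conj_mem_T10 (h.sq x) this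
    convert this using 1
    exact Cx.ext rfl (neg_neg _).symm

/-- In Cartan's formula on three (0,1) fields, brackets stay of type (0,1) by `courant_mem`, and σ
vanishes on pairs of (0,1) vectors: every term is zero. Thus dσ has no (0,3) part. -/
theorem extD_eq_zero (h : IsDiracPair J K L L') {σ : Form E M 2 ℂ}
    (hσ : SmoothFormOn Set.univ σ) (hJσ : ∀ x X Y, σ x ![J x X, J x Y] = σ x ![X, Y])
    {X Y Z : Cx (T E x)} (hX : X ∈ T01 (J x)) (hY : Y ∈ T01 (J x)) (hZ : Z ∈ T01 (J x)) :
    evalThree (extD σ x) X Y Z = 0 := by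
  obtain ⟨U, hU, hxU, X, hX', hXT, rfl⟩ := exists_smoothFieldCOn_T01 h.sq h.smooth hX
  obtain ⟨V, hV, hxV, Y, hY', hYT, rfl⟩ := exists_smoothFieldCOn_T01 h.sq h.smooth hY
  obtain ⟨W, hW, hxW, Z, hZ', hZT, rfl⟩ := exists_smoothFieldCOn_T01 h.sq h.smooth hZ
  have hO := (hU.inter hV).inter hW
  have hxO : x ∈ U ∩ V ∩ W := ⟨⟨hxU, hxV⟩, hxW⟩
  have hX'' := hX'.mono (Set.inter_subset_left.trans Set.inter_subset_left : U ∩ V ∩ W ⊆ U)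
  have hY'' := hY'.mono (Set.inter_subset_left.trans Set.inter_subset_right : U ∩ V ∩ W ⊆ V)
  have hZ'' := hZ'.mono (Set.inter_subset_right : U ∩ V ∩ W ⊆ W)
  have hv : ∀ {y : M} {A B : Cx (T E y)}, A ∈ T01 (J y) → B ∈ T01 (J y) →
      evalC (toCovector (interiorC A (σ y))) B = 0 := fun {y} _ _ hA hB =>
    evalC_interiorC_of_mem_T01 (h.sq y) (hJσ y) hA hB
  rw [evalThree, extD_two_complex hO hxO (hσ.mono (Set.subset_univ _)) hX'' hY'' hZ'',
    extDFun_eq_zero hO hxO fun y _ => hv (hYT y) (hZT y),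
    extDFun_eq_zero hO hxO fun y _ => hv (hXT y) (hZT y),
    extDFun_eq_zero hO hxO fun y _ => hv (hXT y) (hYT y),
    hv (h.courant_mem hO hxO hX'' hY'' (fun y _ => hXT y) (fun y _ => hYT y)).1 hZ,
    hv (h.courant_mem hO hxO hX'' hZ'' (fun y _ => hXT y) (fun y _ => hZT y)).1 hY,
    hv (h.courant_mem hO hxO hY'' hZ'' (fun y _ => hYT y) (fun y _ => hZT y)).1 hX]
  simp [evalC]

/-- Both differential axioms are the involutivity of L followed by π_{1,0}, which maps L to its
trace on 𝕋_{1,0}; for the first, a (0,1) field is regarded as a section of L. -/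
theorem isHolomorphicDirac (h : IsDiracPair J K L L') :
    IsHolomorphicDirac J K (fun x => GT10 (J x) ⊓ L x) where
  lagrangian x := isLagrangianIn_inf (h.sq x) (h.lagrangian x) (h.le x)
  smooth x a ha := by
    obtain ⟨U, hU, hx, u, hu, huL, rfl⟩ := h.smoothFamily x a ha.2
    -- On L the projection leaves the covector part unchanged, so its smoothness requires only that
    -- of J.
    have e : ∀ y ∈ U, (P10 (J y) (u y).1, (u y).2) = pi10 (J y) (u y) := fun y hy =>
      (pi10_of_annihilator (h.sq y)
        (annihilator_of_isotropic (h.lagrangian y) (h.le y) (huL y hy))).symm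
    refine ⟨U, hU, hx, fun y => (P10 (J y) (u y).1, (u y).2), ⟨h.smooth.P10 hU hu.1, hu.2⟩,
      fun y hy => ?_, ?_⟩
    · change (P10 (J y) (u y).1, (u y).2) ∈ _
      rw [e y hy]
      exact pi10_mem (h.sq y) (h.lagrangian y) (h.le y) (huL y hy)
    · change (P10 (J x) (u x).1, (u x).2) = _
      rw [e x hx, pi10_of_mem (h.sq x) ha.1]
  holomorphic U hU X a hX ha hXT haL x hx :=
    pi10_mem (h.sq x) (h.lagrangian x) (h.le x) (h.involutive U hU _ _ hX.pair_zero ha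
      (fun y hy => h.le y ⟨hXT y hy, rfl⟩) (fun y hy => (haL y hy).2) x hx)
  involutive U hU a b ha hb haL hbL x hx :=
    pi10_mem (h.sq x) (h.lagrangian x) (h.le x) (h.involutive U hU _ _ ha hb
      (fun y hy => (haL y hy).2) (fun y hy => (hbL y hy).2) x hx)

theorem isHolomorphic (h : IsDiracPair J K L L') (hK : SmoothFormOn Set.univ K)
    (hdK : ∀ x, extD K x = 0) :
    (⟨J, K, fun x => GT10 (J x) ⊓ L x, fun x => GT10 (J x) ⊓ L' x⟩ :
      ManinTriple E M).IsHolomorphic where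
  complex := h.isComplexStructure
  smooth := hK
  closed := hdK
  type12 x := typePart_one_eq_zero (h.sq x) fun _ hX _ hY Z => h.evalThree_eq_zero hX hY Z
  type03 x := typePart_zero_eq_zero (h.sq x) fun _ hX _ hY Z _ => h.evalThree_eq_zero hX hY Z
  diracA := h.isHolomorphicDirac
  diracB := h.symm.isHolomorphicDirac
  disjoint x := inf_inf_inf_eq_bot (h.sq x) (h.inf x)
  span x := inf_sup_inf_eq (h.sq x) (h.lagrangian x) (h.le x) (h.lagrangian' x) (h.symm.le x)
    (h.span x)

end IsDiracPair

/-- If `H + c dω` is the three-form of a Dirac pair, where `H` is a real closed form, `σ` is real of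
type `(1,1)`, and `c` is imaginary, then `H = -c(∂̄σ - ∂σ)` and `H + c dω = 2c ∂σ`. -/
theorem IsDiracPair.curvature {H : Form E M 3 ℝ} {σ : Form E M 2 ℝ} {c : ℂ} {L L' : Subfamily E M}
    (h : IsDiracPair J (fun x => cxForm (H x) + c • extD (fun x => cxForm (σ x)) x) L L')
    (hc : (starRingEnd ℂ) c = -c) (hσ : SmoothFormOn Set.univ σ)
    (hJσ : ∀ x X Y, σ x ![J x X, J x Y] = σ x ![X, Y]) (x : M) :
    cxForm (H x) = (-c) • (delbar J (fun x => cxForm (σ x)) x - del J (fun x => cxForm (σ x)) x) ∧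
    cxForm (H x) + c • extD (fun x => cxForm (σ x)) x =
      (2 * c) • del J (fun x => cxForm (σ x)) x := by
  refine real_form_types (h.sq x) (conjForm_cxForm _) ?_ hc
    (fun _ hX _ hY Z => h.evalThree_eq_zero hX hY Z) fun X hX Y hY Z hZ => ?_
  · rw [extD_cx isOpen_univ trivial hσ, conjForm_cxForm]
  · refine h.extD_eq_zero hσ.cx (fun y A B => ?_) hX hY hZ
    exact congrArg Complex.ofReal (hJσ y A B)

end Half

/-! ### Smooth and involutive families under conjugation and gauge -/

section Families

variable {E : Type*} [NormedAddCommGroup E] [NormedSpace ℝ E] [FiniteDimensional ℝ E]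
  {M : Type*} [TopologicalSpace M] [ChartedSpace E M] [IsManifold 𝓘(ℝ, E) ∞ M]
  {U : Set M} {x : M}

theorem contMDiffOn_chartD {X : ∀ x : M, T E x} (hX : SmoothFieldOn U X) {x₀ : M}
    (hU : U ⊆ (extChartAt 𝓘(ℝ, E) x₀).source) :
    ContMDiffOn 𝓘(ℝ, E) 𝓘(ℝ, E) ∞ (fun y => chartD x₀ y (X y)) U := by
  have h1 : ContMDiffOn 𝓘(ℝ, E) 𝓘(ℝ, E) ∞ (extChartAt 𝓘(ℝ, E) x₀) U :=
    contMDiffOn_extChartAt.mono (by rwa [← extChartAt_source 𝓘(ℝ, E)])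
  refine ((contDiffOn_chartField hX x₀).contMDiffOn.comp h1 fun y hy => ?_).congr fun y hy => ?_
  · have hs := hU hy
    refine ⟨(extChartAt 𝓘(ℝ, E) x₀).map_source hs, ?_⟩
    rwa [Set.mem_preimage, (extChartAt 𝓘(ℝ, E) x₀).left_inv hs]
  · change _ = chartField X x₀ (extChartAt 𝓘(ℝ, E) x₀ y)
    rw [chartField, (extChartAt 𝓘(ℝ, E) x₀).left_inv (hU hy)]

/-- The extension has constant coefficients in the chart at x. -/
theorem exists_smoothOneForm (x : M) (α : T E x →L[ℝ] ℝ) : ∃ U : Set M, IsOpen U ∧ x ∈ U ∧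
    ∃ β : ∀ x : M, T E x →L[ℝ] ℝ, SmoothFormOn U (fun x => oneForm (β x)) ∧ β x = α := by
  refine ⟨(extChartAt 𝓘(ℝ, E) x).source, isOpen_extChartAt_source x, mem_extChartAt_source x,
    fun y => (α.comp (ContinuousLinearMap.inverse (chartD (E := E) x x))).comp (chartD x y), ?_, ?_⟩
  · refine smoothFormOn_of_apply (isOpen_extChartAt_source x) fun V hV hVU X hX => ?_
    exact (α.comp (ContinuousLinearMap.inverse (chartD (E := E) x x))).contDiff.contMDiff.comp_contMDiffOn
      (contMDiffOn_chartD (hX 0) hVU)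
  · ext v
    exact congrArg α (constField_chartD (mem_extChartAt_source x) v)

theorem exists_smoothOn (x : M) (a : GT (T E x)) : ∃ U : Set M, IsOpen U ∧ x ∈ U ∧
    ∃ u : ∀ x : M, GT (T E x), SmoothOn U u ∧ u x = a := by
  obtain ⟨U, hU, hx, X, hX, hXa⟩ := exists_smoothFieldOn x a.1
  obtain ⟨V, hV, hx', β, hβ, hβa⟩ := exists_smoothOneForm x a.2
  exact ⟨U ∩ V, hU.inter hV, ⟨hx, hx'⟩, fun y => (X y, β y),
    ⟨hX.mono Set.inter_subset_left, hβ.mono Set.inter_subset_right⟩, Prod.ext hXa hβa⟩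

theorem SmoothOn.mkG {r m : ∀ x : M, GT (T E x)} (hr : SmoothOn U r) (hm : SmoothOn U m) :
    SmoothCOn U (fun x => mkG (r x) (m x)) := by
  refine ⟨⟨hr.1, hm.1⟩, ?_⟩
  have h := (hr.2.comp_clm Complex.ofRealCLM).add ((hm.2.comp_clm Complex.ofRealCLM).smul
    Complex.I)
  exact h

theorem SmoothOn.neg {u : ∀ x : M, GT (T E x)} (h : SmoothOn U u) :
    SmoothOn U (fun x => -u x) := ⟨h.1.neg, h.2.neg⟩

namespace IsGeneralizedComplex

variable {H : Form E M 3 ℝ} {J : EndGT E M}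

/-- The eigenspace consists of the r - iJr, so a smooth real extension u of r provides the smooth
section u - iJu. -/
theorem isSmoothFamily (h : IsGeneralizedComplex H J) :
    IsSmoothFamily (fun x => eigenG (J x)) := fun x a ha => by
  obtain ⟨U, hU, hx, u, hu, hua⟩ := exists_smoothOn x (reG a)
  refine ⟨U, hU, hx, fun y => mkG (u y) (-J y (u y)), hu.mkG (h.smooth U hU u hu).neg,
    fun y _ => ?_, ?_⟩
  · rw [mem_eigenG (h.sq y), reG_mkG, imG_mkG, neg_neg]
  · refine ext_re_im ?_ ?_
    · rw [reG_mkG, hua]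
    · rw [imG_mkG, hua, (mem_eigenG (h.sq x)).mp ha, neg_neg]

end IsGeneralizedComplex

theorem IsSmoothFamily.conjSub {L : Subfamily E M} (h : IsSmoothFamily L) :
    IsSmoothFamily (fun x => conjSub (L x)) := fun x a ha => by
  obtain ⟨U, hU, hx, u, hu, huL, hua⟩ := h x _ (mem_conjSub.mp ha)
  refine ⟨U, hU, hx, _, hu.conj, fun y hy => ?_, ?_⟩
  · rw [mem_conjSub, conjG_conjG]
    exact huL y hy
  · rw [hua, conjG_conjG]

theorem IsSmoothFamily.map_gauge {L : Subfamily E M} (h : IsSmoothFamily L) {B : Form E M 2 ℂ}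
    (hB : SmoothFormOn Set.univ B) : IsSmoothFamily (fun x => (L x).map (gauge (B x))) :=
  fun x a ha => by
  obtain ⟨b, hb, rfl⟩ := Submodule.mem_map.mp ha
  obtain ⟨U, hU, hx, u, hu, huL, rfl⟩ := h x b hb
  exact ⟨U, hU, hx, _, hu.gauge hU (hB.mono (Set.subset_univ _)),
    fun y hy => Submodule.mem_map_of_mem (huL y hy), rfl⟩

theorem IsInvolutive.conjSub {L : Subfamily E M} {H : Form E M 3 ℝ}
    (h : IsInvolutive (fun x => cxForm (H x)) L) :
    IsInvolutive (fun x => cxForm (H x)) (fun x => conjSub (L x)) :=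
  fun U hU u v hu hv huL hvL x hx => by
  have := h U hU _ _ hu.conj hv.conj huL hvL x hx
  rw [mem_conjSub, ← courant_conj hU hx _ hu hv]
  simpa only [conjForm_cxForm] using this

theorem IsInvolutive.map_gauge {L : Subfamily E M} {H H' : Form E M 3 ℂ}
    (h : IsInvolutive H L) {B : Form E M 2 ℂ} (hB : SmoothFormOn Set.univ B)
    (hH : ∀ x, H' x = H x + extD B x) :
    IsInvolutive H' (fun x => (L x).map (gauge (B x))) :=
  fun U hU u v hu hv huL hvL x hx => by
  have hBU := hB.mono (Set.subset_univ U)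
  -- Sections of the transformed family are moved back by e^{-B}, bracketed for H, and returned by
  -- `courant_gauge`.
  have hu' := hu.gauge hU hBU.neg
  have hv' := hv.gauge hU hBU.neg
  have := h U hU _ _ hu' hv' (fun y hy => mem_map_gauge.mp (huL y hy))
    (fun y hy => mem_map_gauge.mp (hvL y hy)) x hx
  have e := courant_gauge hU hx hBU (hH x) hu' hv'
  simp only [gauge_gauge_neg] at e
  rw [e]
  exact Submodule.mem_map_of_mem this

theorem isGaugeEquiv {F : Form E M 2 ℂ} (hF : SmoothFormOn Set.univ F) {H H' : Form E M 3 ℂ}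
    (hH : ∀ x, H' x = H x + extD F x) : IsGaugeEquiv F H H' where
  bijective x := Function.bijective_iff_has_inverse.mpr
    ⟨gauge (-F x), gauge_neg_gauge (F x), gauge_gauge_neg (F x)⟩
  smooth U hU u := by
    refine ⟨fun hu => hu.gauge hU (hF.mono (Set.subset_univ _)), fun hu => ?_⟩
    have := hu.gauge hU (hF.mono (Set.subset_univ _)).neg
    simpa only [gauge_neg_gauge] using this
  anchor _ _ := rfl
  pairing x := pairingC_gauge (F x)
  bracket U hU u v hu hv x hx := courant_gauge hU hx (hF.mono (Set.subset_univ _)) (hH x) hu hv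

end Families

/-! ### The generalized metric and the bihermitian formulas -/

section Bihermitian

variable {V : Type*} [AddCommGroup V] [Module ℝ V] [TopologicalSpace V]
  [IsTopologicalAddGroup V] [ContinuousSMul ℝ V]

/-! ### The generalized metric in a fibre -/

theorem pairing_comm (u v : GT V) : pairing u v = pairing v u := add_comm _ _

theorem pairing_neg_left (u v : GT V) : pairing (-u) v = -pairing u v := by
  simp [pairing]; ring

theorem pairing_neg_right (u v : GT V) : pairing u (-v) = -pairing u v := by
  simp [pairing]; ring

theorem gaugeR_add (b : V [⋀^Fin 2]→L[ℝ] ℝ) (u v : GT V) :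
    gaugeR b (u + v) = gaugeR b u + gaugeR b v := by
  refine Prod.ext rfl ?_
  ext Z
  simp only [gaugeR, add_apply, toCovector_interior, Prod.fst_add, Prod.snd_add, two_add_left]
  ring

theorem gaugeR_smul (b : V [⋀^Fin 2]→L[ℝ] ℝ) (c : ℝ) (u : GT V) :
    gaugeR b (c • u) = c • gaugeR b u := by
  refine Prod.ext rfl ?_
  ext Z
  simp only [gaugeR, smul_apply, add_apply, toCovector_interior, Prod.smul_fst, Prod.smul_snd,
    two_smul_left, smul_add]

theorem gaugeR_neg (b : V [⋀^Fin 2]→L[ℝ] ℝ) (u : GT V) : gaugeR b (-u) = -gaugeR b u := by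
  refine Prod.ext rfl ?_
  ext Z
  simp only [gaugeR, add_apply, neg_apply, toCovector_interior, Prod.fst_neg, Prod.snd_neg,
    two_neg_left]
  ring

theorem gaugeR_sub (b : V [⋀^Fin 2]→L[ℝ] ℝ) (u v : GT V) :
    gaugeR b (u - v) = gaugeR b u - gaugeR b v := by
  rw [sub_eq_add_neg, gaugeR_add, gaugeR_neg, sub_eq_add_neg]

theorem gaugeR_covector (b : V [⋀^Fin 2]→L[ℝ] ℝ) (α : V →L[ℝ] ℝ) :
    gaugeR b (0, α) = (0, α) := by
  refine Prod.ext rfl ?_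
  ext Z
  simp [gaugeR, toCovector_interior, two_zero_left]

theorem pairingC_mkG (r m r' m' : GT V) : pairingC (mkG r m) (mkG r' m') =
    ((pairing r r' - pairing m m' : ℝ) : ℂ) +
      Complex.I * ((pairing r m' + pairing m r' : ℝ) : ℂ) := by
  simp only [pairingC, evalC, mkG, pairing, add_apply, smul_apply, ContinuousLinearMap.comp_apply,
    Complex.ofRealCLM_apply, smul_eq_mul]
  push_cast
  linear_combination ((m'.2 m.1 : ℂ) + m.2 m'.1) * Complex.I_sq

/-- A complex structure on `V ⊕ V*` whose eigenspaces are isotropic is orthogonal. -/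
theorem pairing_of_lagrangian {J : GT V →ₗ[ℝ] GT V} (hJ : ∀ u, J (J u) = -u)
    (hL : IsLagrangianIn ⊤ (eigenG J)) (u v : GT V) : pairing (J u) (J v) = pairing u v := by
  have hmem : ∀ u, mkG u (-J u) ∈ eigenG J := fun u => by
    rw [mem_eigenG hJ, reG_mkG, imG_mkG, neg_neg]
  -- The real part of ⟨u - iJu, v - iJv⟩ = 0 is ⟨u, v⟩ = ⟨Ju, Jv⟩.
  have h := congrArg Complex.re ((hL.2 _ trivial).mp (hmem u) _ (hmem v))
  rw [pairingC_mkG, pairing_neg_left, pairing_neg_right, neg_neg] at h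
  simp only [Complex.add_re, Complex.ofReal_re, Complex.I_mul_re, Complex.ofReal_im, neg_zero,
    add_zero, Complex.zero_re] at h
  linarith

/-- A generalized Kähler structure on one fibre. -/
structure IsKahlerPair (JA JB : GT V →ₗ[ℝ] GT V) : Prop where
  sqA : ∀ u, JA (JA u) = -u
  sqB : ∀ u, JB (JB u) = -u
  orthA : ∀ u v, pairing (JA u) (JA v) = pairing u v
  orthB : ∀ u v, pairing (JB u) (JB v) = pairing u v
  comm : ∀ u, JA (JB u) = JB (JA u)
  pos : ∀ u, u ≠ 0 → 0 < pairing (JA u) (JB u)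

/-- The generalized metric `G = -JA JB`. -/
def genMetric (JA JB : GT V →ₗ[ℝ] GT V) : GT V →ₗ[ℝ] GT V := -(JA.comp JB)

theorem genMetric_apply (JA JB : GT V →ₗ[ℝ] GT V) (u : GT V) :
    genMetric JA JB u = -JA (JB u) := rfl

namespace IsKahlerPair

variable {JA JB : GT V →ₗ[ℝ] GT V}

theorem sqG (h : IsKahlerPair JA JB) (u : GT V) : genMetric JA JB (genMetric JA JB u) = u := by
  simp only [genMetric_apply, map_neg, neg_neg]
  rw [← h.comm, h.sqB, map_neg, map_neg, h.sqA, neg_neg]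

theorem pairing_genMetric (h : IsKahlerPair JA JB) (u v : GT V) :
    pairing (genMetric JA JB u) v = pairing (JB u) (JA v) := by
  rw [← h.orthA, genMetric_apply, map_neg, h.sqA, neg_neg]

theorem genMetric_symm (h : IsKahlerPair JA JB) (u v : GT V) :
    pairing (genMetric JA JB u) v = pairing u (genMetric JA JB v) := by
  rw [h.pairing_genMetric, pairing_comm u, h.pairing_genMetric, ← h.orthA (JB u), h.sqA,
    pairing_comm (JB v), ← h.orthB (JA u), h.sqB, h.comm]

theorem genMetric_pos (h : IsKahlerPair JA JB) {u : GT V} (hu : u ≠ 0) : 0 < pairing (genMetric JA JB u) u := by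
  rw [h.pairing_genMetric, pairing_comm]
  exact h.pos u hu

theorem genMetric_covector_pos (h : IsKahlerPair JA JB) {α : V →L[ℝ] ℝ} (hα : α ≠ 0) :
    0 < α (genMetric JA JB (0, α)).1 := by
  have := h.genMetric_pos (u := (0, α)) fun e => hα (congrArg Prod.snd e)
  simpa [pairing] using this

/-- A covector α whose image under G has no vector part would have ⟨Gα, α⟩ = α(π_T Gα) = 0, contrary
to positivity. This makes g definable and identifies the eigenspaces as graphs. -/
theorem genMetric_covector_injective (h : IsKahlerPair JA JB) {α β : V →L[ℝ] ℝ}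
    (e : (genMetric JA JB (0, α)).1 = (genMetric JA JB (0, β)).1) : α = β := by
  by_contra hne
  have hp := h.genMetric_covector_pos (sub_ne_zero.mpr hne)
  have h0 : ((0, α - β) : GT V) = (0, α) - (0, β) := Prod.ext (sub_zero _).symm rfl
  rw [h0, map_sub, Prod.fst_sub, e, sub_self, map_zero] at hp
  exact hp.false

theorem commG (h : IsKahlerPair JA JB) (u : GT V) : JA (genMetric JA JB u) = genMetric JA JB (JA u) := by
  rw [genMetric_apply, genMetric_apply, map_neg, h.comm u]

theorem JA_genMetric (h : IsKahlerPair JA JB) (u : GT V) : JA (genMetric JA JB u) = JB u := by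
  rw [genMetric_apply, map_neg, h.sqA, neg_neg]

end IsKahlerPair

/-- The bihermitian data `(g, I, I', b)` of a generalized Kähler structure on one fibre, in terms
of the eigenspaces `{X + bX ± gX}` of the generalized metric. -/
structure IsFibreData (JA JB : GT V →ₗ[ℝ] GT V) (g : V →L[ℝ] V →L[ℝ] ℝ) (I I' : V →L[ℝ] V)
    (b : V [⋀^Fin 2]→L[ℝ] ℝ) : Prop where
  A_pos : ∀ X, JA (gaugeR b (X, g X)) = gaugeR b (I X, g (I X))
  A_neg : ∀ X, JA (gaugeR b (X, -g X)) = gaugeR b (I' X, -g (I' X))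
  B_pos : ∀ X, JB (gaugeR b (X, g X)) = gaugeR b (I X, g (I X))
  B_neg : ∀ X, JB (gaugeR b (X, -g X)) = -gaugeR b (I' X, -g (I' X))

section Data

variable {JA JB : GT V →ₗ[ℝ] GT V} {g : V →L[ℝ] V →L[ℝ] ℝ} {I I' : V →L[ℝ] V}
  {b : V [⋀^Fin 2]→L[ℝ] ℝ}

theorem comp_of_orthogonal (sq : ∀ X, I (I X) = -X) (orth : ∀ X Y, g (I X) (I Y) = g X Y) (X : V) :
    (g X).comp I = -g (I X) := by
  ext Y
  have := orth X (I Y)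
  rw [sq, map_neg] at this
  simp [← this]

/-- On the graphs, that is for Z = X and Z = -X, the matrix formulas collapse to a single one of I
and I'. -/
theorem isFibreData_of_formulas (sq : ∀ X, I (I X) = -X) (sq' : ∀ X, I' (I' X) = -X)
    (orth : ∀ X Y, g (I X) (I Y) = g X Y) (orth' : ∀ X Y, g (I' X) (I' Y) = g X Y)
    (hA : ∀ X Z, JA (gaugeR b (X, g Z)) = gaugeR b
      ((1 / 2 : ℝ) • (I X + I' X + (I Z - I' Z)),
        (1 / 2 : ℝ) • (g (I X - I' X) - ((g Z).comp I + (g Z).comp I'))))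
    (hB : ∀ X Z, JB (gaugeR b (X, g Z)) = gaugeR b
      ((1 / 2 : ℝ) • (I X - I' X + (I Z + I' Z)),
        (1 / 2 : ℝ) • (g (I X + I' X) - ((g Z).comp I - (g Z).comp I')))) :
    IsFibreData JA JB g I I' b where
  A_pos X := by
    rw [hA, comp_of_orthogonal sq orth, comp_of_orthogonal sq' orth', map_sub]
    congr 2 <;> module
  A_neg X := by
    rw [← map_neg, hA, comp_of_orthogonal sq orth, comp_of_orthogonal sq' orth']
    simp only [map_neg, map_sub]
    congr 2 <;> module
  B_pos X := by
    rw [hB, comp_of_orthogonal sq orth, comp_of_orthogonal sq' orth', map_add]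
    congr 2 <;> module
  B_neg X := by
    rw [← map_neg, hB, comp_of_orthogonal sq orth, comp_of_orthogonal sq' orth', ← gaugeR_neg]
    simp only [map_neg, map_add]
    congr 1
    refine Prod.ext ?_ ?_
    · change _ = -(I' X)
      module
    · change _ = - -g (I' X)
      module

namespace IsFibreData


/-- The components of X + gZ in C₊ and C₋ lie over (X + Z)/2 and (X - Z)/2; this is why the action
on the graphs determines the matrices. -/
theorem decomp (X Z : V) : gaugeR b (X, g Z) =
    (1 / 2 : ℝ) • (gaugeR b (X + Z, g (X + Z)) + gaugeR b (X - Z, -g (X - Z))) := by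
  rw [← gaugeR_add, ← gaugeR_smul]
  congr 1
  refine Prod.ext ?_ ?_
  · change X = (1 / 2 : ℝ) • (X + Z + (X - Z))
    module
  · change g Z = (1 / 2 : ℝ) • (g (X + Z) + -g (X - Z))
    rw [map_add, map_sub]
    module

theorem formulaA (d : IsFibreData JA JB g I I' b) (sq : ∀ X, I (I X) = -X) (sq' : ∀ X, I' (I' X) = -X)
    (orth : ∀ X Y, g (I X) (I Y) = g X Y) (orth' : ∀ X Y, g (I' X) (I' Y) = g X Y) (X Z : V) :
    JA (gaugeR b (X, g Z)) = gaugeR b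
      ((1 / 2 : ℝ) • (I X + I' X + (I Z - I' Z)),
        (1 / 2 : ℝ) • (g (I X - I' X) - ((g Z).comp I + (g Z).comp I'))) := by
  rw [decomp, map_smul, map_add, d.A_pos, d.A_neg, ← gaugeR_add, ← gaugeR_smul,
    comp_of_orthogonal sq orth, comp_of_orthogonal sq' orth']
  congr 1
  refine Prod.ext ?_ ?_
  · change (1 / 2 : ℝ) • (I (X + Z) + I' (X - Z)) = _
    simp only [map_add, map_sub]
    module
  · change (1 / 2 : ℝ) • (g (I (X + Z)) + -g (I' (X - Z))) = _
    simp only [map_add, map_sub]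
    module

theorem formulaB (d : IsFibreData JA JB g I I' b) (sq : ∀ X, I (I X) = -X) (sq' : ∀ X, I' (I' X) = -X)
    (orth : ∀ X Y, g (I X) (I Y) = g X Y) (orth' : ∀ X Y, g (I' X) (I' Y) = g X Y) (X Z : V) :
    JB (gaugeR b (X, g Z)) = gaugeR b
      ((1 / 2 : ℝ) • (I X - I' X + (I Z + I' Z)),
        (1 / 2 : ℝ) • (g (I X + I' X) - ((g Z).comp I - (g Z).comp I'))) := by
  rw [decomp, map_smul, map_add, d.B_pos, d.B_neg, ← gaugeR_neg, ← gaugeR_add, ← gaugeR_smul,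
    comp_of_orthogonal sq orth, comp_of_orthogonal sq' orth']
  congr 1
  refine Prod.ext ?_ ?_
  · change (1 / 2 : ℝ) • (I (X + Z) + -I' (X - Z)) = _
    simp only [map_add, map_sub]
    module
  · change (1 / 2 : ℝ) • (g (I (X + Z)) + - -g (I' (X - Z))) = _
    simp only [map_add, map_sub]
    module

/-- The covector gX is half the difference of the eigenvectors of G over X, so G takes it to half
their sum. Both the uniqueness and the smoothness of g and b rest on this. -/
theorem genMetric_covector (d : IsFibreData JA JB g I I' b) (sq : ∀ X, I (I X) = -X) (sq' : ∀ X, I' (I' X) = -X) (X : V) :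
    genMetric JA JB (0, g X) = gaugeR b (X, 0) := by
  have e : ((0, g X) : GT V) = (1 / 2 : ℝ) • (gaugeR b (X, g X) - gaugeR b (X, -g X)) := by
    rw [← gaugeR_sub, ← gaugeR_smul, ← gaugeR_covector b]
    congr 1
    refine Prod.ext ?_ ?_
    · change (0 : V) = (1 / 2 : ℝ) • (X - X)
      module
    · change g X = (1 / 2 : ℝ) • (g X - -g X)
      module
  rw [genMetric_apply, e, map_smul, map_sub, d.B_pos, d.B_neg, map_smul, map_sub, map_neg, d.A_pos,
    d.A_neg, sq, sq', ← gaugeR_neg, ← gaugeR_sub, ← gaugeR_smul, ← gaugeR_neg]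
  congr 1
  refine Prod.ext ?_ ?_
  · change -((1 / 2 : ℝ) • (-X - - -X)) = X
    module
  · change -((1 / 2 : ℝ) • (g (-X) - - -g (-X))) = 0
    rw [map_neg]
    module

end IsFibreData

end Data

end Bihermitian

/-! ### Existence of the data in one fibre -/

section Existence

variable {V : Type*} [AddCommGroup V] [Module ℝ V] [TopologicalSpace V]
  [IsTopologicalAddGroup V] [ContinuousSMul ℝ V]

/-- The two-form of a continuous alternating bilinear form. -/
def twoFormOfBilin (β : V →L[ℝ] V →L[ℝ] ℝ) (h0 : ∀ X, β X X = 0)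
    (cont : Continuous fun p : V × V => β p.1 p.2) : V [⋀^Fin 2]→L[ℝ] ℝ where
  toFun v := β (v 0) (v 1)
  map_update_add' v i x y := by fin_cases i <;> simp [Function.update]
  map_update_smul' v i c x := by fin_cases i <;> simp [Function.update]
  map_eq_zero_of_eq' v i j hv hij := by
    have h : v 0 = v 1 := by
      fin_cases i <;> fin_cases j <;> simp_all
    change β (v 0) (v 1) = 0
    rw [h, h0]
  cont := cont.comp (f := fun v : Fin 2 → V => (v 0, v 1)) (by fun_prop)

theorem gaugeR_twoFormOfBilin (β : V →L[ℝ] V →L[ℝ] ℝ) (h0 : ∀ X, β X X = 0)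
    (cont : Continuous fun p : V × V => β p.1 p.2) (u : GT V) :
    gaugeR (twoFormOfBilin β h0 cont) u = (u.1, u.2 + β u.1) := by
  refine Prod.ext rfl ?_
  ext Z
  rw [gaugeR, add_apply, add_apply, toCovector_interior]
  rfl

/-- The metric is the inverse of α ↦ π_T G(α), the two-form is the covector part of G(gX), and I, I'
are `JA` on the two eigenspaces of G. The assumption `cont` makes the bilinear form β jointly
continuous, as required to regard it as a two-form. -/
theorem IsKahlerPair.exists_fibreData [FiniteDimensional ℝ V] [T2Space V]
    (cont : ∀ β : V →L[ℝ] V →L[ℝ] ℝ, Continuous fun p : V × V => β p.1 p.2)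
    {JA JB : GT V →ₗ[ℝ] GT V} (h : IsKahlerPair JA JB) :
    ∃ (g : V →L[ℝ] V →L[ℝ] ℝ) (I I' : V →L[ℝ] V) (b : V [⋀^Fin 2]→L[ℝ] ℝ),
      (∀ X Y, g X Y = g Y X) ∧ (∀ X, X ≠ 0 → 0 < g X X) ∧ (∀ X, I (I X) = -X) ∧
      (∀ X, I' (I' X) = -X) ∧ (∀ X Y, g (I X) (I Y) = g X Y) ∧
      (∀ X Y, g (I' X) (I' Y) = g X Y) ∧ IsFibreData JA JB g I I' b := by
  let G := genMetric JA JB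
  let Q : (V →L[ℝ] ℝ) →ₗ[ℝ] V :=
    (LinearMap.fst ℝ V (V →L[ℝ] ℝ)).comp (G.comp (LinearMap.inr ℝ V (V →L[ℝ] ℝ)))
  have hQ : Function.Injective (Q.comp LinearMap.toContinuousLinearMap.toLinearMap) :=
    fun α β e => LinearMap.toContinuousLinearMap.injective (h.genMetric_covector_injective e)
  let e : (V →ₗ[ℝ] ℝ) ≃ₗ[ℝ] V :=
    LinearEquiv.ofInjectiveOfFinrankEq _ hQ Subspace.dual_finrank_eq
  let g₀ : V →ₗ[ℝ] V →L[ℝ] ℝ := LinearMap.toContinuousLinearMap.toLinearMap.comp e.symm.toLinearMap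
  let g : V →L[ℝ] V →L[ℝ] ℝ := LinearMap.toContinuousLinearMap g₀
  have hg : ∀ X, (G (0, g X)).1 = X := fun X => e.apply_symm_apply X
  let β₀ : V →ₗ[ℝ] V →L[ℝ] ℝ :=
    (LinearMap.snd ℝ V (V →L[ℝ] ℝ)).comp (G.comp ((LinearMap.inr ℝ V (V →L[ℝ] ℝ)).comp g₀))
  let β : V →L[ℝ] V →L[ℝ] ℝ := LinearMap.toContinuousLinearMap β₀
  have hG : ∀ X, G (0, g X) = (X, β X) := fun X => Prod.ext (hg X) rfl
  have hG' : ∀ X, G (X, β X) = (0, g X) := fun X => by rw [← hG, h.sqG]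
  -- G is symmetric with G² = 1, hence orthogonal, and covectors are null; so G(gX) = X + βX is
  -- null, and its norm is 2β(X, X).
  have hβ : ∀ X, β X X = 0 := fun X => by
    have := h.genMetric_symm (0, g X) (G (0, g X))
    change pairing (G (0, g X)) (G (0, g X)) = pairing (0, g X) (G (G (0, g X))) at this
    rw [h.sqG, hG] at this
    simp only [pairing, map_zero, add_zero] at this
    linarith
  have hβ' : ∀ X Y, β X Y = -β Y X := fun X Y => by
    have := hβ (X + Y)
    simp only [map_add, add_apply, hβ] at this
    linarith
  have hgs : ∀ X Y, g X Y = g Y X := fun X Y => by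
    have := h.genMetric_symm (0, g X) (0, g Y)
    change pairing (G (0, g X)) (0, g Y) = pairing (0, g X) (G (0, g Y)) at this
    rw [hG, hG] at this
    simpa [pairing] using this.symm
  have hgp : ∀ X, X ≠ 0 → 0 < g X X := fun X hX => by
    have hne : g X ≠ 0 := fun h0 => hX (by rw [← hg X, h0]; exact congrArg Prod.fst (map_zero G))
    have := h.genMetric_covector_pos hne
    change 0 < g X (G (0, g X)).1 at this
    rwa [hg] at this
  -- The difference of w and the graph vector over the same X is a covector fixed by G. Its image
  -- under G has no vector part, so it vanishes by `genMetric_covector_injective`.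
  have hpos : ∀ w, G w = w → w = (w.1, β w.1 + g w.1) := fun w hw => by
    have h1 : G (w.1, β w.1 + g w.1) = (w.1, β w.1 + g w.1) := by
      have : ((w.1, β w.1 + g w.1) : GT V) = (w.1, β w.1) + (0, g w.1) :=
        Prod.ext (add_zero _).symm rfl
      rw [this, map_add, hG, hG', add_comm]
    have h2 : ((0, w.2 - (β w.1 + g w.1)) : GT V) = w - (w.1, β w.1 + g w.1) :=
      Prod.ext (sub_self _).symm rfl
    have h3 : (G (0, w.2 - (β w.1 + g w.1))).1 = (G (0, 0)).1 := by
      rw [h2, map_sub, hw, h1]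
      exact (sub_self _).trans (congrArg Prod.fst (map_zero G)).symm
    exact Prod.ext rfl (sub_eq_zero.mp (h.genMetric_covector_injective h3))
  have hneg : ∀ w, G w = -w → w = (w.1, β w.1 - g w.1) := fun w hw => by
    have h1 : G (w.1, β w.1 - g w.1) = -(w.1, β w.1 - g w.1) := by
      have : ((w.1, β w.1 - g w.1) : GT V) = (w.1, β w.1) - (0, g w.1) :=
        Prod.ext (sub_zero _).symm rfl
      rw [this, map_sub, hG, hG', neg_sub]
    have h2 : ((0, w.2 - (β w.1 - g w.1)) : GT V) = w - (w.1, β w.1 - g w.1) :=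
      Prod.ext (sub_self _).symm rfl
    have h3 : (G (0, w.2 - (β w.1 - g w.1))).1 = (G (0, 0)).1 := by
      rw [h2, map_sub, hw, h1]
      refine Eq.trans ?_ (congrArg Prod.fst (map_zero G)).symm
      exact sub_self (-w.1)
    exact Prod.ext rfl (sub_eq_zero.mp (h.genMetric_covector_injective h3))
  have hpos' : ∀ X, G (X, β X + g X) = (X, β X + g X) := fun X => by
    have : ((X, β X + g X) : GT V) = (X, β X) + (0, g X) := Prod.ext (add_zero _).symm rfl
    rw [this, map_add, hG, hG', add_comm]
  have hneg' : ∀ X, G (X, β X - g X) = -(X, β X - g X) := fun X => by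
    have : ((X, β X - g X) : GT V) = (X, β X) - (0, g X) := Prod.ext (sub_zero _).symm rfl
    rw [this, map_sub, hG, hG', neg_sub]
  let I : V →L[ℝ] V := LinearMap.toContinuousLinearMap
    ((LinearMap.fst ℝ V (V →L[ℝ] ℝ)).comp (JA.comp (LinearMap.id.prod (β₀ + g₀))))
  let I' : V →L[ℝ] V := LinearMap.toContinuousLinearMap
    ((LinearMap.fst ℝ V (V →L[ℝ] ℝ)).comp (JA.comp (LinearMap.id.prod (β₀ - g₀))))
  -- `JA` commutes with G, hence preserves its eigenspaces.
  have hI : ∀ X, JA (X, β X + g X) = (I X, β (I X) + g (I X)) := fun X =>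
    hpos _ (by rw [← h.commG, hpos'])
  have hI' : ∀ X, JA (X, β X - g X) = (I' X, β (I' X) - g (I' X)) := fun X =>
    hneg _ (by rw [← h.commG, hneg', map_neg])
  have hpair : ∀ X Y, pairing (X, β X + g X) (Y, β Y + g Y) = 2 * g X Y := fun X Y => by
    simp only [pairing, add_apply]
    rw [hβ' X Y, hgs Y X]
    ring
  have hpair' : ∀ X Y, pairing (X, β X - g X) (Y, β Y - g Y) = -(2 * g X Y) := fun X Y => by
    simp only [pairing, sub_apply]
    rw [hβ' X Y, hgs Y X]
    ring
  refine ⟨g, I, I', twoFormOfBilin β hβ (cont β), hgs, hgp, fun X => ?_, fun X => ?_,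
    fun X Y => ?_, fun X Y => ?_, ⟨fun X => ?_, fun X => ?_, fun X => ?_, fun X => ?_⟩⟩
  · have := h.sqA (X, β X + g X)
    rw [hI, hI] at this
    exact congrArg Prod.fst this
  · have := h.sqA (X, β X - g X)
    rw [hI', hI'] at this
    exact congrArg Prod.fst this
  · have := h.orthA (X, β X + g X) (Y, β Y + g Y)
    rw [hI, hI, hpair, hpair] at this
    linarith
  · have := h.orthA (X, β X - g X) (Y, β Y - g Y)
    rw [hI', hI', hpair', hpair'] at this
    linarith
  · simp only [gaugeR_twoFormOfBilin]
    rw [add_comm, hI, add_comm]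
  · simp only [gaugeR_twoFormOfBilin]
    rw [neg_add_eq_sub, hI', neg_add_eq_sub]
  -- For `JB` the identity `JB = JA G` is used, with G acting as 1 on the first graph and as -1 on
  -- the second.
  · simp only [gaugeR_twoFormOfBilin]
    rw [add_comm, ← h.JA_genMetric, hpos', hI, add_comm]
  · simp only [gaugeR_twoFormOfBilin]
    rw [neg_add_eq_sub, ← h.JA_genMetric, hneg', map_neg, hI', neg_add_eq_sub]

end Existence

/-! ### Uniqueness of the data -/

section Unique

variable {V : Type*} [AddCommGroup V] [Module ℝ V] [TopologicalSpace V]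
  [IsTopologicalAddGroup V] [ContinuousSMul ℝ V] {JA JB : GT V →ₗ[ℝ] GT V}
  {g g' : V →L[ℝ] V →L[ℝ] ℝ} {I I' K K' : V →L[ℝ] V} {b b' : V [⋀^Fin 2]→L[ℝ] ℝ}

/-- The vectors G(gX) = X + ι_X b determine g through their vector part, by injectivity, and then b
through their covector part; the action of `JA` on the graphs determines I and I'. -/
theorem IsFibreData.unique (h : IsKahlerPair JA JB) (d : IsFibreData JA JB g I I' b)
    (d' : IsFibreData JA JB g' K K' b') (sq : ∀ X, I (I X) = -X) (sq' : ∀ X, I' (I' X) = -X)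
    (sqK : ∀ X, K (K X) = -X) (sqK' : ∀ X, K' (K' X) = -X) :
    g = g' ∧ I = K ∧ I' = K' ∧ b = b' := by
  have e := d.genMetric_covector sq sq'
  have e' := d'.genMetric_covector sqK sqK'
  have hg : g = g' := by
    ext1 X
    refine h.genMetric_covector_injective ?_
    rw [e, e']
    rfl
  subst hg
  have hb : b = b' := by
    ext v
    have h1 := DFunLike.congr_fun (congrArg Prod.snd ((e (v 0)).symm.trans (e' (v 0)))) (v 1)
    simp only [gaugeR, zero_add, toCovector_interior] at h1
    have hv : v = ![v 0, v 1] := List.ofFn_inj.mp rfl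
    rwa [← hv] at h1
  subst hb
  refine ⟨rfl, ?_, ?_, rfl⟩
  · ext X
    exact congrArg Prod.fst ((d.A_pos X).symm.trans (d'.A_pos X))
  · ext X
    exact congrArg Prod.fst ((d.A_neg X).symm.trans (d'.A_neg X))

end Unique

/-! ### The inverse metric in a chart -/

section Smooth

variable {E : Type*} [NormedAddCommGroup E] [NormedSpace ℝ E] [FiniteDimensional ℝ E]
  {M : Type*} [TopologicalSpace M] [ChartedSpace E M] [IsManifold 𝓘(ℝ, E) ∞ M]
  {U : Set M} {x : M}

instance : FiniteDimensional ℝ (T E x) := inferInstanceAs (FiniteDimensional ℝ E)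

instance : T2Space (T E x) := inferInstanceAs (T2Space E)

variable {H : Form E M 3 ℝ} {JA JB : EndGT E M}

theorem IsGeneralizedKahler.isKahlerPair (h : IsGeneralizedKahler H JA JB) (x : M) :
    IsKahlerPair (JA x) (JB x) where
  sqA := h.complexA.sq x
  sqB := h.complexB.sq x
  orthA := pairing_of_lagrangian (h.complexA.sq x) (h.complexA.lagrangian x)
  orthB := pairing_of_lagrangian (h.complexB.sq x) (h.complexB.lagrangian x)
  comm := h.comm x
  pos := h.pos x

theorem BihermitianData.IsDataOf.isFibreData {d : BihermitianData E M} (hd : d.IsDataOf JA JB)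
    (x : M) : IsFibreData (JA x) (JB x) (d.g x) (d.Ip x) (d.Im x) (d.b x) :=
  isFibreData_of_formulas (d.Ip_sq x) (d.Im_sq x) (d.g_Ip x) (d.g_Im x) (hd.formulaA x)
    (hd.formulaB x)

theorem IsGeneralizedKahler.existsUnique_data (h : IsGeneralizedKahler H JA JB) :
    ∃! d : BihermitianData E M, d.IsDataOf JA JB := by
  choose g I I' b h1 h2 h3 h4 h5 h6 h7 using fun x =>
    (h.isKahlerPair x).exists_fibreData (continuous_bilin x)
  refine ⟨⟨g, I, I', b, h1, h2, h3, h4, h5, h6⟩, ⟨fun x => (h7 x).formulaA (h3 x) (h4 x) (h5 x)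
    (h6 x), fun x => (h7 x).formulaB (h3 x) (h4 x) (h5 x) (h6 x)⟩, fun d hd => ?_⟩
  have key := fun x => (hd.isFibreData x).unique (h.isKahlerPair x) (h7 x) (d.Ip_sq x) (d.Im_sq x)
    (h3 x) (h4 x)
  exact BihermitianData.ext (funext fun x => (key x).1) (funext fun x => (key x).2.1)
    (funext fun x => (key x).2.2.1) (funext fun x => (key x).2.2.2)

theorem IsGeneralizedKahler.smoothOn_genMetric (h : IsGeneralizedKahler H JA JB) (hU : IsOpen U)
    {u : ∀ x : M, GT (T E x)} (hu : SmoothOn U u) :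
    SmoothOn U (fun x => genMetric (JA x) (JB x) (u x)) :=
  (h.complexA.smooth U hU _ (h.complexB.smooth U hU _ hu)).neg

theorem SmoothFormOn.pair_zero {β : ∀ x : M, T E x →L[ℝ] ℝ}
    (h : SmoothFormOn U (fun x => oneForm (β x))) :
    SmoothOn U (fun x => ((0, β x) : GT (T E x))) := ⟨smoothFieldOn_zero, h⟩

theorem smoothFormOn_chartD (x₀ : M) (a : E →L[ℝ] ℝ) :
    SmoothFormOn (extChartAt 𝓘(ℝ, E) x₀).source (fun y => oneForm (a.comp (chartD x₀ y))) := by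
  refine smoothFormOn_of_apply (isOpen_extChartAt_source x₀) fun V hV hVU X hX => ?_
  exact a.contDiff.contMDiff.comp_contMDiffOn (contMDiffOn_chartD (hX 0) hVU)

/-- The operator `α ↦ π_T G(α)` from covectors to vectors, in the chart at `x₀`. -/
def cometric (JA JB : EndGT E M) (x₀ : M) (y : E) : (E →L[ℝ] ℝ) →L[ℝ] E :=
  let m := (extChartAt 𝓘(ℝ, E) x₀).symm y
  LinearMap.toContinuousLinearMap
    { toFun := fun a => chartD x₀ m (genMetric (JA m) (JB m) (0, a.comp (chartD x₀ m))).1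
      map_add' := fun a c => by
        have : ((0, (a + c).comp (chartD x₀ m)) : GT (T E m)) =
          (0, a.comp (chartD x₀ m)) + (0, c.comp (chartD x₀ m)) := Prod.ext (add_zero _).symm rfl
        rw [this, map_add, Prod.fst_add, map_add]
      map_smul' := fun r a => by
        have : ((0, (r • a).comp (chartD x₀ m)) : GT (T E m)) =
          r • (0, a.comp (chartD x₀ m)) := Prod.ext (smul_zero _).symm rfl
        rw [this, map_smul, Prod.smul_fst, map_smul]
        rfl }

theorem cometric_apply (x₀ : M) (y : E) (a : E →L[ℝ] ℝ) : cometric JA JB x₀ y a =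
    chartField (fun m => (genMetric (JA m) (JB m) (0, a.comp (chartD x₀ m))).1) x₀ y := rfl

theorem IsGeneralizedKahler.contDiffOn_cometric (h : IsGeneralizedKahler H JA JB) (x₀ : M) :
    ContDiffOn ℝ ∞ (cometric JA JB x₀) (extChartAt 𝓘(ℝ, E) x₀).target := by
  rw [contDiffOn_clm_apply]
  intro a
  have h1 := contDiffOn_chartField (h.smoothOn_genMetric (isOpen_extChartAt_source x₀)
    (smoothFormOn_chartD x₀ a).pair_zero).1 x₀
  refine h1.mono fun y hy => ⟨hy, (extChartAt 𝓘(ℝ, E) x₀).map_target hy⟩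

/-- This is G(gX) = X + ι_X b, projected to vectors and read in the chart: `cometric` inverts g. -/
theorem BihermitianData.IsDataOf.cometric_inverse {d : BihermitianData E M}
    (hd : d.IsDataOf JA JB) {x₀ : M} {y : E}
    (hy : y ∈ (extChartAt 𝓘(ℝ, E) x₀).target) (X : T E ((extChartAt 𝓘(ℝ, E) x₀).symm y)) :
    cometric JA JB x₀ y ((d.g _ X).comp (chartDSymm x₀ y)) = chartD x₀ _ X := by
  have e : ((d.g _ X).comp (chartDSymm x₀ y)).comp
      (chartD x₀ ((extChartAt 𝓘(ℝ, E) x₀).symm y)) = d.g _ X := by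
    ext v
    exact congrArg (d.g _ X) (chartDSymm_chartD hy v)
  rw [cometric_apply, chartField, e,
    (hd.isFibreData _).genMetric_covector (d.Ip_sq _) (d.Im_sq _)]
  rfl

theorem BihermitianData.IsDataOf.isInvertible_cometric {d : BihermitianData E M}
    (hd : d.IsDataOf JA JB) {x₀ : M} {y : E}
    (hy : y ∈ (extChartAt 𝓘(ℝ, E) x₀).target) : (cometric JA JB x₀ y).IsInvertible := by
  have hs : Function.Surjective (cometric JA JB x₀ y) := fun v =>
    ⟨_, (hd.cometric_inverse hy (chartDSymm x₀ y v)).trans (chartD_chartDSymm hy v)⟩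
  have hr : Module.finrank ℝ (E →L[ℝ] ℝ) = Module.finrank ℝ E := by
    rw [← (LinearMap.toContinuousLinearMap (𝕜 := ℝ) (E := E) (F' := ℝ)).finrank_eq]
    exact Subspace.dual_finrank_eq
  have hi : Function.Injective (cometric JA JB x₀ y) :=
    (LinearMap.injective_iff_surjective_of_finrank_eq_finrank
      (f := (cometric JA JB x₀ y : (E →L[ℝ] ℝ) →ₗ[ℝ] E)) hr).mpr hs
  refine ⟨(LinearEquiv.ofInjectiveOfFinrankEq
    (cometric JA JB x₀ y : (E →L[ℝ] ℝ) →ₗ[ℝ] E) hi hr).toContinuousLinearEquiv, ?_⟩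
  ext a
  rfl

end Smooth

/-! ### Smoothness of g, b, I± and ω± -/

section DataSmooth

variable {E : Type*} [NormedAddCommGroup E] [NormedSpace ℝ E] [FiniteDimensional ℝ E]
  {M : Type*} [TopologicalSpace M] [ChartedSpace E M] [IsManifold 𝓘(ℝ, E) ∞ M]
  {U : Set M} {x : M} {H : Form E M 3 ℝ} {JA JB : EndGT E M} {d : BihermitianData E M}

theorem SmoothOn.add {u v : ∀ x : M, GT (T E x)} (hu : SmoothOn U u) (hv : SmoothOn U v) :
    SmoothOn U (fun x => u x + v x) := ⟨hu.1.add hv.1, hu.2.add hv.2⟩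

theorem SmoothOn.sub {u v : ∀ x : M, GT (T E x)} (hu : SmoothOn U u) (hv : SmoothOn U v) :
    SmoothOn U (fun x => u x - v x) := ⟨hu.1.sub hv.1, hu.2.sub hv.2⟩

namespace IsGeneralizedKahler

/-- Inversion of operators is smooth at invertible ones, and in a chart g is the inverse of the
smooth family `cometric`. -/
theorem smooth_g (h : IsGeneralizedKahler H JA JB) (hd : d.IsDataOf JA JB) (hU : IsOpen U)
    {X : ∀ x : M, T E x} (hX : SmoothFieldOn U X) :
    SmoothFormOn U (fun x => oneForm (d.g x (X x))) := by
  refine smoothFormOn_of_apply hU fun V hV hVU Y hY => contMDiffOn_of_comp_symm hV fun x₀ => ?_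
  have h1 : ContDiffOn ℝ ∞ (fun y => ContinuousLinearMap.inverse (cometric JA JB x₀ y))
      (extChartAt 𝓘(ℝ, E) x₀).target := fun y hy => by
    obtain ⟨e, he⟩ := hd.isInvertible_cometric hy
    have h2 := contDiffAt_map_inverse (𝕜 := ℝ) (n := ∞) e
    rw [he] at h2
    exact h2.comp_contDiffWithinAt y (h.contDiffOn_cometric x₀ y hy)
  have h3 := ((h1.mono Set.inter_subset_left).clm_apply
    (contDiffOn_chartField (hX.mono hVU) x₀)).clm_apply (contDiffOn_chartField (hY 0) x₀)
  refine h3.congr fun y hy => ?_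
  have e : ContinuousLinearMap.inverse (cometric JA JB x₀ y) (chartField X x₀ y) =
      (d.g _ (X ((extChartAt 𝓘(ℝ, E) x₀).symm y))).comp (chartDSymm x₀ y) := by
    rw [chartField, ← hd.cometric_inverse hy.1]
    exact (hd.isInvertible_cometric hy.1).inverse_apply_self _
  rw [e]
  exact congrArg (d.g _ _) (chartDSymm_chartD hy.1 _).symm

/-- X + ι_X b is G(gX), and G preserves smooth sections. -/
theorem smoothOn_gaugeR (h : IsGeneralizedKahler H JA JB) (hd : d.IsDataOf JA JB) (hU : IsOpen U)
    {X : ∀ x : M, T E x} (hX : SmoothFieldOn U X) :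
    SmoothOn U (fun x => gaugeR (d.b x) (X x, 0)) := by
  have h1 := h.smoothOn_genMetric hU (h.smooth_g hd hU hX).pair_zero
  have e : ∀ x, genMetric (JA x) (JB x) (0, d.g x (X x)) = gaugeR (d.b x) (X x, 0) := fun x =>
    (hd.isFibreData x).genMetric_covector (d.Ip_sq x) (d.Im_sq x) _
  simpa only [e] using h1

theorem smooth_b (h : IsGeneralizedKahler H JA JB) (hd : d.IsDataOf JA JB) :
    SmoothFormOn Set.univ d.b := by
  refine smoothFormOn_of_apply isOpen_univ fun V hV _ X hX => ?_
  refine ((h.smoothOn_gaugeR hd hV (hX 0)).2.apply_one hV (hX 1)).congr fun y _ => ?_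
  change _ = (0 + toCovector (interior (X 0 y) (d.b y))) (X 1 y)
  rw [zero_add, toCovector_interior]
  congr 1
  exact List.ofFn_inj.mp rfl

theorem smooth_Ip (h : IsGeneralizedKahler H JA JB) (hd : d.IsDataOf JA JB) :
    IsSmoothEnd d.Ip := fun U hU X hX => by
  have h1 := h.complexA.smooth U hU _
    ((h.smoothOn_gaugeR hd hU hX).add (h.smooth_g hd hU hX).pair_zero)
  have e : ∀ x, JA x (gaugeR (d.b x) (X x, 0) + (0, d.g x (X x))) =
      gaugeR (d.b x) (d.Ip x (X x), d.g x (d.Ip x (X x))) := fun x => by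
    rw [← (hd.isFibreData x).A_pos, ← gaugeR_covector (d.b x), ← gaugeR_add]
    congr 2
    exact Prod.ext (add_zero _) (zero_add _)
  simp only [e] at h1
  exact h1.1

theorem smooth_Im (h : IsGeneralizedKahler H JA JB) (hd : d.IsDataOf JA JB) :
    IsSmoothEnd d.Im := fun U hU X hX => by
  have h1 := h.complexA.smooth U hU _
    ((h.smoothOn_gaugeR hd hU hX).sub (h.smooth_g hd hU hX).pair_zero)
  have e : ∀ x, JA x (gaugeR (d.b x) (X x, 0) - (0, d.g x (X x))) =
      gaugeR (d.b x) (d.Im x (X x), -d.g x (d.Im x (X x))) := fun x => by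
    rw [← (hd.isFibreData x).A_neg, ← gaugeR_covector (d.b x), ← gaugeR_sub]
    congr 2
    exact Prod.ext (sub_zero _) (zero_sub _)
  simp only [e] at h1
  exact h1.1

theorem smooth_omegaP (h : IsGeneralizedKahler H JA JB) (hd : d.IsDataOf JA JB) :
    SmoothFormOn Set.univ d.omegaP :=
  smoothFormOn_of_apply isOpen_univ fun V hV _ _ hX =>
    (h.smooth_g hd hV (h.smooth_Ip hd V hV _ (hX 0))).apply_one hV (hX 1)

theorem smooth_omegaM (h : IsGeneralizedKahler H JA JB) (hd : d.IsDataOf JA JB) :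
    SmoothFormOn Set.univ d.omegaM :=
  smoothFormOn_of_apply isOpen_univ fun V hV _ _ hX =>
    (h.smooth_g hd hV (h.smooth_Im hd V hV _ (hX 0))).apply_one hV (hX 1)

end IsGeneralizedKahler

end DataSmooth

/-! ### The gauge transformation that straightens the intersection to T_{0,1} -/

section Transverse

variable {V : Type*} [AddCommGroup V] [Module ℝ V] [TopologicalSpace V]
  [IsTopologicalAddGroup V] [ContinuousSMul ℝ V]
  {g : V →L[ℝ] V →L[ℝ] ℝ} {J : V →L[ℝ] V} {b σ : V [⋀^Fin 2]→L[ℝ] ℝ} {c : ℂ} {s : ℝ}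

theorem gauge_mkG_gaugeR (hσ : ∀ X Y, σ ![X, Y] = g (J X) Y) (X Y : V) (α β : V →L[ℝ] ℝ) :
    gauge (c • cxForm σ + -cxForm b) (mkG (gaugeR b (X, α)) (gaugeR b (Y, β))) =
      (⟨X, Y⟩, Complex.ofRealCLM.comp α + Complex.I • Complex.ofRealCLM.comp β +
        c • (Complex.ofRealCLM.comp (g (J X)) + Complex.I • Complex.ofRealCLM.comp (g (J Y)))) := by
  refine Prod.ext rfl ?_
  ext Z
  have h : ∀ W : V, (c • cxForm σ + -cxForm b) ![W, Z] = c * (g (J W) Z : ℂ) - (b ![W, Z] : ℂ) :=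
    fun W => by
      rw [← hσ]
      exact (sub_eq_add_neg _ _).symm
  simp only [gauge_apply, mkG, gaugeR, add_apply, smul_apply, toCovector_interiorC, h,
    ContinuousLinearMap.comp_apply, Complex.ofRealCLM_apply, toCovector_interior, smul_eq_mul]
  push_cast
  ring

/-- On the (0,1) vector X + iJX, contraction with cσ = cgJ gives -ic g = -s g, which cancels the
covector part of the lift, while -b undoes the shift by b. The sign s distinguishes the graphs C₊
and C₋. -/
theorem gauge_mkG_same (hJ : ∀ X, J (J X) = -X) (hσ : ∀ X Y, σ ![X, Y] = g (J X) Y)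
    (hc : c = -s * Complex.I) (X : V) :
    gauge (c • cxForm σ + -cxForm b)
      (mkG (gaugeR b (X, s • g X)) (gaugeR b (J X, s • g (J X)))) = (⟨X, J X⟩, 0) := by
  rw [gauge_mkG_gaugeR hσ, hJ, hc]
  refine Prod.ext rfl ?_
  ext Z
  simp only [add_apply, smul_apply, ContinuousLinearMap.comp_apply, Complex.ofRealCLM_apply,
    smul_eq_mul, map_neg, neg_apply, zero_apply]
  push_cast
  linear_combination ((s : ℂ) * (g X Z : ℂ)) * Complex.I_sq

/-- On the graph of the opposite sign nothing cancels; the image supplies the covectors of type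
(1,0). -/
theorem gauge_mkG_opposite (hσ : ∀ X Y, σ ![X, Y] = g (J X) Y) (hc : c = -s * Complex.I) (X : V) :
    gauge (c • cxForm σ + -cxForm b) (mkG (gaugeR b (X, -(s • g X))) 0) =
      (⟨X, 0⟩, (-s : ℂ) •
        (Complex.ofRealCLM.comp (g X) + Complex.I • Complex.ofRealCLM.comp (g (J X)))) := by
  have h0 : (0 : GT V) = gaugeR b (0, 0) := (gaugeR_covector b 0).symm
  rw [h0, gauge_mkG_gaugeR hσ, hc]
  refine Prod.ext rfl ?_
  ext Z
  simp only [add_apply, smul_apply, ContinuousLinearMap.comp_apply, Complex.ofRealCLM_apply,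
    smul_eq_mul, map_zero, neg_apply, zero_apply, Complex.ofReal_neg]
  push_cast
  ring

/-- Complex combinations of the given elements over X and JX isolate the (1,0) vectors and, with the
help of the (0,1) vectors, the covectors gX + ig(JX). By surjectivity of g these are all covectors
of type (1,0). -/
theorem GT10_le_of_mem (hJ : ∀ X, J (J X) = -X) (orth : ∀ X Y, g (J X) (J Y) = g X Y)
    (surj : Function.Surjective g) (hs : s ≠ 0) {S : Submodule ℂ (GTC V)}
    (hT : ∀ X, ((⟨X, J X⟩, 0) : GTC V) ∈ S)
    (hS : ∀ X, ((⟨X, 0⟩, (-s : ℂ) • (Complex.ofRealCLM.comp (g X) +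
      Complex.I • Complex.ofRealCLM.comp (g (J X)))) : GTC V) ∈ S) : GT10 J ≤ S := by
  have h10 : ∀ X, ((⟨X, -J X⟩, 0) : GTC V) ∈ S := fun X => by
    convert S.sub_mem (hS X) (S.smul_mem Complex.I (hS (J X))) using 1
    refine Prod.ext (Cx.ext ?_ ?_) ?_
    · simp
    · simp
    · ext Z
      simp only [hJ, Prod.snd_sub, Prod.smul_snd, sub_apply, add_apply, smul_apply, map_neg,
        neg_apply, ContinuousLinearMap.comp_apply, Complex.ofRealCLM_apply, smul_eq_mul, zero_apply]
      linear_combination ((s : ℂ) * (g X Z : ℂ)) * Complex.I_sq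
  have hcov : ∀ X, ((0, Complex.ofRealCLM.comp (g X) +
      Complex.I • Complex.ofRealCLM.comp (g (J X))) : GTC V) ∈ S := fun X => by
    have hs' : (s : ℂ) ≠ 0 := Complex.ofReal_ne_zero.mpr hs
    have h1 := S.smul_mem (-(1 / (2 * s)) : ℂ)
      (S.sub_mem (S.add_mem (hS X) (S.smul_mem Complex.I (hS (J X)))) (hT X))
    convert h1 using 1
    refine Prod.ext (Cx.ext ?_ ?_) ?_
    · simp
    · simp
    · ext Z
      simp only [hJ, Prod.snd_sub, Prod.snd_add, Prod.smul_snd, sub_apply, add_apply, smul_apply,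
        map_neg, neg_apply, ContinuousLinearMap.comp_apply, Complex.ofRealCLM_apply, smul_eq_mul,
        zero_apply]
      field_simp
      linear_combination ((s : ℂ) * (g X Z : ℂ)) * Complex.I_sq
  rintro ⟨⟨X, Y⟩, β⟩ ⟨hX, hβ⟩
  have hX' : J X = -Y := (mem_T10 hJ).mp hX
  have hβ' := comp_of_mem_annihilator hJ hβ
  -- A matches the real part of β; the imaginary part then agrees because β ∘ J = iβ and g is
  -- J-invariant.
  obtain ⟨A, hA⟩ := surj (Complex.reCLM.comp β)
  have hB : g (J A) = Complex.imCLM.comp β := by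
    ext Z
    have h1 := orth A (J Z)
    have h2 : β (J Z) = Complex.I * β Z := DFunLike.congr_fun hβ' Z
    rw [hJ, map_neg, hA] at h1
    change -g (J A) Z = (β (J Z)).re at h1
    rw [h2] at h1
    simp at h1
    exact h1
  have e : ((⟨X, Y⟩, β) : GTC V) = (⟨X, -J X⟩, 0) + (0, Complex.ofRealCLM.comp (g A) +
      Complex.I • Complex.ofRealCLM.comp (g (J A))) := by
    refine Prod.ext (Cx.ext ?_ ?_) ?_
    · simp
    · simp [hX']
    · rw [hA, hB]
      ext Z
      apply Complex.ext <;> simp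
  rw [e]
  exact S.add_mem (h10 X) (hcov A)

section Pair

variable {P P' : Submodule ℂ (GTC V)}

theorem map_gauge_inf_map_gauge (hJ : ∀ X, J (J X) = -X) (hσ : ∀ X Y, σ ![X, Y] = g (J X) Y)
    (hc : c = -s * Complex.I)
    (hP : ∀ w, w ∈ P ⊓ P' ↔ ∃ X, w = mkG (gaugeR b (X, s • g X)) (gaugeR b (J X, s • g (J X)))) :
    P.map (gauge (c • cxForm σ + -cxForm b)) ⊓ P'.map (gauge (c • cxForm σ + -cxForm b)) =
      (T01 J).prod ⊥ := by
  ext u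
  rw [Submodule.mem_inf, mem_map_gauge, mem_map_gauge, ← Submodule.mem_inf, hP, Submodule.mem_prod,
    mem_T01 hJ, Submodule.mem_bot]
  constructor
  · rintro ⟨X, hX⟩
    have := congrArg (gauge (c • cxForm σ + -cxForm b)) hX
    rw [gauge_gauge_neg, gauge_mkG_same hJ hσ hc] at this
    rw [this]
    exact ⟨rfl, rfl⟩
  · rintro ⟨h1, h2⟩
    refine ⟨u.1.re, ?_⟩
    rw [← gauge_neg_gauge (c • cxForm σ + -cxForm b) (mkG _ _), gauge_mkG_same hJ hσ hc, h1]
    congr 1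
    exact Prod.ext rfl h2

theorem GT10_le_map_gauge_sup (hJ : ∀ X, J (J X) = -X) (orth : ∀ X Y, g (J X) (J Y) = g X Y)
    (surj : Function.Surjective g) (hs : s ≠ 0) (hσ : ∀ X Y, σ ![X, Y] = g (J X) Y)
    (hc : c = -s * Complex.I)
    (hP : ∀ w, w ∈ P ⊓ P' ↔ ∃ X, w = mkG (gaugeR b (X, s • g X)) (gaugeR b (J X, s • g (J X))))
    (hS : ∀ X, mkG (gaugeR b (X, -(s • g X))) 0 ∈ P ⊔ P') :
    GT10 J ≤ P.map (gauge (c • cxForm σ + -cxForm b)) ⊔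
      P'.map (gauge (c • cxForm σ + -cxForm b)) := by
  refine GT10_le_of_mem hJ orth surj hs (fun X => ?_) fun X => ?_
  · have h : ((⟨X, J X⟩, 0) : GTC V) ∈ (T01 J).prod ⊥ := ⟨(mem_T01 hJ).mpr rfl, rfl⟩
    rw [← map_gauge_inf_map_gauge hJ hσ hc hP] at h
    exact Submodule.mem_sup_left h.1
  · rw [← gauge_mkG_opposite (b := b) hσ hc, ← Submodule.map_sup]
    exact Submodule.mem_map_of_mem (hS X)

end Pair

theorem mkG_mem_sup {P P' : Submodule ℂ (GTC V)} {r m : GT V} (h : mkG r m ∈ P)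
    (h' : mkG r (-m) ∈ P') : mkG r 0 ∈ P ⊔ P' := by
  have e : mkG r 0 = (1 / 2 : ℂ) • (mkG r m + mkG r (-m)) := by
    refine Prod.ext (Cx.ext ?_ ?_) ?_
    · simp [mkG]
      module
    · simp [mkG]
    · ext Z
      simp [mkG]
      ring
  rw [e]
  exact Submodule.smul_mem _ _ (Submodule.add_mem_sup h h')

section FibreData

variable {JA JB : GT V →ₗ[ℝ] GT V} {I I' : V →L[ℝ] V}

/-- The vector r and the graph vector over its projection are both fixed by G and differ by a
covector, which is zero by injectivity. -/
theorem IsFibreData.genMetric_pos_iff (h : IsKahlerPair JA JB) (d : IsFibreData JA JB g I I' b)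
    (sq : ∀ X, I (I X) = -X) {r : GT V} :
    genMetric JA JB r = r ↔ r = gaugeR b (r.1, g r.1) := by
  have h1 : ∀ X, genMetric JA JB (gaugeR b (X, g X)) = gaugeR b (X, g X) := fun X => by
    rw [genMetric_apply, d.B_pos, d.A_pos, sq, ← gaugeR_neg]
    congr 1
    refine Prod.ext (neg_neg X) ?_
    change -g (-X) = g X
    rw [map_neg, neg_neg]
  refine ⟨fun hr => ?_, fun hr => by rw [hr]; exact h1 _⟩
  have h2 : ((0, (r - gaugeR b (r.1, g r.1)).2) : GT V) = r - gaugeR b (r.1, g r.1) :=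
    Prod.ext (sub_self _).symm rfl
  have h3 : (genMetric JA JB (0, (r - gaugeR b (r.1, g r.1)).2)).1 =
      (genMetric JA JB (0, 0)).1 := by
    rw [h2, map_sub, hr, h1]
    refine Eq.trans ?_ (congrArg Prod.fst (map_zero (genMetric JA JB))).symm
    exact sub_self r.1
  exact Prod.ext rfl (sub_eq_zero.mp (h.genMetric_covector_injective h3))

theorem IsFibreData.genMetric_neg_iff (h : IsKahlerPair JA JB) (d : IsFibreData JA JB g I I' b)
    (sq' : ∀ X, I' (I' X) = -X) {r : GT V} :
    genMetric JA JB r = -r ↔ r = gaugeR b (r.1, -g r.1) := by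
  have h1 : ∀ X, genMetric JA JB (gaugeR b (X, -g X)) = -gaugeR b (X, -g X) := fun X => by
    rw [genMetric_apply, d.B_neg, map_neg, d.A_neg, sq', neg_neg, ← gaugeR_neg]
    congr 1
    refine Prod.ext rfl ?_
    change -g (-X) = - -g X
    rw [map_neg]
  refine ⟨fun hr => ?_, fun hr => by rw [hr]; exact h1 _⟩
  have h2 : ((0, (r - gaugeR b (r.1, -g r.1)).2) : GT V) = r - gaugeR b (r.1, -g r.1) :=
    Prod.ext (sub_self _).symm rfl
  have h3 : (genMetric JA JB (0, (r - gaugeR b (r.1, -g r.1)).2)).1 =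
      (genMetric JA JB (0, 0)).1 := by
    rw [h2, map_sub, hr, h1]
    refine Eq.trans ?_ (congrArg Prod.fst (map_zero (genMetric JA JB))).symm
    exact sub_self (-r.1)
  exact Prod.ext rfl (sub_eq_zero.mp (h.genMetric_covector_injective h3))

/-- Membership in both conjugate eigenspaces means that `JA` and `JB` take the real part r to the
same vector; then Gr = -`JA JA` r = r, so r lies in C₊, where `JA` is I. -/
theorem IsFibreData.mem_inf_pos (h : IsKahlerPair JA JB) (d : IsFibreData JA JB g I I' b)
    (sq : ∀ X, I (I X) = -X) (w : GTC V) :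
    w ∈ conjSub (eigenG JA) ⊓ conjSub (eigenG JB) ↔
      ∃ X, w = mkG (gaugeR b (X, (1 : ℝ) • g X)) (gaugeR b (I X, (1 : ℝ) • g (I X))) := by
  rw [Submodule.mem_inf, mem_conjSub_eigenG h.sqA, mem_conjSub_eigenG h.sqB]
  simp only [one_smul]
  constructor
  · rintro ⟨hA, hB⟩
    have hr : genMetric JA JB (reG w) = reG w := by
      rw [genMetric_apply, hB, ← hA, h.sqA, neg_neg]
    rw [d.genMetric_pos_iff h sq] at hr
    refine ⟨(reG w).1, ext_re_im (hr.trans (reG_mkG _ _).symm) ?_⟩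
    rw [← hA, imG_mkG, ← d.A_pos, ← hr]
  · rintro ⟨X, rfl⟩
    rw [reG_mkG, imG_mkG, d.A_pos, d.B_pos]
    exact ⟨rfl, rfl⟩

theorem neg_one_smul_covector (α : V →L[ℝ] ℝ) : (-1 : ℝ) • α = -α := by
  ext Z
  simp

/-- Here `JB` takes r to minus its image under `JA`, so Gr = -r. This is why L_B enters without
conjugation for the second complex structure. -/
theorem IsFibreData.mem_inf_neg (h : IsKahlerPair JA JB) (d : IsFibreData JA JB g I I' b)
    (sq' : ∀ X, I' (I' X) = -X) (w : GTC V) :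
    w ∈ conjSub (eigenG JA) ⊓ eigenG JB ↔
      ∃ X, w = mkG (gaugeR b (X, (-1 : ℝ) • g X)) (gaugeR b (I' X, (-1 : ℝ) • g (I' X))) := by
  rw [Submodule.mem_inf, mem_conjSub_eigenG h.sqA, mem_eigenG h.sqB]
  simp only [neg_one_smul_covector]
  constructor
  · rintro ⟨hA, hB⟩
    have hr : genMetric JA JB (reG w) = -reG w := by
      rw [genMetric_apply, hB, map_neg, ← hA, h.sqA, neg_neg]
    rw [d.genMetric_neg_iff h sq'] at hr
    refine ⟨(reG w).1, ext_re_im (hr.trans (reG_mkG _ _).symm) ?_⟩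
    rw [← hA, imG_mkG, ← d.A_neg, ← hr]
  · rintro ⟨X, rfl⟩
    rw [reG_mkG, imG_mkG, d.A_neg, d.B_neg]
    exact ⟨rfl, rfl⟩

/-- On C₋ one has `JB = -JA`, so r + i`JA`r and r - i`JA`r lie in the two conjugate eigenspaces, and
r is their average. -/
theorem IsFibreData.mem_sup_pos (h : IsKahlerPair JA JB) (d : IsFibreData JA JB g I I' b) (X : V) :
    mkG (gaugeR b (X, -((1 : ℝ) • g X))) 0 ∈ conjSub (eigenG JA) ⊔ conjSub (eigenG JB) := by
  refine mkG_mem_sup (m := gaugeR b (I' X, -g (I' X))) ?_ ?_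
  · rw [mem_conjSub_eigenG h.sqA, reG_mkG, imG_mkG, one_smul, d.A_neg]
  · rw [mem_conjSub_eigenG h.sqB, reG_mkG, imG_mkG, one_smul, d.B_neg]

theorem IsFibreData.mem_sup_neg (h : IsKahlerPair JA JB) (d : IsFibreData JA JB g I I' b) (X : V) :
    mkG (gaugeR b (X, -((-1 : ℝ) • g X))) 0 ∈ conjSub (eigenG JA) ⊔ eigenG JB := by
  refine mkG_mem_sup (m := gaugeR b (I X, g (I X))) ?_ ?_
  · rw [mem_conjSub_eigenG h.sqA, reG_mkG, imG_mkG, neg_one_smul_covector, neg_neg, d.A_pos]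
  · rw [mem_eigenG h.sqB, reG_mkG, imG_mkG, neg_one_smul_covector, neg_neg, d.B_pos, neg_neg]

end FibreData

end Transverse

/-! ### The Manin triples and their gauge equivalences -/

section Triples

variable {E : Type*} [NormedAddCommGroup E] [NormedSpace ℝ E] [FiniteDimensional ℝ E]
  {M : Type*} [TopologicalSpace M] [ChartedSpace E M] [IsManifold 𝓘(ℝ, E) ∞ M]
  {x : M} {H : Form E M 3 ℝ}

/-- The two-form `cσ - b`. -/
def splitForm (c : ℂ) (σ b : Form E M 2 ℝ) : Form E M 2 ℂ := fun x =>
  c • cxForm (σ x) + -cxForm (b x)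

variable {σ b : Form E M 2 ℝ}

theorem smooth_splitForm (hσ : SmoothFormOn Set.univ σ) (hb : SmoothFormOn Set.univ b) (c : ℂ) :
    SmoothFormOn Set.univ (splitForm c σ b) := (hσ.cx.smul c).add hb.cx.neg

theorem conjForm_splitForm (c : ℂ) (x : M) :
    conjForm (splitForm c σ b x) = splitForm ((starRingEnd ℂ) c) σ b x := by
  ext v
  change conjL (c * (σ x v : ℂ) + -(b x v : ℂ)) =
    (starRingEnd ℂ) c * (σ x v : ℂ) + -(b x v : ℂ)
  change (starRingEnd ℂ) _ = _
  simp

theorem cxForm_sub_add_smul_extD (hσ : SmoothFormOn Set.univ σ) (hb : SmoothFormOn Set.univ b)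
    (c : ℂ) (x : M) :
    cxForm (H x - extD b x) + c • extD (fun x => cxForm (σ x)) x =
      cxForm (H x) + extD (splitForm c σ b) x := by
  have e : extD (splitForm c σ b) x =
      c • extD (fun x => cxForm (σ x)) x + -cxForm (extD b x) := by
    rw [← extD_cx isOpen_univ trivial hb, ← extD_neg isOpen_univ trivial hb.cx,
      ← extD_smul isOpen_univ trivial hσ.cx]
    exact extD_add isOpen_univ trivial (hσ.cx.smul c) hb.cx.neg
  rw [e]
  ext v
  change ((H x v - extD b x v : ℝ) : ℂ) + _ = (H x v : ℂ) + (_ + -(extD b x v : ℂ))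
  push_cast
  ring

theorem smooth_cxForm_add_extD (hH : SmoothFormOn Set.univ H) {G : Form E M 2 ℂ}
    (hG : SmoothFormOn Set.univ G) : SmoothFormOn Set.univ (fun x => cxForm (H x) + extD G x) :=
  hH.cx.add (hG.extD isOpen_univ)

theorem extD_cxForm_add_extD (hH : SmoothFormOn Set.univ H) (dH : ∀ x, extD H x = 0)
    {G : Form E M 2 ℂ} (hG : SmoothFormOn Set.univ G) (x : M) :
    extD (fun x => cxForm (H x) + extD G x) x = 0 := by
  rw [extD_add isOpen_univ trivial hH.cx (hG.extD isOpen_univ), extD_cx isOpen_univ trivial hH, dH,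
    extD_extD isOpen_univ trivial hG, add_zero]
  ext v
  exact Complex.ofReal_zero

theorem surjective_of_pos {g : T E x →L[ℝ] T E x →L[ℝ] ℝ} (hg : ∀ X, X ≠ 0 → 0 < g X X) :
    Function.Surjective g := by
  have hi : Function.Injective (g : T E x →ₗ[ℝ] T E x →L[ℝ] ℝ) :=
    (injective_iff_map_eq_zero _).mpr fun X hX => by
      by_contra hne
      have h1 : g X = 0 := hX
      have := hg X hne
      rw [h1] at this
      exact this.false
  have hr : Module.finrank ℝ (T E x) = Module.finrank ℝ (T E x →L[ℝ] ℝ) := by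
    rw [← (LinearMap.toContinuousLinearMap (𝕜 := ℝ) (E := T E x) (F' := ℝ)).finrank_eq]
    exact Subspace.dual_finrank_eq.symm
  have : FiniteDimensional ℝ (T E x →L[ℝ] ℝ) :=
    (LinearMap.toContinuousLinearMap (𝕜 := ℝ) (E := T E x) (F' := ℝ)).finiteDimensional
  exact (LinearMap.injective_iff_surjective_of_finrank_eq_finrank hr).mp hi

/-- The gauge transforms of two Dirac structures for a real form `H` by `cσ - b`, where `σ = gJ`,
are a Dirac pair as soon as they meet in `T_{0,1}` and span `𝕋_{1,0}`. -/
theorem isDiracPair {J : EndT E M} {g : ∀ x : M, T E x →L[ℝ] T E x →L[ℝ] ℝ}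
    (sq : ∀ x X, J x (J x X) = -X) (hJ : IsSmoothEnd J)
    (orth : ∀ x X Y, g x (J x X) (J x Y) = g x X Y) (hg : ∀ x X, X ≠ 0 → 0 < g x X X)
    (hσJ : ∀ x X Y, σ x ![X, Y] = g x (J x X) Y)
    (hσ : SmoothFormOn Set.univ σ) (hb : SmoothFormOn Set.univ b)
    {c : ℂ} {s : ℝ} (hs : s ≠ 0) (hc : c = -s * Complex.I) {N N' : Subfamily E M}
    (hN : ∀ x, IsLagrangianIn ⊤ (N x)) (hN' : ∀ x, IsLagrangianIn ⊤ (N' x))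
    (sN : IsSmoothFamily N) (sN' : IsSmoothFamily N')
    (iN : IsInvolutive (fun x => cxForm (H x)) N) (iN' : IsInvolutive (fun x => cxForm (H x)) N')
    (hinf : ∀ x w, w ∈ N x ⊓ N' x ↔ ∃ X, w = mkG (gaugeR (b x) (X, s • g x X))
      (gaugeR (b x) (J x X, s • g x (J x X))))
    (hsup : ∀ x X, mkG (gaugeR (b x) (X, -(s • g x X))) 0 ∈ N x ⊔ N' x) :
    IsDiracPair J (fun x => cxForm (H x - extD b x) + c • extD (fun x => cxForm (σ x)) x)
      (fun x => (N x).map (gauge (splitForm c σ b x)))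
      (fun x => (N' x).map (gauge (splitForm c σ b x))) where
  sq := sq
  smooth := hJ
  lagrangian x := (hN x).map_gauge _
  lagrangian' x := (hN' x).map_gauge _
  smoothFamily := sN.map_gauge (smooth_splitForm hσ hb c)
  smoothFamily' := sN'.map_gauge (smooth_splitForm hσ hb c)
  involutive := iN.map_gauge (smooth_splitForm hσ hb c) (cxForm_sub_add_smul_extD hσ hb c)
  involutive' := iN'.map_gauge (smooth_splitForm hσ hb c) (cxForm_sub_add_smul_extD hσ hb c)
  inf x := map_gauge_inf_map_gauge (sq x) (hσJ x) hc (hinf x)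
  span x := GT10_le_map_gauge_sup (sq x) (orth x) (surjective_of_pos (hg x)) hs (hσJ x) hc (hinf x)
    (hsup x)

/-- The matched pairs of the Manin triple `t` are the gauge transforms by `G` of two families for
the real three-form `H`. -/
structure IsGaugeOf (H : Form E M 3 ℝ) (N N' : Subfamily E M) (G : Form E M 2 ℂ)
    (t : ManinTriple E M) : Prop where
  smooth : SmoothFormOn Set.univ G
  sq : ∀ x X, t.J x (t.J x X) = -X
  curv : ∀ x, t.curv x = cxForm (H x) + extD G x
  LA : ∀ x, t.LA x = (N x).map (gauge (G x))
  LB : ∀ x, t.LB x = (N' x).map (gauge (G x))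

namespace IsGaugeOf

variable {N N' N'' : Subfamily E M} {F G G' : Form E M 2 ℂ} {t t' : ManinTriple E M}

theorem conj (p : IsGaugeOf H N N' G t) : IsGaugeOf H (fun x => conjSub (N x))
    (fun x => conjSub (N' x)) (fun x => conjForm (G x)) t.conj where
  smooth := p.smooth.comp_clm conjL
  sq x X := by
    change -t.J x (-t.J x X) = -X
    rw [map_neg, p.sq, neg_neg]
  curv x := by
    change conjForm (t.curv x) = _
    have e : extD (fun x => conjForm (G x)) x = conjForm (extD G x) :=
      extD_comp_clm isOpen_univ trivial p.smooth conjL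
    rw [e, p.curv]
    ext v
    change conjL ((H x v : ℂ) + extD G x v) = (H x v : ℂ) + conjL (extD G x v)
    rw [map_add]
    congr 1
    exact Complex.conj_ofReal _
  LA x := by
    rw [← conjSub_map_gauge, ← p.LA]
    exact matched_conj (p.sq x) _
  LB x := by
    rw [← conjSub_map_gauge, ← p.LB]
    exact matched_conj (p.sq x) _

theorem isGaugeEquiv {N₁ N₁' : Subfamily E M} (p : IsGaugeOf H N N' G t)
    (p' : IsGaugeOf H N₁ N₁' G' t') (hF : ∀ x, F x + G x = G' x) :
    IsGaugeEquiv F t.curv t'.curv := by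
  have e : F = fun x => G' x - G x := funext fun x => eq_sub_of_add_eq (hF x)
  have hFs : SmoothFormOn Set.univ F := e ▸ p'.smooth.sub p.smooth
  refine GenKahler.isGaugeEquiv hFs fun x => ?_
  have e' : G' = fun x => F x + G x := funext fun x => (hF x).symm
  rw [p.curv, p'.curv, e', extD_add isOpen_univ trivial hFs p.smooth, add_assoc,
    add_comm (extD F x)]

/-- Both triples start from the same family N, so the difference of their gauge forms matches its
transforms. Were it also to match those of N' and N'', injectivity of gauge transformations would
force N' = N''. -/
theorem gaugeEquivA (p : IsGaugeOf H N N' G t) (p' : IsGaugeOf H N N'' G' t')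
    (hF : ∀ x, F x + G x = G' x) (hne : Nontrivial E → ∀ x, N' x ≠ N'' x) :
    GaugeEquivA F t t' := by
  refine ⟨p.isGaugeEquiv p' hF, fun x => ?_, fun hE x h => ?_⟩
  · rw [p.LA, p'.LA, map_gauge_map_gauge, hF]
  · rw [p.LB, p'.LB, map_gauge_map_gauge, hF] at h
    exact hne hE x (map_gauge_injective _ h)

theorem gaugeEquivB (p : IsGaugeOf H N N' G t) (p' : IsGaugeOf H N'' N' G' t')
    (hF : ∀ x, F x + G x = G' x) (hne : Nontrivial E → ∀ x, N x ≠ N'' x) :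
    GaugeEquivB F t t' := by
  refine ⟨p.isGaugeEquiv p' hF, fun x => ?_, fun hE x h => ?_⟩
  · rw [p.LB, p'.LB, map_gauge_map_gauge, hF]
  · rw [p.LA, p'.LA, map_gauge_map_gauge, hF] at h
    exact hne hE x (map_gauge_injective _ h)

end IsGaugeOf

theorem IsDiracPair.isGaugeOf {J : EndT E M} {K : Form E M 3 ℂ} {N N' : Subfamily E M}
    {G : Form E M 2 ℂ} (hG : SmoothFormOn Set.univ G)
    (h : IsDiracPair J K (fun x => (N x).map (gauge (G x))) (fun x => (N' x).map (gauge (G x))))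
    (hK : ∀ x, K x = cxForm (H x) + extD G x) :
    IsGaugeOf H N N' G ⟨J, K, fun x => GT10 (J x) ⊓ (N x).map (gauge (G x)),
      fun x => GT10 (J x) ⊓ (N' x).map (gauge (G x))⟩ where
  smooth := hG
  sq := h.sq
  curv := hK
  LA x := matched_inf (h.sq x) (h.lagrangian x) (h.le x)
  LB x := matched_inf (h.sq x) (h.lagrangian' x) (h.symm.le x)

theorem conjSub_eigenbundle (J : EndGT E M) (b : Form E M 2 ℝ) (x : M) :
    conjSub (eigenbundle J b x) = (conjSub (eigenG (J x))).map (gauge (-cxForm (b x))) := by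
  rw [eigenbundle, conjSub_map_gauge]
  congr 2
  ext v
  change conjL (-(b x v : ℂ)) = -(b x v : ℂ)
  rw [map_neg]
  congr 1
  exact Complex.conj_ofReal _

variable {JA JB : EndGT E M} {d : BihermitianData E M}

namespace IsGeneralizedKahler

theorem isDiracPairP (h : IsGeneralizedKahler H JA JB) (hd : d.IsDataOf JA JB) :
    IsDiracPair d.Ip (fun x => cxForm (H x - extD d.b x) +
        (-Complex.I) • extD (fun x => cxForm (d.omegaP x)) x)
      (fun x => (conjSub (eigenG (JA x))).map (gauge (splitForm (-Complex.I) d.omegaP d.b x)))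
      (fun x => (conjSub (eigenG (JB x))).map (gauge (splitForm (-Complex.I) d.omegaP d.b x))) :=
  isDiracPair (s := 1) d.Ip_sq (h.smooth_Ip hd) d.g_Ip d.g_pos (fun _ _ _ => rfl)
    (h.smooth_omegaP hd) (h.smooth_b hd) one_ne_zero (by simp)
    (fun x => (h.complexA.lagrangian x).conjSub) (fun x => (h.complexB.lagrangian x).conjSub)
    h.complexA.isSmoothFamily.conjSub h.complexB.isSmoothFamily.conjSub
    h.complexA.involutive.conjSub h.complexB.involutive.conjSub
    (fun x => (hd.isFibreData x).mem_inf_pos (h.isKahlerPair x) (d.Ip_sq x))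
    (fun x => (hd.isFibreData x).mem_sup_pos (h.isKahlerPair x))

/-- With s = -1 the lifts lie in C₋ and the two-form is iω₋ - b. -/
theorem isDiracPairM (h : IsGeneralizedKahler H JA JB) (hd : d.IsDataOf JA JB) :
    IsDiracPair d.Im (fun x => cxForm (H x - extD d.b x) +
        Complex.I • extD (fun x => cxForm (d.omegaM x)) x)
      (fun x => (conjSub (eigenG (JA x))).map (gauge (splitForm Complex.I d.omegaM d.b x)))
      (fun x => (eigenG (JB x)).map (gauge (splitForm Complex.I d.omegaM d.b x))) :=
  isDiracPair (s := -1) d.Im_sq (h.smooth_Im hd) d.g_Im d.g_pos (fun _ _ _ => rfl)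
    (h.smooth_omegaM hd) (h.smooth_b hd) (by norm_num) (by simp)
    (fun x => (h.complexA.lagrangian x).conjSub) h.complexB.lagrangian
    h.complexA.isSmoothFamily.conjSub h.complexB.isSmoothFamily
    h.complexA.involutive.conjSub h.complexB.involutive
    (fun x => (hd.isFibreData x).mem_inf_neg (h.isKahlerPair x) (d.Im_sq x))
    (fun x => (hd.isFibreData x).mem_sup_neg (h.isKahlerPair x))

theorem curvatureP (h : IsGeneralizedKahler H JA JB) (hd : d.IsDataOf JA JB) (x : M) :
    cxForm (H x - extD d.b x) = (-(-Complex.I)) • (delbar d.Ip (fun x => cxForm (d.omegaP x)) x -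
      del d.Ip (fun x => cxForm (d.omegaP x)) x) ∧
    cxForm (H x - extD d.b x) + (-Complex.I) • extD (fun x => cxForm (d.omegaP x)) x =
      (2 * (-Complex.I)) • del d.Ip (fun x => cxForm (d.omegaP x)) x :=
  (h.isDiracPairP hd).curvature (H := fun x => H x - extD d.b x) (by simp) (h.smooth_omegaP hd)
    (fun x X Y => by
      change d.g x (d.Ip x (d.Ip x X)) (d.Ip x Y) = d.g x (d.Ip x X) Y
      exact d.g_Ip x _ _) x

theorem curvatureM (h : IsGeneralizedKahler H JA JB) (hd : d.IsDataOf JA JB) (x : M) :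
    cxForm (H x - extD d.b x) = (-Complex.I) • (delbar d.Im (fun x => cxForm (d.omegaM x)) x -
      del d.Im (fun x => cxForm (d.omegaM x)) x) ∧
    cxForm (H x - extD d.b x) + Complex.I • extD (fun x => cxForm (d.omegaM x)) x =
      (2 * Complex.I) • del d.Im (fun x => cxForm (d.omegaM x)) x :=
  (h.isDiracPairM hd).curvature (H := fun x => H x - extD d.b x) (by simp) (h.smooth_omegaM hd)
    (fun x X Y => by
      change d.g x (d.Im x (d.Im x X)) (d.Im x Y) = d.g x (d.Im x X) Y
      exact d.g_Im x _ _) x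

theorem isBihermitian (h : IsGeneralizedKahler H JA JB) (hd : d.IsDataOf JA JB) :
    d.IsBihermitian H where
  smooth_g _ hU _ hX := h.smooth_g hd hU hX
  smooth_b := h.smooth_b hd
  complexP := (h.isDiracPairP hd).isComplexStructure
  complexM := (h.isDiracPairM hd).isComplexStructure
  dcP x := by
    rw [(h.curvatureP hd x).1, neg_neg]
    rfl
  dcM x := by
    rw [(h.curvatureM hd x).1]
    ext v
    exact (neg_mul _ _).symm

/-- The type comparison replaces -2i∂₊ω₊ by H - db - i dω₊, a form visibly closed and visibly
related to H by a gauge transformation; the splitting by b and e^{-iω₊} merge into one gauge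
transformation. -/
theorem maninP_eq (h : IsGeneralizedKahler H JA JB) (hd : d.IsDataOf JA JB) :
    maninP JA JB d = ⟨d.Ip, fun x => cxForm (H x - extD d.b x) +
        (-Complex.I) • extD (fun x => cxForm (d.omegaP x)) x,
      fun x => GT10 (d.Ip x) ⊓
        (conjSub (eigenG (JA x))).map (gauge (splitForm (-Complex.I) d.omegaP d.b x)),
      fun x => GT10 (d.Ip x) ⊓
        (conjSub (eigenG (JB x))).map (gauge (splitForm (-Complex.I) d.omegaP d.b x))⟩ := by
  rw [maninP]
  congr 1
  · funext x
    rw [(h.curvatureP hd x).2]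
    congr 1
    ring
  · funext x
    rw [conjSub_eigenbundle, map_gauge_map_gauge]
    rfl
  · funext x
    rw [conjSub_eigenbundle, map_gauge_map_gauge]
    rfl

theorem maninM_eq (h : IsGeneralizedKahler H JA JB) (hd : d.IsDataOf JA JB) :
    maninM JA JB d = ⟨d.Im, fun x => cxForm (H x - extD d.b x) +
        Complex.I • extD (fun x => cxForm (d.omegaM x)) x,
      fun x => GT10 (d.Im x) ⊓
        (conjSub (eigenG (JA x))).map (gauge (splitForm Complex.I d.omegaM d.b x)),
      fun x => GT10 (d.Im x) ⊓
        (eigenG (JB x)).map (gauge (splitForm Complex.I d.omegaM d.b x))⟩ := by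
  rw [maninM]
  congr 1
  · funext x
    rw [(h.curvatureM hd x).2]
  · funext x
    rw [conjSub_eigenbundle, map_gauge_map_gauge]
    rfl
  · funext x
    rw [eigenbundle, map_gauge_map_gauge]
    rfl

theorem isHolomorphicP (h : IsGeneralizedKahler H JA JB) (hd : d.IsDataOf JA JB)
    (hH : SmoothFormOn Set.univ H) (dH : ∀ x, extD H x = 0) :
    (maninP JA JB d).IsHolomorphic := by
  have hs := smooth_splitForm (h.smooth_omegaP hd) (h.smooth_b hd) (-Complex.I)
  have e := funext (cxForm_sub_add_smul_extD (H := H) (h.smooth_omegaP hd) (h.smooth_b hd)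
    (-Complex.I))
  rw [h.maninP_eq hd]
  refine (h.isDiracPairP hd).isHolomorphic ?_ ?_
  · rw [e]
    exact smooth_cxForm_add_extD hH hs
  · rw [e]
    exact extD_cxForm_add_extD hH dH hs

theorem isHolomorphicM (h : IsGeneralizedKahler H JA JB) (hd : d.IsDataOf JA JB)
    (hH : SmoothFormOn Set.univ H) (dH : ∀ x, extD H x = 0) :
    (maninM JA JB d).IsHolomorphic := by
  have hs := smooth_splitForm (h.smooth_omegaM hd) (h.smooth_b hd) Complex.I
  have e := funext (cxForm_sub_add_smul_extD (H := H) (h.smooth_omegaM hd) (h.smooth_b hd)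
    Complex.I)
  rw [h.maninM_eq hd]
  refine (h.isDiracPairM hd).isHolomorphic ?_ ?_
  · rw [e]
    exact smooth_cxForm_add_extD hH hs
  · rw [e]
    exact extD_cxForm_add_extD hH dH hs

theorem isGaugeOfP (h : IsGeneralizedKahler H JA JB) (hd : d.IsDataOf JA JB) :
    IsGaugeOf H (fun x => conjSub (eigenG (JA x))) (fun x => conjSub (eigenG (JB x)))
      (splitForm (-Complex.I) d.omegaP d.b) (maninP JA JB d) := by
  rw [h.maninP_eq hd]
  exact (h.isDiracPairP hd).isGaugeOf (smooth_splitForm (h.smooth_omegaP hd) (h.smooth_b hd) _)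
    (cxForm_sub_add_smul_extD (h.smooth_omegaP hd) (h.smooth_b hd) _)

theorem isGaugeOfM (h : IsGeneralizedKahler H JA JB) (hd : d.IsDataOf JA JB) :
    IsGaugeOf H (fun x => conjSub (eigenG (JA x))) (fun x => eigenG (JB x))
      (splitForm Complex.I d.omegaM d.b) (maninM JA JB d) := by
  rw [h.maninM_eq hd]
  exact (h.isDiracPairM hd).isGaugeOf (smooth_splitForm (h.smooth_omegaM hd) (h.smooth_b hd) _)
    (cxForm_sub_add_smul_extD (h.smooth_omegaM hd) (h.smooth_b hd) _)

/-- Conjugation exchanges each eigenbundle with its conjugate and, since ω₊ and b are real, only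
replaces -i by i in the gauge form. -/
theorem isGaugeOfP_conj (h : IsGeneralizedKahler H JA JB) (hd : d.IsDataOf JA JB) :
    IsGaugeOf H (fun x => eigenG (JA x)) (fun x => eigenG (JB x))
      (splitForm Complex.I d.omegaP d.b) (maninP JA JB d).conj := by
  simpa only [conjSub_conjSub, conjForm_splitForm, map_neg, Complex.conj_I, neg_neg]
    using (h.isGaugeOfP hd).conj

theorem isGaugeOfM_conj (h : IsGeneralizedKahler H JA JB) (hd : d.IsDataOf JA JB) :
    IsGaugeOf H (fun x => eigenG (JA x)) (fun x => conjSub (eigenG (JB x)))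
      (splitForm (-Complex.I) d.omegaM d.b) (maninM JA JB d).conj := by
  simpa only [conjSub_conjSub, conjForm_splitForm, map_neg, Complex.conj_I, neg_neg]
    using (h.isGaugeOfM hd).conj

end IsGeneralizedKahler

theorem IsGeneralizedComplex.eigenG_ne_conjSub {J : EndGT E M} (h : IsGeneralizedComplex H J)
    (hE : Nontrivial E) (x : M) : eigenG (J x) ≠ conjSub (eigenG (J x)) :=
  have : Nontrivial (T E x) := hE
  GenKahler.eigenG_ne_conjSub (h.sq x)

theorem vertical_add (d : BihermitianData E M) (x : M) : d.vertical x +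
    splitForm Complex.I d.omegaM d.b x = splitForm (-Complex.I) d.omegaP d.b x := by
  ext v
  change -Complex.I * ((d.omegaP x v + d.omegaM x v : ℝ) : ℂ) +
    (Complex.I * (d.omegaM x v : ℂ) + -(d.b x v : ℂ)) =
    -Complex.I * (d.omegaP x v : ℂ) + -(d.b x v : ℂ)
  push_cast
  ring

theorem vertical_add_conj (d : BihermitianData E M) (x : M) : d.vertical x +
    splitForm Complex.I d.omegaP d.b x = splitForm (-Complex.I) d.omegaM d.b x := by
  ext v
  change -Complex.I * ((d.omegaP x v + d.omegaM x v : ℝ) : ℂ) +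
    (Complex.I * (d.omegaP x v : ℂ) + -(d.b x v : ℂ)) =
    -Complex.I * (d.omegaM x v : ℂ) + -(d.b x v : ℂ)
  push_cast
  ring

theorem horizontal_add (d : BihermitianData E M) (x : M) : d.horizontal x +
    splitForm (-Complex.I) d.omegaP d.b x = splitForm (-Complex.I) d.omegaM d.b x := by
  ext v
  change Complex.I * ((d.omegaP x v - d.omegaM x v : ℝ) : ℂ) +
    (-Complex.I * (d.omegaP x v : ℂ) + -(d.b x v : ℂ)) =
    -Complex.I * (d.omegaM x v : ℂ) + -(d.b x v : ℂ)
  push_cast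
  ring

theorem horizontal_add_conj (d : BihermitianData E M) (x : M) : d.horizontal x +
    splitForm Complex.I d.omegaM d.b x = splitForm Complex.I d.omegaP d.b x := by
  ext v
  change Complex.I * ((d.omegaP x v - d.omegaM x v : ℝ) : ℂ) +
    (Complex.I * (d.omegaM x v : ℂ) + -(d.b x v : ℂ)) =
    Complex.I * (d.omegaP x v : ℂ) + -(d.b x v : ℂ)
  push_cast
  ring

end Triples

end GenKahler

end

theorem mainTheorem5
    {E : Type*} [NormedAddCommGroup E] [NormedSpace ℝ E] [FiniteDimensional ℝ E]
    {M : Type*} [TopologicalSpace M] [ChartedSpace E M] [IsManifold 𝓘(ℝ, E) ∞ M]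
    (H : GenKahler.Form E M 3 ℝ) (H_smooth : GenKahler.SmoothFormOn Set.univ H)
    (H_closed : ∀ x, GenKahler.extD H x = 0)
    (JA JB : GenKahler.EndGT E M) (hJ : GenKahler.IsGeneralizedKahler H JA JB) :
    (∃! d : GenKahler.BihermitianData E M, d.IsDataOf JA JB) ∧
    ∀ d : GenKahler.BihermitianData E M, d.IsDataOf JA JB →
      d.IsBihermitian H ∧
      (GenKahler.maninP JA JB d).IsHolomorphic ∧
      (GenKahler.maninM JA JB d).IsHolomorphic ∧
      GenKahler.GaugeEquivA d.vertical
        (GenKahler.maninM JA JB d) (GenKahler.maninP JA JB d) ∧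
      GenKahler.GaugeEquivA d.vertical
        (GenKahler.maninP JA JB d).conj (GenKahler.maninM JA JB d).conj ∧
      GenKahler.GaugeEquivB d.horizontal
        (GenKahler.maninP JA JB d) (GenKahler.maninM JA JB d).conj ∧
      GenKahler.GaugeEquivB d.horizontal
        (GenKahler.maninM JA JB d) (GenKahler.maninP JA JB d).conj := by
  refine ⟨hJ.existsUnique_data, fun d hd => ⟨hJ.isBihermitian hd,
    hJ.isHolomorphicP hd H_smooth H_closed, hJ.isHolomorphicM hd H_smooth H_closed, ?_, ?_, ?_, ?_⟩⟩
  -- In the vertical cases the triples share the conjugate of L_A or L_A itself, and L_B faces its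
  -- conjugate; in the horizontal cases A and B are exchanged.
  · exact (hJ.isGaugeOfM hd).gaugeEquivA (hJ.isGaugeOfP hd) (GenKahler.vertical_add d)
      hJ.complexB.eigenG_ne_conjSub
  · exact (hJ.isGaugeOfP_conj hd).gaugeEquivA (hJ.isGaugeOfM_conj hd)
      (GenKahler.vertical_add_conj d) hJ.complexB.eigenG_ne_conjSub
  · exact (hJ.isGaugeOfP hd).gaugeEquivB (hJ.isGaugeOfM_conj hd) (GenKahler.horizontal_add d)
      fun hE x => (hJ.complexA.eigenG_ne_conjSub hE x).symm
  · exact (hJ.isGaugeOfM hd).gaugeEquivB (hJ.isGaugeOfP_conj hd)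
      (GenKahler.horizontal_add_conj d) fun hE x => (hJ.complexA.eigenG_ne_conjSub hE x).symm
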